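/- Let $N\ge 1$ and let $q\in\mathbb C$ satisfy $q^N=(-1)^{N+1}$, with $q^2$ a primitive $N$-th root of unity. **The Weyl algebra.** Let $\mathcal W$ be the complex algebra generated by $X^{\pm1},Y$ with $XY=q^2YX$, with comultiplication $\Delta(X)=X\otimes X$, $\Delta(Y)=X^{-1}\otimes Y+Y\otimes 1$; it acts on tensor products of representations through $\Delta$. A representation is *cyclic* if its space is finite dimensional and $X,Y$ act invertibly. A pair $(\mu,\nu)$ of cyclic representations is *regular* if $\mu\otimes\nu$ is cyclic; a triple $(\mu,\nu,\sigma)$ of cyclic representations is regular if $\mu\otimes\nu$, $\nu\otimes\sigma$ and $\mu\otimes\nu\otimes\sigma$ are cyclic. On an irreducible cyclic representation $\mu$, $X^N$ and $Y^N$ act by scalars $x_\mu,y_\mu\in\mathbb C^*$, which determine $\mu$ up to isomorphism. For a regular pair $(\mu,\nu)$ of irreducible representations, $\mu\nu$ is the irreducible cyclic representation with $x_{\mu\nu}=x_\mu x_\nu$, $y_{\mu\nu}=x_\mu^{-1}y_\nu+y_\mu$. Let $V_{(\mu,\nu)}=\mathrm{Hom}_{\mathcal W}(V_{\mu\nu},V_\mu\otimes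 V_\nu)$, with the action of $\mathcal W$ $$X\cdot f=(X_\mu^{-1}\otimes \mathrm{Id}+Y_\mu\otimes Y_\nu^{-1})^{-1}\circ f,\qquad Y\cdot f=(q^{-1}Y_\mu\otimes X_\nu^{-1}Y_\nu^{-1})\circ f,$$ and let $\Omega(\mu,\nu):V_{(\mu,\nu)}\otimes V_{\mu\nu}\to V_\mu\otimes V_\nu$, $f\otimes v\mapsto f(v)$, be the canonical map. For a regular triple of irreducible representations, Kashaev's $6j$-symbol $R(\mu,\nu,\sigma):V_{(\mu,\nu)}\otimes V_{(\mu\nu,\sigma)}\to V_{(\mu,\nu\sigma)}\otimes V_{(\nu,\sigma)}$ is the linear map defined by $\Omega_{23}(\nu,\sigma)\,\Omega_{13}(\mu,\nu\sigma)\,R_{12}(\mu,\nu,\sigma)=\Omega_{12}(\mu,\nu)\,\Omega_{23}(\mu\nu,\sigma)$ on $V_{(\mu,\nu)}\otimes V_{(\mu\nu,\sigma)}\otimes V_{\mu\nu\sigma}$, where the indices give the tensor factors on which a map acts. **The square.** The triangle algebra is generated by $X^{\pm1},Y^{\pm1},Z^{\pm1}$ with $XY=q^2YX$, $YZ=q^2ZY$,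 $ZX=q^2XZ$. An irreducible cyclic representation of $\mathcal W$ gives an irreducible representation of the triangle algebra with $Z=qY^{-1}X^{-1}$. Let the square have vertices $0,1,2,3$ in counterclockwise order, let $\lambda$ be its triangulation into $T_1=012$, $T_2=023$, and $\lambda'$ its triangulation into $T_1'=013$, $T_2'=123$; the edges are $\lambda_1=01$, $\lambda_2=03$, $\lambda_3=23$, $\lambda_4=12$ and the diagonal $\lambda_5=02$, respectively $\lambda_5'=13$. In a triangle with vertices $a<b<c$ the generators $X,Y,Z$ belong to the edges $ab,ac,bc$. The Chekhov–Fock algebra $\mathcal T^q_\lambda$ is generated by $X_1^{\pm1},\dots,X_5^{\pm1}$ with relations $X_iX_j=q^{2\sigma_{ij}}X_jX_i$, where $\sigma_{ij}$ is such that $(X_1,\dots,X_5)\mapsto(X\otimes1,\,1\otimes Y,\,1\otimes Z,\,Z\otimes1,\,Y\otimes X)$ is compatible with the relations of the triangle algebras of $T_1,T_2$; similarly $\mathcal T^q_{\lambda'}$ with $(X_1',\dots,X_5')\mapsto(X\otimes1,\,Y\otimes1,\,1\otimes Z,\,1\otimes X,\,Z\otimes Y)$. Through these embeddings, finite dimensional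 irreducible representations of the two triangle algebras induce a *local representation* of $\mathcal T_\lambda^q$ (of $\mathcal T_{\lambda'}^q$) on the tensor product of their spaces. The coordinate change $\Phi_{\lambda\lambda'}^q$ from $\mathcal T_{\lambda'}^q$ to the fraction division algebra of $\mathcal T_\lambda^q$ is $$X_1'\mapsto(1+qX_5)X_1,\quad X_2'\mapsto(1+qX_5^{-1})^{-1}X_2,\quad X_3'\mapsto(1+qX_5)X_3,\quad X_4'\mapsto(1+qX_5^{-1})^{-1}X_4,\quad X_5'\mapsto X_5^{-1}.$$ An *intertwining operator* between local representations $\rho_\lambda$ and $\rho_{\lambda'}$ is a linear isomorphism $L$ such that for every $X'\in\mathcal T_{\lambda'}^q$ the operator $\rho_\lambda(\Phi_{\lambda\lambda'}^q(X'))$ is defined (that is, $\Phi_{\lambda\lambda'}^q(X')=PQ^{-1}=Q'^{-1}P'$ with $P,Q,P',Q'\in\mathcal T_\lambda^q$ and $\rho_\lambda(Q),\rho_\lambda(Q')$ invertible) and $L\circ\rho_\lambda(\Phi_{\lambda\lambda'}^q(X'))=\rho_{\lambda'}(X')\circ L$. **Theorem.** Let $L:V_1\otimes V_2\to V_1'\otimes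 V_2'$ be a linear map of complex vector spaces. (a) Let each of $V_1,V_2,V_1',V_2'$ carry an action of $\mathcal W$. The following are equivalent. 1. There are a regular pair $(\mu,\nu)$ of irreducible representations of $\mathcal W$ and isomorphisms of $\mathcal W$-spaces $V_1\cong V_{(\mu,\nu)}$, $V_2\cong V_{\mu\nu}$, $V_1'\cong V_\mu$, $V_2'\cong V_\nu$ for which $L$ corresponds to a nonzero scalar multiple of $\Omega(\mu,\nu)$. 2. There are a regular triple $(\mu,\nu,\sigma)$ of irreducible representations of $\mathcal W$ and isomorphisms of $\mathcal W$-spaces $V_1\cong V_{(\mu,\nu)}$, $V_2\cong V_{(\mu\nu,\sigma)}$, $V_1'\cong V_{(\mu,\nu\sigma)}$, $V_2'\cong V_{(\nu,\sigma)}$ for which $L$ corresponds to a nonzero scalar multiple of $R(\mu,\nu,\sigma)$. 3. The four actions are irreducible and cyclic, and $L$ is an intertwining operator between the local representations $\rho_\lambda:\mathcal T_\lambda^q\to\mathrm{End}(V_1\otimes V_2)$ and $\rho_{\lambda'}:\mathcal T_{\lambda'}^q\to\mathrm{End}(V_1'\otimes V_2')$ that they induce. (b) For bare vector spaces the following are equivalent: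 there are actions of $\mathcal W$ on the four spaces for which 1 holds; there are such actions for which 2 holds; $L$ is an intertwining operator between some local representations $\rho_\lambda:\mathcal T_\lambda^q\to\mathrm{End}(V_1\otimes V_2)$ and $\rho_{\lambda'}:\mathcal T_{\lambda'}^q\to\mathrm{End}(V_1'\otimes V_2')$ given by arbitrary finite dimensional irreducible representations of the triangle algebras on the four spaces. -/

import Mathlib

open scoped TensorProduct

universe u

noncomputable section

namespace QTeich

/-- `q` is a primitive `N`-th root of `(-1)^(N+1)`: it is an `N`-th root of `(-1)^(N+1)`, and
`q ^ 2` is a primitive `N`-th root of unity. -/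
structure IsQRoot (N : ℕ) (q : ℂ) : Prop where
  pos : 0 < N
  primitive : IsPrimitiveRoot (q ^ 2) N
  pow_eq : q ^ N = (-1) ^ (N + 1)

theorem IsQRoot.ne_zero {N : ℕ} {q : ℂ} (h : IsQRoot N q) : q ≠ 0 := by
  rintro rfl
  have := h.pow_eq
  rw [zero_pow h.pos.ne'] at this
  exact pow_ne_zero (N + 1) (by norm_num : (-1 : ℂ) ≠ 0) this.symm

/-! ### The Weyl algebra -/

/-- The generators of the Weyl algebra. -/
inductive WeylGen
  | X
  | Xinv
  | Y

/-- The relations of the Weyl algebra: `X` and `Xinv` are inverse to each other, `XY = q²YX`. -/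
inductive WeylRel (q : ℂ) : FreeAlgebra ℂ WeylGen → FreeAlgebra ℂ WeylGen → Prop
  | X_Xinv : WeylRel q (FreeAlgebra.ι ℂ WeylGen.X * FreeAlgebra.ι ℂ WeylGen.Xinv) 1
  | Xinv_X : WeylRel q (FreeAlgebra.ι ℂ WeylGen.Xinv * FreeAlgebra.ι ℂ WeylGen.X) 1
  | X_Y : WeylRel q (FreeAlgebra.ι ℂ WeylGen.X * FreeAlgebra.ι ℂ WeylGen.Y)
      (q ^ 2 • (FreeAlgebra.ι ℂ WeylGen.Y * FreeAlgebra.ι ℂ WeylGen.X))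

/-- The Weyl algebra: the complex algebra generated by `X`, `X⁻¹`, `Y` with `XY = q²YX`. -/
def Weyl (q : ℂ) : Type := RingQuot (WeylRel q)

instance (q : ℂ) : Ring (Weyl q) := inferInstanceAs (Ring (RingQuot (WeylRel q)))

instance (q : ℂ) : Algebra ℂ (Weyl q) := inferInstanceAs (Algebra ℂ (RingQuot (WeylRel q)))

/-- The quotient map from the free algebra. -/
def Weyl.mk (q : ℂ) : FreeAlgebra ℂ WeylGen →ₐ[ℂ] Weyl q := RingQuot.mkAlgHom ℂ (WeylRel q)

namespace Weyl

variable {q : ℂ} {A : Type*} [Ring A] [Algebra ℂ A]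

def gen (q : ℂ) (g : WeylGen) : Weyl q := Weyl.mk q (FreeAlgebra.ι ℂ g)

def X (q : ℂ) : Weyl q := gen q WeylGen.X

def Xinv (q : ℂ) : Weyl q := gen q WeylGen.Xinv

def Y (q : ℂ) : Weyl q := gen q WeylGen.Y

theorem X_mul_Xinv : X q * Xinv q = 1 := by
  have : Weyl.mk q _ = Weyl.mk q _ := RingQuot.mkAlgHom_rel ℂ (WeylRel.X_Xinv (q := q))
  simpa [X, Xinv, gen] using this

theorem Xinv_mul_X : Xinv q * X q = 1 := by
  have : Weyl.mk q _ = Weyl.mk q _ := RingQuot.mkAlgHom_rel ℂ (WeylRel.Xinv_X (q := q))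
  simpa [X, Xinv, gen] using this

theorem X_mul_Y : X q * Y q = q ^ 2 • (Y q * X q) := by
  have : Weyl.mk q _ = Weyl.mk q _ := RingQuot.mkAlgHom_rel ℂ (WeylRel.X_Y (q := q))
  simpa [X, Y, gen] using this

theorem mk_surjective : Function.Surjective (Weyl.mk q) :=
  RingQuot.mkAlgHom_surjective ℂ (WeylRel q)

/-- The values of a homomorphism on the generators. -/
def liftFun (x xi y : A) : WeylGen → A
  | WeylGen.X => x
  | WeylGen.Xinv => xi
  | WeylGen.Y => y

/-- The homomorphism from the Weyl algebra that is given by elements satisfying the relations. -/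
def lift (x xi y : A) (h₁ : x * xi = 1) (h₂ : xi * x = 1) (h₃ : x * y = q ^ 2 • (y * x)) :
    Weyl q →ₐ[ℂ] A :=
  RingQuot.liftAlgHom ℂ ⟨FreeAlgebra.lift ℂ (liftFun x xi y), by
    intro a b hab
    cases hab <;> simp [liftFun, h₁, h₂, h₃]⟩

theorem lift_gen (x xi y : A) (h₁ : x * xi = 1) (h₂ : xi * x = 1)
    (h₃ : x * y = q ^ 2 • (y * x)) (g : WeylGen) :
    lift (q := q) x xi y h₁ h₂ h₃ (gen q g) = liftFun x xi y g :=
  (RingQuot.liftAlgHom_mkAlgHom_apply ..).trans (FreeAlgebra.lift_ι_apply ..)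

@[simp] theorem lift_X (x xi y : A) (h₁ : x * xi = 1) (h₂ : xi * x = 1)
    (h₃ : x * y = q ^ 2 • (y * x)) : lift (q := q) x xi y h₁ h₂ h₃ (X q) = x :=
  lift_gen x xi y h₁ h₂ h₃ WeylGen.X

@[simp] theorem lift_Xinv (x xi y : A) (h₁ : x * xi = 1) (h₂ : xi * x = 1)
    (h₃ : x * y = q ^ 2 • (y * x)) : lift (q := q) x xi y h₁ h₂ h₃ (Xinv q) = xi :=
  lift_gen x xi y h₁ h₂ h₃ WeylGen.Xinv

@[simp] theorem lift_Y (x xi y : A) (h₁ : x * xi = 1) (h₂ : xi * x = 1)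
    (h₃ : x * y = q ^ 2 • (y * x)) : lift (q := q) x xi y h₁ h₂ h₃ (Y q) = y :=
  lift_gen x xi y h₁ h₂ h₃ WeylGen.Y

theorem Y_mul_Xinv : Y q * Xinv q = q ^ 2 • (Xinv q * Y q) := by
  calc Y q * Xinv q = (Xinv q * X q) * Y q * Xinv q := by rw [Xinv_mul_X, one_mul]
    _ = Xinv q * (X q * Y q) * Xinv q := by simp only [mul_assoc]
    _ = q ^ 2 • (Xinv q * Y q * (X q * Xinv q)) := by
      rw [X_mul_Y]; simp only [mul_assoc, mul_smul_comm, smul_mul_assoc]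
    _ = q ^ 2 • (Xinv q * Y q) := by rw [X_mul_Xinv, mul_one]

theorem isUnit_map_X (μ : Weyl q →ₐ[ℂ] A) : IsUnit (μ (X q)) :=
  ⟨⟨μ (X q), μ (Xinv q), by rw [← map_mul, X_mul_Xinv, map_one],
    by rw [← map_mul, Xinv_mul_X, map_one]⟩, rfl⟩

theorem commute_of_gen (μ : Weyl q →ₐ[ℂ] A) (t : A) (hX : Commute t (μ (X q)))
    (hY : Commute t (μ (Y q))) (w : Weyl q) : Commute t (μ w) := by
  have hXi : Commute t (μ (Xinv q)) := by
    have h₁ : μ (X q) * μ (Xinv q) = 1 := by rw [← map_mul, X_mul_Xinv, map_one]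
    have h₂ : μ (Xinv q) * μ (X q) = 1 := by rw [← map_mul, Xinv_mul_X, map_one]
    exact Commute.units_inv_right (u := ⟨μ (X q), μ (Xinv q), h₁, h₂⟩) hX
  obtain ⟨a, rfl⟩ := mk_surjective w
  induction a using FreeAlgebra.induction with
  | grade0 r => rw [AlgHom.commutes, AlgHom.commutes]; exact (Algebra.commutes r t).symm
  | grade1 g =>
    cases g
    · exact hX
    · exact hXi
    · exact hY
  | mul a b ha hb => rw [map_mul, map_mul]; exact ha.mul_right hb
  | add a b ha hb => rw [map_add, map_add]; exact ha.add_right hb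

/-- The comultiplication: `Δ(X) = X ⊗ X`, `Δ(Y) = X⁻¹ ⊗ Y + Y ⊗ 1`. -/
def comul (q : ℂ) : Weyl q →ₐ[ℂ] Weyl q ⊗[ℂ] Weyl q :=
  lift (X q ⊗ₜ X q) (Xinv q ⊗ₜ Xinv q) (Xinv q ⊗ₜ Y q + Y q ⊗ₜ 1)
    (by simp [X_mul_Xinv, Algebra.TensorProduct.one_def])
    (by simp [Xinv_mul_X, Algebra.TensorProduct.one_def])
    (by
      simp only [mul_add, add_mul, Algebra.TensorProduct.tmul_mul_tmul, X_mul_Xinv, Xinv_mul_X,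
        X_mul_Y, mul_one, one_mul, smul_add, TensorProduct.smul_tmul', TensorProduct.tmul_smul])

end Weyl

/-! ### Representations -/

section Representations

variable {q : ℂ} {A : Type*} [Ring A] [Algebra ℂ A]
variable {V V' Vμ Vν Vσ Vκ : Type*}
  [AddCommGroup V] [Module ℂ V] [AddCommGroup V'] [Module ℂ V']
  [AddCommGroup Vμ] [Module ℂ Vμ] [AddCommGroup Vν] [Module ℂ Vν]
  [AddCommGroup Vσ] [Module ℂ Vσ] [AddCommGroup Vκ] [Module ℂ Vκ]

/-- A representation of an algebra is irreducible if the space is nonzero and has no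
invariant subspace except `0` and itself. -/
def IsIrred (μ : A →ₐ[ℂ] Module.End ℂ V) : Prop :=
  Nontrivial V ∧ ∀ p : Submodule ℂ V, (∀ a, ∀ v ∈ p, μ a v ∈ p) → p = ⊥ ∨ p = ⊤

/-- The linear isomorphism `e` is an isomorphism of representations. -/
def IsRepIso (μ : A →ₐ[ℂ] Module.End ℂ V) (μ' : A →ₐ[ℂ] Module.End ℂ V') (e : V ≃ₗ[ℂ] V') :
    Prop :=
  ∀ a v, e (μ a v) = μ' a (e v)

/-- A representation of the Weyl algebra is cyclic if its space is finite dimensional and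
`X`, `Y` act by invertible operators. -/
structure IsCyclic (μ : Weyl q →ₐ[ℂ] Module.End ℂ V) : Prop where
  finite : FiniteDimensional ℂ V
  isUnit_X : IsUnit (μ (Weyl.X q))
  isUnit_Y : IsUnit (μ (Weyl.Y q))

/-- The tensor product of two representations of the Weyl algebra: `W` acts by `Δ(W)`. -/
def tensorRep (μ : Weyl q →ₐ[ℂ] Module.End ℂ Vμ) (ν : Weyl q →ₐ[ℂ] Module.End ℂ Vν) :
    Weyl q →ₐ[ℂ] Module.End ℂ (Vμ ⊗[ℂ] Vν) :=
  ((Module.endTensorEndAlgHom (R := ℂ) (S := ℂ) (A := ℂ)).comp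
    (Algebra.TensorProduct.map μ ν)).comp (Weyl.comul q)

theorem tensorRep_X (μ : Weyl q →ₐ[ℂ] Module.End ℂ Vμ) (ν : Weyl q →ₐ[ℂ] Module.End ℂ Vν) :
    tensorRep μ ν (Weyl.X q) = TensorProduct.map (μ (Weyl.X q)) (ν (Weyl.X q)) := by
  ext; simp [tensorRep, Weyl.comul, Module.endTensorEndAlgHom_apply]

theorem tensorRep_Xinv (μ : Weyl q →ₐ[ℂ] Module.End ℂ Vμ) (ν : Weyl q →ₐ[ℂ] Module.End ℂ Vν) :
    tensorRep μ ν (Weyl.Xinv q) = TensorProduct.map (μ (Weyl.Xinv q)) (ν (Weyl.Xinv q)) := by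
  ext; simp [tensorRep, Weyl.comul, Module.endTensorEndAlgHom_apply]

theorem tensorRep_Y (μ : Weyl q →ₐ[ℂ] Module.End ℂ Vμ) (ν : Weyl q →ₐ[ℂ] Module.End ℂ Vν) :
    tensorRep μ ν (Weyl.Y q) =
      TensorProduct.map (μ (Weyl.Xinv q)) (ν (Weyl.Y q)) + TensorProduct.map (μ (Weyl.Y q)) 1 := by
  ext; simp [tensorRep, Weyl.comul, Module.endTensorEndAlgHom_apply]

/-- A regular pair of representations of the Weyl algebra. -/
structure IsRegularPair (μ : Weyl q →ₐ[ℂ] Module.End ℂ Vμ) (ν : Weyl q →ₐ[ℂ] Module.End ℂ Vν) :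
    Prop where
  left : IsCyclic μ
  right : IsCyclic ν
  tensor : IsCyclic (tensorRep μ ν)

/-- A regular triple of representations of the Weyl algebra. -/
structure IsRegularTriple (μ : Weyl q →ₐ[ℂ] Module.End ℂ Vμ) (ν : Weyl q →ₐ[ℂ] Module.End ℂ Vν)
    (σ : Weyl q →ₐ[ℂ] Module.End ℂ Vσ) : Prop where
  fst : IsCyclic μ
  snd : IsCyclic ν
  thd : IsCyclic σ
  tensor₁₂ : IsCyclic (tensorRep μ ν)
  tensor₂₃ : IsCyclic (tensorRep ν σ)
  tensor₁₂₃ : IsCyclic (tensorRep (tensorRep μ ν) σ)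

/-- The parameters `x`, `y` of a representation: `X ^ N` acts by `x` and `Y ^ N` by `y`. -/
def HasParams (N : ℕ) (μ : Weyl q →ₐ[ℂ] Module.End ℂ V) (x y : ℂ) : Prop :=
  μ (Weyl.X q) ^ N = x • (1 : Module.End ℂ V) ∧ μ (Weyl.Y q) ^ N = y • (1 : Module.End ℂ V)

/-- `κ` is the representation `μν`, which is determined up to isomorphism: it is irreducible and
cyclic, with parameters `x_μ x_ν` and `x_μ⁻¹ y_ν + y_μ`. -/
structure IsProductRep (N : ℕ) (μ : Weyl q →ₐ[ℂ] Module.End ℂ Vμ)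
    (ν : Weyl q →ₐ[ℂ] Module.End ℂ Vν) (κ : Weyl q →ₐ[ℂ] Module.End ℂ Vκ) : Prop where
  irred : IsIrred κ
  cyclic : IsCyclic κ
  params : ∃ xμ yμ xν yν : ℂ, HasParams N μ xμ yμ ∧ HasParams N ν xν yν ∧
    HasParams N κ (xμ * xν) (xμ⁻¹ * yν + yμ)

/-- The `W`-equivariant linear maps `V_κ → V_μ ⊗ V_ν`. -/
def cgSubmodule (μ : Weyl q →ₐ[ℂ] Module.End ℂ Vμ) (ν : Weyl q →ₐ[ℂ] Module.End ℂ Vν)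
    (κ : Weyl q →ₐ[ℂ] Module.End ℂ Vκ) : Submodule ℂ (Vκ →ₗ[ℂ] Vμ ⊗[ℂ] Vν) where
  carrier := {f | ∀ w v, f (κ w v) = tensorRep μ ν w (f v)}
  zero_mem' := by simp
  add_mem' := by
    intro f g hf hg w v
    simp [hf w v, hg w v]
  smul_mem' := by
    intro c f hf w v
    simp [hf w v]

/-- The space `V_(μ,ν) = Hom_W(V_μν, V_μ ⊗ V_ν)` of Clebsch-Gordan operators, where `κ` stands
for the representation `μν`. -/
def cgSpace (μ : Weyl q →ₐ[ℂ] Module.End ℂ Vμ) (ν : Weyl q →ₐ[ℂ] Module.End ℂ Vν)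
    (κ : Weyl q →ₐ[ℂ] Module.End ℂ Vκ) : Type _ := cgSubmodule μ ν κ

instance (μ : Weyl q →ₐ[ℂ] Module.End ℂ Vμ) (ν : Weyl q →ₐ[ℂ] Module.End ℂ Vν)
    (κ : Weyl q →ₐ[ℂ] Module.End ℂ Vκ) : AddCommGroup (cgSpace μ ν κ) :=
  inferInstanceAs (AddCommGroup (cgSubmodule μ ν κ))

instance (μ : Weyl q →ₐ[ℂ] Module.End ℂ Vμ) (ν : Weyl q →ₐ[ℂ] Module.End ℂ Vν)
    (κ : Weyl q →ₐ[ℂ] Module.End ℂ Vκ) : Module ℂ (cgSpace μ ν κ) :=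
  inferInstanceAs (Module ℂ (cgSubmodule μ ν κ))

/-- The linear map `V_κ → V_μ ⊗ V_ν` underlying a Clebsch-Gordan operator. -/
def cgSpace.toHom (μ : Weyl q →ₐ[ℂ] Module.End ℂ Vμ) (ν : Weyl q →ₐ[ℂ] Module.End ℂ Vν)
    (κ : Weyl q →ₐ[ℂ] Module.End ℂ Vκ) : cgSpace μ ν κ →ₗ[ℂ] (Vκ →ₗ[ℂ] Vμ ⊗[ℂ] Vν) :=
  (cgSubmodule μ ν κ).subtype

/-- The canonical map `Ω(μ,ν) : V_(μ,ν) ⊗ V_μν → V_μ ⊗ V_ν`, `f ⊗ v ↦ f(v)`. -/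
def canonicalMap (μ : Weyl q →ₐ[ℂ] Module.End ℂ Vμ) (ν : Weyl q →ₐ[ℂ] Module.End ℂ Vν)
    (κ : Weyl q →ₐ[ℂ] Module.End ℂ Vκ) : cgSpace μ ν κ ⊗[ℂ] Vκ →ₗ[ℂ] Vμ ⊗[ℂ] Vν :=
  TensorProduct.lift (cgSpace.toHom μ ν κ)

/-- The operator `X_μ⁻¹ ⊗ 1 + Y_μ ⊗ Y_ν⁻¹`. -/
def cgOpX (μ : Weyl q →ₐ[ℂ] Module.End ℂ Vμ) (ν : Weyl q →ₐ[ℂ] Module.End ℂ Vν) :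
    Module.End ℂ (Vμ ⊗[ℂ] Vν) :=
  TensorProduct.map (μ (Weyl.Xinv q)) 1 +
    TensorProduct.map (μ (Weyl.Y q)) (Ring.inverse (ν (Weyl.Y q)))

/-- The operator `q⁻¹ Y_μ ⊗ X_ν⁻¹ Y_ν⁻¹`. -/
def cgOpY (μ : Weyl q →ₐ[ℂ] Module.End ℂ Vμ) (ν : Weyl q →ₐ[ℂ] Module.End ℂ Vν) :
    Module.End ℂ (Vμ ⊗[ℂ] Vν) :=
  q⁻¹ • TensorProduct.map (μ (Weyl.Y q)) (ν (Weyl.Xinv q) * Ring.inverse (ν (Weyl.Y q)))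

section CGAction

variable (μ : Weyl q →ₐ[ℂ] Module.End ℂ Vμ) (ν : Weyl q →ₐ[ℂ] Module.End ℂ Vν)
  (κ : Weyl q →ₐ[ℂ] Module.End ℂ Vκ)

theorem rep_X_Y : μ (Weyl.X q) * μ (Weyl.Y q) = q ^ 2 • (μ (Weyl.Y q) * μ (Weyl.X q)) := by
  rw [← map_mul, Weyl.X_mul_Y, map_smul, map_mul]

theorem rep_Y_Xinv :
    μ (Weyl.Y q) * μ (Weyl.Xinv q) = q ^ 2 • (μ (Weyl.Xinv q) * μ (Weyl.Y q)) := by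
  rw [← map_mul, Weyl.Y_mul_Xinv, map_smul, map_mul]

theorem rep_X_Xinv : μ (Weyl.X q) * μ (Weyl.Xinv q) = 1 := by
  rw [← map_mul, Weyl.X_mul_Xinv, map_one]

theorem rep_Xinv_X : μ (Weyl.Xinv q) * μ (Weyl.X q) = 1 := by
  rw [← map_mul, Weyl.Xinv_mul_X, map_one]

theorem rep_Yinv_X (hY : IsUnit (μ (Weyl.Y q))) :
    Ring.inverse (μ (Weyl.Y q)) * μ (Weyl.X q) =
      q ^ 2 • (μ (Weyl.X q) * Ring.inverse (μ (Weyl.Y q))) := by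
  calc Ring.inverse (μ (Weyl.Y q)) * μ (Weyl.X q)
      = Ring.inverse (μ (Weyl.Y q)) * (μ (Weyl.X q) * μ (Weyl.Y q)) *
          Ring.inverse (μ (Weyl.Y q)) := by
        rw [mul_assoc, mul_assoc, Ring.mul_inverse_cancel _ hY, mul_one]
    _ = _ := by
        rw [rep_X_Y, mul_smul_comm, ← mul_assoc, Ring.inverse_mul_cancel _ hY, one_mul,
          smul_mul_assoc]

theorem rep_Xinv_Yinv (hY : IsUnit (μ (Weyl.Y q))) :
    μ (Weyl.Xinv q) * Ring.inverse (μ (Weyl.Y q)) =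
      q ^ 2 • (Ring.inverse (μ (Weyl.Y q)) * μ (Weyl.Xinv q)) := by
  calc μ (Weyl.Xinv q) * Ring.inverse (μ (Weyl.Y q))
      = μ (Weyl.Xinv q) * (Ring.inverse (μ (Weyl.Y q)) * μ (Weyl.X q)) * μ (Weyl.Xinv q) := by
        rw [mul_assoc, mul_assoc, rep_X_Xinv, mul_one]
    _ = _ := by
        rw [rep_Yinv_X μ hY, mul_smul_comm, ← mul_assoc, rep_Xinv_X, one_mul, smul_mul_assoc]

theorem commute_ringInverse {B : Type*} [Ring B] {a b : B} (ha : IsUnit a) (h : Commute a b) :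
    Commute (Ring.inverse a) b := by
  obtain ⟨u, rfl⟩ := ha
  rw [Ring.inverse_unit]
  exact h.units_inv_left

theorem cgOpX_eq (h : IsRegularPair μ ν) :
    cgOpX μ ν = tensorRep μ ν (Weyl.Y q) * TensorProduct.map 1 (Ring.inverse (ν (Weyl.Y q))) := by
  rw [tensorRep_Y, add_mul, ← TensorProduct.map_mul, ← TensorProduct.map_mul,
    Ring.mul_inverse_cancel _ h.right.isUnit_Y, mul_one, mul_one, one_mul, cgOpX]

theorem cgOpX_eq' (h : IsRegularPair μ ν) :
    cgOpX μ ν = TensorProduct.map 1 (Ring.inverse (ν (Weyl.Y q))) * tensorRep μ ν (Weyl.Y q) := by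
  rw [tensorRep_Y, mul_add, ← TensorProduct.map_mul, ← TensorProduct.map_mul,
    Ring.inverse_mul_cancel _ h.right.isUnit_Y, mul_one, one_mul, one_mul, cgOpX]

theorem isUnit_cgOpX (h : IsRegularPair μ ν) : IsUnit (cgOpX μ ν) := by
  rw [cgOpX_eq μ ν h]
  refine h.tensor.isUnit_Y.mul ⟨⟨TensorProduct.map 1 (Ring.inverse (ν (Weyl.Y q))), TensorProduct.map 1 (ν (Weyl.Y q)), ?_, ?_⟩, rfl⟩
  · rw [← TensorProduct.map_mul, Ring.inverse_mul_cancel _ h.right.isUnit_Y, one_mul,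
      TensorProduct.map_one]
  · rw [← TensorProduct.map_mul, Ring.mul_inverse_cancel _ h.right.isUnit_Y, one_mul,
      TensorProduct.map_one]

theorem cgOpX_commute (h : IsRegularPair μ ν) (w : Weyl q) :
    Commute (cgOpX μ ν) (tensorRep μ ν w) := by
  refine Weyl.commute_of_gen _ _ ?_ ?_ w
  · rw [commute_iff_eq, tensorRep_X, cgOpX, add_mul, mul_add]
    simp only [← TensorProduct.map_mul]
    rw [rep_Xinv_X, rep_X_Xinv, rep_X_Y, rep_Yinv_X ν h.right.isUnit_Y, one_mul, mul_one,
      TensorProduct.map_smul_left, TensorProduct.map_smul_right]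
  · rw [commute_iff_eq]
    nth_rewrite 1 [cgOpX_eq μ ν h]
    rw [cgOpX_eq' μ ν h, mul_assoc]

theorem cgOpY_commute (h : IsRegularPair μ ν) (w : Weyl q) :
    Commute (cgOpY μ ν) (tensorRep μ ν w) := by
  refine Commute.smul_left (Weyl.commute_of_gen _ _ ?_ ?_ w) _
  · rw [commute_iff_eq, tensorRep_X]
    simp only [← TensorProduct.map_mul]
    rw [mul_assoc, rep_Yinv_X ν h.right.isUnit_Y, rep_X_Y, mul_smul_comm, ← mul_assoc, ← mul_assoc,
      rep_Xinv_X, rep_X_Xinv, TensorProduct.map_smul_left, TensorProduct.map_smul_right]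
  · rw [commute_iff_eq, tensorRep_Y, add_mul, mul_add]
    simp only [← TensorProduct.map_mul]
    rw [mul_assoc, Ring.inverse_mul_cancel _ h.right.isUnit_Y, ← mul_assoc (ν (Weyl.Y q)),
      rep_Y_Xinv μ, rep_Y_Xinv ν, smul_mul_assoc, mul_assoc (ν (Weyl.Xinv q)) (ν (Weyl.Y q)),
      Ring.mul_inverse_cancel _ h.right.isUnit_Y, mul_one, mul_one, one_mul,
      TensorProduct.map_smul_left, TensorProduct.map_smul_right]

theorem cgOpY_mul_cgOpX (h : IsRegularPair μ ν) :
    cgOpY μ ν * cgOpX μ ν = q ^ 2 • (cgOpX μ ν * cgOpY μ ν) := by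
  rw [cgOpX, cgOpY, smul_mul_assoc, mul_smul_comm, smul_comm (q ^ 2) q⁻¹, add_mul, mul_add]
  simp only [← TensorProduct.map_mul]
  rw [rep_Y_Xinv μ, mul_one, one_mul, ← mul_assoc (Ring.inverse (ν (Weyl.Y q))),
    rep_Xinv_Yinv ν h.right.isUnit_Y, smul_mul_assoc]
  simp only [TensorProduct.map_smul_left, TensorProduct.map_smul_right, smul_add]

variable {μ ν}

/-- Composition with an operator that commutes with the action on `V_μ ⊗ V_ν`. -/
def cgPost (T : Module.End ℂ (Vμ ⊗[ℂ] Vν)) (hT : ∀ w, Commute T (tensorRep μ ν w)) :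
    Module.End ℂ (cgSpace μ ν κ) where
  toFun f := ⟨T ∘ₗ f.1, by
    intro w v
    have h := LinearMap.congr_fun (hT w).eq (f.1 v)
    simp only [Module.End.mul_apply] at h
    simp only [LinearMap.comp_apply]
    rw [f.2 w v, h]⟩
  map_add' f g := Subtype.ext (LinearMap.comp_add f.1 g.1 T)
  map_smul' c f := Subtype.ext (LinearMap.comp_smul T c f.1)

/-- The action of the Weyl algebra on the space of Clebsch-Gordan operators of a regular pair:
`(X·f)(v) = (X_μ⁻¹ ⊗ 1 + Y_μ ⊗ Y_ν⁻¹)⁻¹ f(v)` and `(Y·f)(v) = (q⁻¹ Y_μ ⊗ X_ν⁻¹ Y_ν⁻¹) f(v)`. -/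
def cgRep (h : IsRegularPair μ ν) : Weyl q →ₐ[ℂ] Module.End ℂ (cgSpace μ ν κ) :=
  Weyl.lift
    (cgPost κ (Ring.inverse (cgOpX μ ν)) fun w =>
      commute_ringInverse (isUnit_cgOpX μ ν h) (cgOpX_commute μ ν h w))
    (cgPost κ (cgOpX μ ν) (cgOpX_commute μ ν h))
    (cgPost κ (cgOpY μ ν) (cgOpY_commute μ ν h))
    (by
      refine LinearMap.ext fun f => Subtype.ext (LinearMap.ext fun v => ?_)
      have := Ring.inverse_mul_cancel _ (isUnit_cgOpX μ ν h)
      exact LinearMap.congr_fun this (f.1 v))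
    (by
      refine LinearMap.ext fun f => Subtype.ext (LinearMap.ext fun v => ?_)
      have := Ring.mul_inverse_cancel _ (isUnit_cgOpX μ ν h)
      exact LinearMap.congr_fun this (f.1 v))
    (by
      have h₁ := isUnit_cgOpX μ ν h
      have : Ring.inverse (cgOpX μ ν) * cgOpY μ ν =
          q ^ 2 • (cgOpY μ ν * Ring.inverse (cgOpX μ ν)) := by
        calc Ring.inverse (cgOpX μ ν) * cgOpY μ ν
            = Ring.inverse (cgOpX μ ν) * (cgOpY μ ν * cgOpX μ ν) * Ring.inverse (cgOpX μ ν) := by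
              rw [mul_assoc, mul_assoc, Ring.mul_inverse_cancel _ h₁, mul_one]
          _ = _ := by
              rw [cgOpY_mul_cgOpX μ ν h, mul_smul_comm, ← mul_assoc,
                Ring.inverse_mul_cancel _ h₁, one_mul, smul_mul_assoc]
      refine LinearMap.ext fun f => Subtype.ext (LinearMap.ext fun v => ?_)
      exact LinearMap.congr_fun this (f.1 v))

end CGAction

/-- The defining five-term relation of Kashaev's `6j`-symbol `R = R(μ,ν,σ)`,
`Ω₂₃(ν,σ) Ω₁₃(μ,νσ) R₁₂ = Ω₁₂(μ,ν) Ω₂₃(μν,σ)`, as an equality of linear maps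
`V_(μ,ν) ⊗ V_(μν,σ) ⊗ V_μνσ → V_μ ⊗ V_ν ⊗ V_σ`. For a regular triple it determines `R`.
Here `μν`, `νσ`, `μνσ` are representations on `Vμν`, `Vνσ`, `Vμνσ`. -/
def IsSixJ {Vμν Vνσ Vμνσ : Type*} [AddCommGroup Vμν] [Module ℂ Vμν] [AddCommGroup Vνσ]
    [Module ℂ Vνσ] [AddCommGroup Vμνσ] [Module ℂ Vμνσ]
    (μ : Weyl q →ₐ[ℂ] Module.End ℂ Vμ) (ν : Weyl q →ₐ[ℂ] Module.End ℂ Vν)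
    (σ : Weyl q →ₐ[ℂ] Module.End ℂ Vσ) (μν : Weyl q →ₐ[ℂ] Module.End ℂ Vμν)
    (νσ : Weyl q →ₐ[ℂ] Module.End ℂ Vνσ) (μνσ : Weyl q →ₐ[ℂ] Module.End ℂ Vμνσ)
    (R : cgSpace μ ν μν ⊗[ℂ] cgSpace μν σ μνσ →ₗ[ℂ] cgSpace μ νσ μνσ ⊗[ℂ] cgSpace ν σ νσ) :
    Prop :=
  let Ω₂₃ : cgSpace μ ν μν ⊗[ℂ] (cgSpace μν σ μνσ ⊗[ℂ] Vμνσ) →ₗ[ℂ]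
      cgSpace μ ν μν ⊗[ℂ] (Vμν ⊗[ℂ] Vσ) :=
    (canonicalMap μν σ μνσ).lTensor (cgSpace μ ν μν)
  let Ω₁₂ : (cgSpace μ ν μν ⊗[ℂ] Vμν) ⊗[ℂ] Vσ →ₗ[ℂ] (Vμ ⊗[ℂ] Vν) ⊗[ℂ] Vσ :=
    (canonicalMap μ ν μν).rTensor Vσ
  let R₁₂ : (cgSpace μ ν μν ⊗[ℂ] cgSpace μν σ μνσ) ⊗[ℂ] Vμνσ →ₗ[ℂ]
      (cgSpace μ νσ μνσ ⊗[ℂ] cgSpace ν σ νσ) ⊗[ℂ] Vμνσ := R.rTensor Vμνσ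
  let Ω₁₃ : (cgSpace μ νσ μνσ ⊗[ℂ] cgSpace ν σ νσ) ⊗[ℂ] Vμνσ →ₗ[ℂ]
      Vμ ⊗[ℂ] (cgSpace ν σ νσ ⊗[ℂ] Vνσ) :=
    (TensorProduct.comm ℂ Vνσ (cgSpace ν σ νσ)).toLinearMap.lTensor Vμ ∘ₗ
      (TensorProduct.assoc ℂ Vμ Vνσ (cgSpace ν σ νσ)).toLinearMap ∘ₗ
      (canonicalMap μ νσ μνσ).rTensor (cgSpace ν σ νσ) ∘ₗ
      (TensorProduct.rightComm ℂ (cgSpace μ νσ μνσ) (cgSpace ν σ νσ) Vμνσ).toLinearMap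
  let Ω₂₃' : Vμ ⊗[ℂ] (cgSpace ν σ νσ ⊗[ℂ] Vνσ) →ₗ[ℂ] Vμ ⊗[ℂ] (Vν ⊗[ℂ] Vσ) :=
    (canonicalMap ν σ νσ).lTensor Vμ
  Ω₂₃' ∘ₗ Ω₁₃ ∘ₗ R₁₂ =
    (TensorProduct.assoc ℂ Vμ Vν Vσ).toLinearMap ∘ₗ Ω₁₂ ∘ₗ
      (TensorProduct.assoc ℂ (cgSpace μ ν μν) Vμν Vσ).symm.toLinearMap ∘ₗ Ω₂₃ ∘ₗ
      (TensorProduct.assoc ℂ (cgSpace μ ν μν) (cgSpace μν σ μνσ) Vμνσ).toLinearMap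

end Representations

/-! ### Triangle algebras and Chekhov-Fock algebras -/

/-- Generators `X i` and their inverses. -/
inductive TorusGen (ι : Type)
  | pos (i : ι)
  | neg (i : ι)

/-- The relations `X i (X i)⁻¹ = (X i)⁻¹ X i = 1` and `X i X j = q ^ (2 σ i j) X j X i`. -/
inductive TorusRel (q : ℂ) {ι : Type} (σ : ι → ι → ℤ) :
    FreeAlgebra ℂ (TorusGen ι) → FreeAlgebra ℂ (TorusGen ι) → Prop
  | pos_neg (i : ι) : TorusRel q σ
      (FreeAlgebra.ι ℂ (TorusGen.pos i) * FreeAlgebra.ι ℂ (TorusGen.neg i)) 1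
  | neg_pos (i : ι) : TorusRel q σ
      (FreeAlgebra.ι ℂ (TorusGen.neg i) * FreeAlgebra.ι ℂ (TorusGen.pos i)) 1
  | pos_pos (i j : ι) : TorusRel q σ
      (FreeAlgebra.ι ℂ (TorusGen.pos i) * FreeAlgebra.ι ℂ (TorusGen.pos j))
      (q ^ (2 * σ i j) • (FreeAlgebra.ι ℂ (TorusGen.pos j) * FreeAlgebra.ι ℂ (TorusGen.pos i)))

/-- The complex algebra generated by `(X i)^{±1}` with relations
`X i X j = q ^ (2 σ i j) X j X i`. -/
def Torus (q : ℂ) {ι : Type} (σ : ι → ι → ℤ) : Type := RingQuot (TorusRel q σ)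

instance (q : ℂ) {ι : Type} (σ : ι → ι → ℤ) : Ring (Torus q σ) :=
  inferInstanceAs (Ring (RingQuot (TorusRel q σ)))

instance (q : ℂ) {ι : Type} (σ : ι → ι → ℤ) : Algebra ℂ (Torus q σ) :=
  inferInstanceAs (Algebra ℂ (RingQuot (TorusRel q σ)))

namespace Torus

variable {q : ℂ} {ι : Type} {σ : ι → ι → ℤ} {A : Type*} [Ring A] [Algebra ℂ A]

/-- The quotient map from the free algebra. -/
def mk (q : ℂ) (σ : ι → ι → ℤ) : FreeAlgebra ℂ (TorusGen ι) →ₐ[ℂ] Torus q σ :=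
  RingQuot.mkAlgHom ℂ (TorusRel q σ)

theorem mk_surjective : Function.Surjective (mk q σ) :=
  RingQuot.mkAlgHom_surjective ℂ (TorusRel q σ)

/-- The generator `X i`, as a unit. -/
def X (q : ℂ) (σ : ι → ι → ℤ) (i : ι) : (Torus q σ)ˣ where
  val := mk q σ (FreeAlgebra.ι ℂ (TorusGen.pos i))
  inv := mk q σ (FreeAlgebra.ι ℂ (TorusGen.neg i))
  val_inv := by
    have : mk q σ _ = mk q σ _ := RingQuot.mkAlgHom_rel ℂ (TorusRel.pos_neg (q := q) (σ := σ) i)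
    simpa using this
  inv_val := by
    have : mk q σ _ = mk q σ _ := RingQuot.mkAlgHom_rel ℂ (TorusRel.neg_pos (q := q) (σ := σ) i)
    simpa using this

theorem X_mul_X (i j : ι) : (X q σ i : Torus q σ) * X q σ j =
    q ^ (2 * σ i j) • ((X q σ j : Torus q σ) * X q σ i) := by
  have : mk q σ _ = mk q σ _ := RingQuot.mkAlgHom_rel ℂ (TorusRel.pos_pos (q := q) (σ := σ) i j)
  simpa [X] using this

/-- The values of a homomorphism on the generators. -/
def liftFun (u : ι → Aˣ) : TorusGen ι → A
  | TorusGen.pos i => u i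
  | TorusGen.neg i => (u i)⁻¹.1

/-- The homomorphism that is given by invertible elements satisfying the relations. -/
def lift (u : ι → Aˣ) (h : ∀ i j, (u i : A) * u j = q ^ (2 * σ i j) • ((u j : A) * u i)) :
    Torus q σ →ₐ[ℂ] A :=
  RingQuot.liftAlgHom ℂ ⟨FreeAlgebra.lift ℂ (liftFun u), by
    intro a b hab
    cases hab with
    | pos_neg i => simp [liftFun]
    | neg_pos i => simp [liftFun]
    | pos_pos i j =>
      simp only [map_mul, map_smul, FreeAlgebra.lift_ι_apply, liftFun]
      exact h i j⟩

@[simp] theorem lift_X (u : ι → Aˣ)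
    (h : ∀ i j, (u i : A) * u j = q ^ (2 * σ i j) • ((u j : A) * u i)) (i : ι) :
    lift (q := q) (σ := σ) u h (X q σ i) = u i :=
  (RingQuot.liftAlgHom_mkAlgHom_apply ..).trans (FreeAlgebra.lift_ι_apply ..)

theorem induction {P : Torus q σ → Prop} (hc : ∀ c : ℂ, P (algebraMap ℂ _ c))
    (hX : ∀ i, P (X q σ i)) (hXi : ∀ i, P (X q σ i)⁻¹.1) (hm : ∀ a b, P a → P b → P (a * b))
    (ha : ∀ a b, P a → P b → P (a + b)) (a : Torus q σ) : P a := by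
  obtain ⟨a, rfl⟩ := mk_surjective a
  induction a using FreeAlgebra.induction with
  | grade0 r => rw [AlgHom.commutes]; exact hc r
  | grade1 g =>
    cases g with
    | pos i => exact hX i
    | neg i => exact hXi i
  | mul a b h₁ h₂ => rw [map_mul]; exact hm _ _ h₁ h₂
  | add a b h₁ h₂ => rw [map_add]; exact ha _ _ h₁ h₂

/-- The homomorphism to Laurent polynomials in a central variable that multiplies `X i₀` by
this variable. -/
def grading [DecidableEq ι] (i₀ : ι) : Torus q σ →ₐ[ℂ] LaurentPolynomial (Torus q σ) :=
  lift (fun i => ⟨LaurentPolynomial.C (X q σ i).1 * LaurentPolynomial.T (if i = i₀ then 1 else 0),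
      LaurentPolynomial.C (X q σ i)⁻¹.1 * LaurentPolynomial.T (-if i = i₀ then 1 else 0),
      by
        rw [mul_assoc, LaurentPolynomial.T_mul, mul_assoc, ← LaurentPolynomial.T_add, ← mul_assoc,
          ← map_mul]
        simp,
      by
        rw [mul_assoc, LaurentPolynomial.T_mul, mul_assoc, ← LaurentPolynomial.T_add, ← mul_assoc,
          ← map_mul]
        simp⟩)
    (by
      intro i j
      have hs : ∀ (c : ℂ) (a : Torus q σ), (LaurentPolynomial.C (c • a) : LaurentPolynomial _) =
          c • LaurentPolynomial.C a := by
        intro c a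
        rw [Algebra.smul_def, map_mul, ← LaurentPolynomial.algebraMap_apply, ← Algebra.smul_def]
      have hc : ∀ (a b : Torus q σ) (m n : ℤ),
          (LaurentPolynomial.C a * LaurentPolynomial.T m : LaurentPolynomial _) *
            (LaurentPolynomial.C b * LaurentPolynomial.T n) =
          LaurentPolynomial.C (a * b) * LaurentPolynomial.T (m + n) := by
        intro a b m n
        rw [mul_assoc, ← mul_assoc (LaurentPolynomial.T m), LaurentPolynomial.T_mul, mul_assoc,
          ← LaurentPolynomial.T_add, ← mul_assoc, ← map_mul]
      simp only [hc]
      rw [X_mul_X, hs, smul_mul_assoc, add_comm])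

theorem grading_injective [DecidableEq ι] (i₀ : ι) :
    Function.Injective (grading (q := q) (σ := σ) i₀) := by
  let ε : LaurentPolynomial (Torus q σ) →+* Torus q σ :=
    AddMonoidAlgebra.liftNCRingHom (RingHom.id _) 1 (fun _ _ => Commute.one_right _)
  have hε : ∀ (a : Torus q σ) (n : ℤ),
      ε (LaurentPolynomial.C a * LaurentPolynomial.T n) = a := by
    intro a n
    rw [← LaurentPolynomial.single_eq_C_mul_T]
    exact (AddMonoidAlgebra.liftNCRingHom_single ..).trans (by simp)
  refine Function.LeftInverse.injective (g := ε) fun a => ?_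
  induction a using Torus.induction with
  | hc c =>
    rw [AlgHom.commutes, LaurentPolynomial.algebraMap_apply]
    simpa using hε (algebraMap ℂ _ c) 0
  | hX i => rw [grading, lift_X]; exact hε _ _
  | hXi i =>
    have : grading i₀ (X q σ i)⁻¹.1 = LaurentPolynomial.C (X q σ i)⁻¹.1 *
        LaurentPolynomial.T (-if i = i₀ then 1 else 0) :=
      (RingQuot.liftAlgHom_mkAlgHom_apply ..).trans (FreeAlgebra.lift_ι_apply ..)
    rw [this]
    exact hε _ _
  | hm a b h₁ h₂ => rw [map_mul, map_mul, h₁, h₂]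
  | ha a b h₁ h₂ => rw [map_add, map_add, h₁, h₂]

theorem eq_zero_of_one_add_pow_mul (i₀ : ι) {N : ℕ} (hN : 0 < N) (a : Torus q σ)
    (h : (1 + (X q σ i₀ : Torus q σ) ^ N) * a = 0) : a = 0 := by
  classical
  refine grading_injective i₀ ?_
  rw [map_zero]
  have hX : grading i₀ (X q σ i₀ : Torus q σ) =
      LaurentPolynomial.C (X q σ i₀).1 * LaurentPolynomial.T 1 := by
    rw [grading, lift_X]; simp
  have hN' : grading i₀ ((X q σ i₀ : Torus q σ) ^ N) =
      AddMonoidAlgebra.single (N : ℤ) ((X q σ i₀ : Torus q σ) ^ N) := by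
    rw [map_pow, hX, ← LaurentPolynomial.single_eq_C_mul_T, AddMonoidAlgebra.single_pow]
    simp
  have h₁ := congrArg (grading i₀) h
  rw [map_mul, map_add, map_one, hN', map_zero, add_mul, one_mul] at h₁
  set f := grading i₀ a
  by_contra hf
  have hs : f.coeff.support.Nonempty := by
    rw [Finsupp.support_nonempty_iff]
    intro h0
    exact hf (by ext n; rw [h0]; rfl)
  have hmem := f.coeff.support.min'_mem hs
  set m := f.coeff.support.min' hs with hm
  have h₂ := congrArg (fun g : LaurentPolynomial (Torus q σ) => g.coeff m) h₁
  simp only [AddMonoidAlgebra.coeff_add, Finsupp.add_apply,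
    AddMonoidAlgebra.coeff_single_mul_apply, AddMonoidAlgebra.coeff_zero,
    Finsupp.zero_apply] at h₂
  have h₃ : f.coeff (-(N : ℤ) + m) = 0 := by
    by_contra h0
    have := f.coeff.support.min'_le _ (Finsupp.mem_support_iff.mpr h0)
    omega
  rw [h₃, mul_zero, add_zero] at h₂
  exact (Finsupp.mem_support_iff.mp hmem) h₂

/-- The denominators: the central elements that are not zero divisors. -/
def denominators (q : ℂ) (σ : ι → ι → ℤ) : Submonoid (Torus q σ) :=
  Submonoid.center (Torus q σ) ⊓ nonZeroDivisors (Torus q σ)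

instance (q : ℂ) (σ : ι → ι → ℤ) : OreLocalization.OreSet (denominators q σ) where
  ore_right_cancel r₁ r₂ s h := ⟨s, by
    rw [(Submonoid.mem_center_iff.mp s.2.1 r₁).symm, (Submonoid.mem_center_iff.mp s.2.1 r₂).symm, h]⟩
  oreNum r _ := r
  oreDenom _ s := s
  ore_eq r s := (Submonoid.mem_center_iff.mp s.2.1 r).symm

/-- The fraction division algebra. When `q` is a root of unity and `ι` is finite, the algebra is
a domain that is finite over its center, so its fraction division algebra consists of the
fractions whose denominator is a nonzero central element. -/
abbrev Frac (q : ℂ) (σ : ι → ι → ℤ) : Type := OreLocalization (denominators q σ) (Torus q σ)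

/-- The embedding into the fraction division algebra. -/
def toFrac (q : ℂ) (σ : ι → ι → ℤ) : Torus q σ →ₐ[ℂ] Frac q σ where
  __ := OreLocalization.numeratorRingHom
  commutes' _ := rfl

theorem one_add_pow_mem_denominators {N : ℕ} (h : IsQRoot N q) (i₀ : ι) :
    1 + (X q σ i₀ : Torus q σ) ^ N ∈ denominators q σ := by
  have hcomm : ∀ a, Commute ((X q σ i₀ : Torus q σ) ^ N) a := by
    have hX : ∀ i, Commute ((X q σ i₀ : Torus q σ) ^ N) (X q σ i) := by
      intro i
      have hk : ∀ k : ℕ, (X q σ i₀ : Torus q σ) ^ k * X q σ i =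
          (q ^ (2 * σ i₀ i)) ^ k • ((X q σ i : Torus q σ) * (X q σ i₀ : Torus q σ) ^ k) := by
        intro k
        induction k with
        | zero => simp
        | succ k ih =>
          rw [pow_succ, mul_assoc, X_mul_X, mul_smul_comm, ← mul_assoc, ih, smul_mul_assoc,
            mul_assoc, ← pow_succ, smul_smul, ← pow_succ']
      have h1 : (q ^ (2 * σ i₀ i)) ^ N = 1 := by
        have h2 : (q ^ 2) ^ N = 1 := h.primitive.pow_eq_one
        rw [zpow_mul, ← zpow_natCast, ← zpow_mul, mul_comm, zpow_mul, zpow_natCast]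
        have h3 : q ^ (2 : ℤ) = q ^ 2 := by norm_cast
        rw [h3, h2, one_zpow]
      have := hk N
      rwa [h1, one_smul] at this
    intro a
    induction a using Torus.induction with
    | hc c => exact Algebra.commute_algebraMap_right c _
    | hX i => exact hX i
    | hXi i => exact (hX i).units_inv_right
    | hm a b h₁ h₂ => exact h₁.mul_right h₂
    | ha a b h₁ h₂ => exact h₁.add_right h₂
  have hc : ∀ a, a * (1 + (X q σ i₀ : Torus q σ) ^ N) = (1 + (X q σ i₀ : Torus q σ) ^ N) * a :=
    fun a => ((Commute.one_left a).add_left (hcomm a)).eq.symm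
  refine ⟨Submonoid.mem_center_iff.mpr hc, ?_, ?_⟩
  · exact fun a ha => eq_zero_of_one_add_pow_mul i₀ h.pos a ha
  · exact fun a ha => eq_zero_of_one_add_pow_mul i₀ h.pos a (by rw [← hc, ha])

theorem isUnit_toFrac_one_add_pow {N : ℕ} (h : IsQRoot N q) (i₀ : ι) :
    IsUnit (1 + toFrac q σ (X q σ i₀) ^ N) := by
  have := OreLocalization.numerator_isUnit (⟨_, one_add_pow_mem_denominators h i₀⟩ : denominators q σ)
  have h' : IsUnit (toFrac q σ (1 + (X q σ i₀ : Torus q σ) ^ N)) := this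
  rwa [map_add, map_one, map_pow] at h'

theorem isUnit_one_add_of_pow {N : ℕ} (h : IsQRoot N q) (y : A) (hy : IsUnit (1 + y ^ N)) :
    IsUnit (1 + q • y) := by
  have hz : (-(q • y)) ^ N = - y ^ N := by
    rw [← neg_smul, smul_pow, neg_pow, h.pow_eq, ← pow_add, show N + (N + 1) = 2 * N + 1 by ring,
      pow_succ, pow_mul]
    simp
  have h₁ := mul_neg_geom_sum (-(q • y)) N
  have h₂ := geom_sum_mul_neg (-(q • y)) N
  rw [hz, sub_neg_eq_add, sub_neg_eq_add] at h₁ h₂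
  obtain ⟨u, hu⟩ := hy
  rw [← hu] at h₁ h₂
  exact isUnit_iff_exists_and_exists.mpr
    ⟨⟨(∑ i ∈ Finset.range N, (-(q • y)) ^ i) * (u⁻¹ : Aˣ), by rw [← mul_assoc, h₁, Units.mul_inv]⟩,
      ⟨(u⁻¹ : Aˣ) * ∑ i ∈ Finset.range N, (-(q • y)) ^ i, by rw [mul_assoc, h₂, Units.inv_mul]⟩⟩

/-- `1 + q X i₀` is invertible in the fraction division algebra. -/
theorem isUnit_toFrac_one_add {N : ℕ} (h : IsQRoot N q) (i₀ : ι) :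
    IsUnit (1 + q • toFrac q σ (X q σ i₀)) :=
  isUnit_one_add_of_pow h _ (isUnit_toFrac_one_add_pow h i₀)

/-- `1 + q (X i₀)⁻¹` is invertible in the fraction division algebra. -/
theorem isUnit_toFrac_one_add_inv {N : ℕ} (h : IsQRoot N q) (i₀ : ι) :
    IsUnit (1 + q • toFrac q σ (X q σ i₀)⁻¹.1) := by
  refine isUnit_one_add_of_pow h _ ?_
  have h₁ : toFrac q σ (X q σ i₀)⁻¹.1 * toFrac q σ (X q σ i₀) = 1 := by
    rw [← map_mul, Units.inv_mul, map_one]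
  have h₂ : toFrac q σ (X q σ i₀) * toFrac q σ (X q σ i₀)⁻¹.1 = 1 := by
    rw [← map_mul, Units.mul_inv, map_one]
  have hc : Commute (toFrac q σ (X q σ i₀)⁻¹.1) (toFrac q σ (X q σ i₀)) := h₁.trans h₂.symm
  have : 1 + toFrac q σ (X q σ i₀)⁻¹.1 ^ N =
      toFrac q σ (X q σ i₀)⁻¹.1 ^ N * (1 + toFrac q σ (X q σ i₀) ^ N) := by
    rw [mul_add, mul_one, ← hc.mul_pow, h₁, one_pow, add_comm]
  rw [this]
  exact (IsUnit.pow N ⟨⟨_, _, h₁, h₂⟩, rfl⟩).mul (isUnit_toFrac_one_add_pow h i₀)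

end Torus

/-- The commutation exponents of the triangle algebra: `XY = q²YX`, `YZ = q²ZY`, `ZX = q²XZ`,
where `X`, `Y`, `Z` are indexed by `0`, `1`, `2`. -/
def triSigma : Fin 3 → Fin 3 → ℤ := ![![0, 1, -1], ![-1, 0, 1], ![1, -1, 0]]

/-- The triangle algebra, generated by `X^{±1}`, `Y^{±1}`, `Z^{±1}`. -/
abbrev TriangleAlg (q : ℂ) : Type := Torus q triSigma

/-- The combinatorics of an ideal triangulation of the square: it has five edges, and the two
triangles are given by their edges, in the order of the generators `X`, `Y`, `Z` of the triangle
algebra. -/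
structure SquareTriangulation where
  T₁ : Fin 3 → Fin 5
  T₂ : Fin 3 → Fin 5
  inj₁ : Function.Injective T₁
  inj₂ : Function.Injective T₂

namespace SquareTriangulation

/-- Let `0, 1, 2, 3` be the vertices of the square in counterclockwise order. The edges
`X₁, X₂, X₃, X₄` (with indices `0, 1, 2, 3` here) are `01`, `03`, `23`, `12`, and the fifth edge
is the diagonal. In a triangle with vertices `a < b < c`, the generators `X`, `Y`, `Z` belong to
the edges `ab`, `ac`, `bc`. The triangulation `lam` has the diagonal `02`, with triangles `012`
and `023`. -/
def lam : SquareTriangulation where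
  T₁ := ![0, 4, 3]
  T₂ := ![4, 1, 2]
  inj₁ := by decide
  inj₂ := by decide

/-- The triangulation of the square with the diagonal `13`, with triangles `013` and `123`. -/
def lam' : SquareTriangulation where
  T₁ := ![0, 1, 4]
  T₂ := ![3, 4, 2]
  inj₁ := by decide
  inj₂ := by decide

/-- The contribution of a triangle to the commutation exponents of the Chekhov-Fock algebra. -/
def triPart (t : Fin 3 → Fin 5) (i j : Fin 5) : ℤ :=
  ∑ a, ∑ b, if t a = i ∧ t b = j then triSigma a b else 0

/-- The commutation exponents of the Chekhov-Fock algebra. -/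
def sigma (τ : SquareTriangulation) (i j : Fin 5) : ℤ := triPart τ.T₁ i j + triPart τ.T₂ i j

end SquareTriangulation

/-- The Chekhov-Fock algebra of a triangulation of the square. -/
abbrev ChekhovFock (q : ℂ) (τ : SquareTriangulation) : Type := Torus q τ.sigma

/-- The generator of the triangle algebra that belongs to the edge `i`, and `1` if `i` is not an
edge of the triangle. -/
def side (q : ℂ) (t : Fin 3 → Fin 5) (i : Fin 5) : (TriangleAlg q)ˣ :=
  if t 0 = i then Torus.X q triSigma 0
  else if t 1 = i then Torus.X q triSigma 1
  else if t 2 = i then Torus.X q triSigma 2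
  else 1

theorem side_apply (q : ℂ) {t : Fin 3 → Fin 5} (ht : Function.Injective t) (a : Fin 3) :
    side q t (t a) = Torus.X q triSigma a := by
  fin_cases a <;> simp [side, ht.eq_iff]

theorem side_of_ne (q : ℂ) {t : Fin 3 → Fin 5} {i : Fin 5} (hi : ∀ a, t a ≠ i) :
    side q t i = 1 := by
  simp [side, hi]

theorem side_mul_side (q : ℂ) {t : Fin 3 → Fin 5} (ht : Function.Injective t) (i j : Fin 5) :
    (side q t i : TriangleAlg q) * side q t j =
      q ^ (2 * SquareTriangulation.triPart t i j) • ((side q t j : TriangleAlg q) * side q t i) := by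
  by_cases hi : ∃ a, t a = i
  · by_cases hj : ∃ b, t b = j
    · obtain ⟨a, rfl⟩ := hi
      obtain ⟨b, rfl⟩ := hj
      have : SquareTriangulation.triPart t (t a) (t b) = triSigma a b := by
        simp [SquareTriangulation.triPart, ht.eq_iff, ite_and]
      rw [this, side_apply q ht, side_apply q ht, Torus.X_mul_X]
    · push Not at hj
      have : SquareTriangulation.triPart t i j = 0 := by
        simp [SquareTriangulation.triPart, hj]
      simp [this, side_of_ne q hj]
  · push Not at hi
    have : SquareTriangulation.triPart t i j = 0 := by
      simp [SquareTriangulation.triPart, hi]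
    simp [this, side_of_ne q hi]

/-- The tensor product of two invertible elements. -/
def unitTmul {A B : Type*} [Ring A] [Algebra ℂ A] [Ring B] [Algebra ℂ B] (a : Aˣ) (b : Bˣ) :
    (A ⊗[ℂ] B)ˣ where
  val := a.1 ⊗ₜ b.1
  inv := a⁻¹.1 ⊗ₜ b⁻¹.1
  val_inv := by simp [Algebra.TensorProduct.one_def]
  inv_val := by simp [Algebra.TensorProduct.one_def]

/-- The embedding of the Chekhov-Fock algebra in the tensor product of the two triangle algebras.
For `lam` it maps `X₁, …, X₅` to `X ⊗ 1`, `1 ⊗ Y`, `1 ⊗ Z`, `Z ⊗ 1`, `Y ⊗ X`, and for `lam'` to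
`X ⊗ 1`, `Y ⊗ 1`, `1 ⊗ Z`, `1 ⊗ X`, `Z ⊗ Y`. -/
def cfEmbed {q : ℂ} (hq : q ≠ 0) (τ : SquareTriangulation) :
    ChekhovFock q τ →ₐ[ℂ] TriangleAlg q ⊗[ℂ] TriangleAlg q :=
  Torus.lift (fun i => unitTmul (side q τ.T₁ i) (side q τ.T₂ i)) (by
    intro i j
    simp only [unitTmul, Algebra.TensorProduct.tmul_mul_tmul]
    rw [side_mul_side q τ.inj₁ i j, side_mul_side q τ.inj₂ i j, TensorProduct.tmul_smul,
      ← TensorProduct.smul_tmul', smul_smul, SquareTriangulation.sigma, ← zpow_add₀ hq, mul_add,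
      add_comm])

/-! ### The coordinate change -/

section CoordChange

variable {q : ℂ} {F : Type*} [Ring F] [Algebra ℂ F]

theorem swap_rel {a b : F} {s : ℂ} (hs : s ≠ 0) (h : a * b = s • (b * a)) :
    b * a = s⁻¹ • (a * b) := by
  rw [h, smul_smul, inv_mul_cancel₀ hs, one_smul]

theorem inv_rel {a : F} {b : Fˣ} {s : ℂ} (hs : s ≠ 0) (h : a * b = s • (b.1 * a)) :
    a * b⁻¹.1 = s⁻¹ • (b⁻¹.1 * a) := by
  have h' := swap_rel hs h
  calc a * b⁻¹.1 = b⁻¹.1 * (b.1 * a) * b⁻¹.1 := by rw [← mul_assoc, Units.inv_mul, one_mul]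
    _ = s⁻¹ • (b⁻¹.1 * a) := by
      rw [h', mul_smul_comm, smul_mul_assoc, mul_assoc, mul_assoc, Units.mul_inv, mul_one]

variable (x y z a b c : Fˣ)

/-- The new coordinate of an edge of the first kind and of an edge of the second kind. -/
theorem coord_mixed (hq : q ≠ 0) (ha : a.1 = 1 + q • z.1) (hb : b.1 = 1 + q • z⁻¹.1)
    (hx : x.1 * z.1 = q ^ (2 : ℤ) • (z.1 * x.1)) (hy : y.1 * z.1 = q ^ (-2 : ℤ) • (z.1 * y.1))
    {s : ℂ} (hxy : x.1 * y.1 = s • (y.1 * x.1)) :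
    (a * x).1 * (b⁻¹ * y).1 = (q ^ (2 : ℤ) * s) • ((b⁻¹ * y).1 * (a * x).1) := by
  have h₁ : a.1 * x.1 = (q • (z.1 * x.1)) * b.1 := by
    rw [ha, hb, mul_add, mul_one, smul_mul_assoc, mul_smul_comm, mul_assoc,
      inv_rel (zpow_ne_zero _ hq) hx, mul_smul_comm, ← mul_assoc, Units.mul_inv, one_mul, smul_smul,
      smul_smul, add_mul, one_mul, smul_mul_assoc, add_comm]
    congr 1
    have : q * q * (q ^ (2 : ℤ))⁻¹ = 1 := by
      rw [show q ^ (2 : ℤ) = q * q by rw [zpow_ofNat, sq]]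
      exact mul_inv_cancel₀ (mul_ne_zero hq hq)
    rw [this, one_smul]
  have h₂ : y.1 * a.1 = b.1 * (q⁻¹ • (z.1 * y.1)) := by
    rw [ha, hb, mul_add, mul_one, add_mul, one_mul, mul_smul_comm, mul_smul_comm, smul_mul_assoc,
      ← mul_assoc, Units.inv_mul, one_mul, hy, smul_smul, smul_smul, inv_mul_cancel₀ hq, one_smul,
      add_comm]
    congr 2
    rw [zpow_neg, zpow_ofNat]
    field_simp
  have h₃ : a.1 * x.1 * b⁻¹.1 = q • (z.1 * x.1) := by
    rw [h₁, mul_assoc, Units.mul_inv, mul_one]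
  have h₄ : b⁻¹.1 * (y.1 * a.1) = q⁻¹ • (z.1 * y.1) := by
    rw [h₂, ← mul_assoc, Units.inv_mul, one_mul]
  simp only [Units.val_mul]
  rw [← mul_assoc, h₃, show b⁻¹.1 * y.1 * (a.1 * x.1) = b⁻¹.1 * (y.1 * a.1) * x.1 by
    simp only [mul_assoc], h₄, smul_mul_assoc, smul_mul_assoc, mul_assoc, mul_assoc, hxy,
    mul_smul_comm, smul_smul, smul_smul]
  congr 1
  rw [zpow_ofNat]
  field_simp

theorem coord_same {s : ℂ} (hs : s ≠ 0) (hx : x.1 * z.1 = s • (z.1 * x.1))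
    (hy : y.1 * z.1 = s • (z.1 * y.1)) (hxy : x.1 * y.1 = y.1 * x.1)
    (hc : ∀ t : F, Commute t z.1 → Commute t c.1) :
    (c * x).1 * (c * y).1 = (c * y).1 * (c * x).1 := by
  have h₁ : Commute (y⁻¹ * x).1 z.1 := by
    rw [commute_iff_eq, Units.val_mul, mul_assoc, hx, mul_smul_comm, ← mul_assoc]
    have := inv_rel (b := z⁻¹) (inv_ne_zero hs) (inv_rel hs hy)
    have h₂ := swap_rel hs hy
    have h₃ : y⁻¹.1 * z.1 = s⁻¹ • (z.1 * y⁻¹.1) := by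
      calc y⁻¹.1 * z.1 = y⁻¹.1 * (z.1 * y.1) * y⁻¹.1 := by
            rw [mul_assoc, mul_assoc, Units.mul_inv, mul_one]
        _ = _ := by
            rw [h₂, mul_smul_comm, smul_mul_assoc, ← mul_assoc, Units.inv_mul, one_mul]
    rw [h₃, smul_mul_assoc, smul_smul, mul_inv_cancel₀ hs, one_smul, mul_assoc]
  have h₂ := (hc _ h₁).eq
  have h₃ : x.1 * c.1 = y.1 * c.1 * (y⁻¹ * x).1 := by
    rw [mul_assoc, ← h₂, ← mul_assoc, Units.val_mul, ← mul_assoc, Units.mul_inv, one_mul]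
  simp only [Units.val_mul] at h₃ ⊢
  rw [mul_assoc, ← mul_assoc x.1, h₃, mul_assoc (y.1 * c.1), mul_assoc y⁻¹.1, hxy,
    ← mul_assoc y⁻¹.1, Units.inv_mul, one_mul]
  simp only [mul_assoc]

end CoordChange

theorem rel_of_lt {q : ℂ} (hq : q ≠ 0) {F : Type*} [Ring F] [Algebra ℂ F] {n : ℕ}
    {σ : Fin n → Fin n → ℤ} (hσ : ∀ i j, σ i j = -σ j i) (u : Fin n → Fˣ)
    (h : ∀ i j, i < j → (u i : F) * u j = q ^ (2 * σ i j) • ((u j : F) * u i)) (i j : Fin n) :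
    (u i : F) * u j = q ^ (2 * σ i j) • ((u j : F) * u i) := by
  rcases lt_trichotomy i j with hij | rfl | hij
  · exact h i j hij
  · have : σ i i = 0 := by have := hσ i i; omega
    simp [this]
  · rw [hσ i j, mul_neg, zpow_neg]
    exact swap_rel (zpow_ne_zero _ hq) (h j i hij)

section CoordChange

variable {N : ℕ} {q : ℂ}

open SquareTriangulation Torus

/-- The edge coordinates of the triangulation `lam`, in the fraction division algebra. -/
def fracX (q : ℂ) (i : Fin 5) : (Frac q lam.sigma)ˣ :=
  Units.map (toFrac q lam.sigma).toMonoidHom (Torus.X q lam.sigma i)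

theorem fracX_rel (i j : Fin 5) : (fracX q i).1 * (fracX q j).1 =
    q ^ (2 * lam.sigma i j) • ((fracX q j).1 * (fracX q i).1) := by
  have := congrArg (toFrac q lam.sigma) (Torus.X_mul_X (q := q) (σ := lam.sigma) i j)
  rw [map_mul, map_smul, map_mul] at this
  exact this

/-- `1 + q X₅` in the fraction division algebra. -/
def fracA (h : IsQRoot N q) : (Frac q lam.sigma)ˣ :=
  (isUnit_toFrac_one_add (σ := lam.sigma) h 4).unit

/-- `1 + q X₅⁻¹` in the fraction division algebra. -/
def fracB (h : IsQRoot N q) : (Frac q lam.sigma)ˣ :=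
  (isUnit_toFrac_one_add_inv (σ := lam.sigma) h 4).unit

theorem fracA_val (h : IsQRoot N q) : (fracA h).1 = 1 + q • (fracX q 4).1 := rfl

theorem fracB_val (h : IsQRoot N q) : (fracB h).1 = 1 + q • (fracX q 4)⁻¹.1 := rfl

/-- The images of `X₁', …, X₅'` under the coordinate change: `(1 + q X₅) X₁`,
`(1 + q X₅⁻¹)⁻¹ X₂`, `(1 + q X₅) X₃`, `(1 + q X₅⁻¹)⁻¹ X₄`, `X₅⁻¹`. -/
def coordImage (h : IsQRoot N q) : Fin 5 → (Frac q lam.sigma)ˣ :=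
  ![fracA h * fracX q 0, (fracB h)⁻¹ * fracX q 1, fracA h * fracX q 2, (fracB h)⁻¹ * fracX q 3,
    (fracX q 4)⁻¹]

theorem fracA_commute (h : IsQRoot N q) (t : Frac q lam.sigma) (ht : Commute t (fracX q 4).1) :
    Commute t (fracA h).1 := by
  rw [fracA_val]
  exact (Commute.one_right t).add_right (ht.smul_right q)

theorem fracB_commute (h : IsQRoot N q) (t : Frac q lam.sigma) (ht : Commute t (fracX q 4).1) :
    Commute t (fracB h)⁻¹.1 := by
  refine Commute.units_inv_right ?_
  rw [fracB_val]
  exact (Commute.one_right t).add_right (ht.units_inv_right.smul_right q)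

theorem coordImage_rel (h : IsQRoot N q) (i j : Fin 5) : (coordImage h i).1 * (coordImage h j).1 =
    q ^ (2 * lam'.sigma i j) • ((coordImage h j).1 * (coordImage h i).1) := by
  have hq := h.ne_zero
  have r04 : (fracX q 0).1 * (fracX q 4).1 = q ^ (2 : ℤ) • ((fracX q 4).1 * (fracX q 0).1) :=
    fracX_rel 0 4
  have r24 : (fracX q 2).1 * (fracX q 4).1 = q ^ (2 : ℤ) • ((fracX q 4).1 * (fracX q 2).1) :=
    fracX_rel 2 4
  have r14 : (fracX q 1).1 * (fracX q 4).1 = q ^ (-2 : ℤ) • ((fracX q 4).1 * (fracX q 1).1) :=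
    fracX_rel 1 4
  have r34 : (fracX q 3).1 * (fracX q 4).1 = q ^ (-2 : ℤ) • ((fracX q 4).1 * (fracX q 3).1) :=
    fracX_rel 3 4
  have r01 := fracX_rel (q := q) 0 1
  have r02 : (fracX q 0).1 * (fracX q 2).1 = (fracX q 2).1 * (fracX q 0).1 :=
    (fracX_rel 0 2).trans (one_smul ..)
  have r03 := fracX_rel (q := q) 0 3
  have r21 := fracX_rel (q := q) 2 1
  have r13 : (fracX q 1).1 * (fracX q 3).1 = (fracX q 3).1 * (fracX q 1).1 :=
    (fracX_rel 1 3).trans (one_smul ..)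
  have r23 := fracX_rel (q := q) 2 3
  have hmix : ∀ (i j : Fin 5) (s : ℤ), (q ^ (2 : ℤ) * q ^ (2 * s)) = q ^ (2 * (1 + s)) := by
    intro _ _ s
    rw [← zpow_add₀ hq, mul_add, mul_one]
  have hlast : ∀ (x c : (Frac q lam.sigma)ˣ) (s : ℤ),
      x.1 * (fracX q 4).1 = q ^ s • ((fracX q 4).1 * x.1) → Commute c.1 (fracX q 4).1 →
      (c * x).1 * (fracX q 4)⁻¹.1 = q ^ (-s) • ((fracX q 4)⁻¹.1 * (c * x).1) := by
    intro x c s hx hc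
    rw [Units.val_mul, mul_assoc, inv_rel (zpow_ne_zero _ hq) hx, mul_smul_comm, ← mul_assoc,
      hc.units_inv_right.eq, mul_assoc, zpow_neg]
  have hA : Commute (fracA h).1 (fracX q 4).1 := (fracA_commute h _ (Commute.refl _)).symm
  have hB : Commute (fracB h)⁻¹.1 (fracX q 4).1 := (fracB_commute h _ (Commute.refl _)).symm
  refine rel_of_lt hq (by decide) (coordImage h) ?_ i j
  intro i j hij
  fin_cases i <;> fin_cases j <;> first | exact absurd hij (by decide) | skip
  · exact (coord_mixed _ _ _ _ _ hq (fracA_val h) (fracB_val h) r04 r14 r01).trans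
      (by rw [hmix 0 0]; rfl)
  · exact (coord_same _ _ _ _ (zpow_ne_zero _ hq) r04 r24 r02 (fracA_commute h)).trans
      (one_smul ..).symm
  · exact (coord_mixed _ _ _ _ _ hq (fracA_val h) (fracB_val h) r04 r34 r03).trans
      (by rw [hmix 0 0]; rfl)
  · exact hlast _ _ _ r04 hA
  · refine (swap_rel (mul_ne_zero (zpow_ne_zero _ hq) (zpow_ne_zero _ hq))
      (coord_mixed _ _ _ _ _ hq (fracA_val h) (fracB_val h) r24 r14 r21)).trans ?_
    rw [hmix 0 0, ← zpow_neg]; rfl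
  · exact (coord_same _ _ _ _ (zpow_ne_zero _ hq) r14 r34 r13 (fracB_commute h)).trans
      (one_smul ..).symm
  · exact hlast _ _ _ r14 hB
  · exact (coord_mixed _ _ _ _ _ hq (fracA_val h) (fracB_val h) r24 r34 r23).trans
      (by rw [hmix 0 0]; rfl)
  · exact hlast _ _ _ r24 hA
  · exact hlast _ _ _ r34 hB

/-- The coordinate change isomorphism `Φ_{λλ'}`, restricted to the Chekhov-Fock algebra of
`lam'`; it takes its values in the fraction division algebra of the Chekhov-Fock algebra of
`lam`. -/
def coordChange (h : IsQRoot N q) : ChekhovFock q lam' →ₐ[ℂ] Frac q lam.sigma :=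
  Torus.lift (coordImage h) (coordImage_rel h)

end CoordChange

/-! ### Local representations and intertwining operators -/

section LocalReps

variable {N : ℕ} {q : ℂ} {V V₁ V₂ V₁' V₂' : Type*}
  [AddCommGroup V] [Module ℂ V]
  [AddCommGroup V₁] [Module ℂ V₁] [AddCommGroup V₂] [Module ℂ V₂]
  [AddCommGroup V₁'] [Module ℂ V₁'] [AddCommGroup V₂'] [Module ℂ V₂']

open SquareTriangulation

/-- The representation of the Chekhov-Fock algebra on `V₁ ⊗ V₂` that is induced by representations
of the triangle algebras on `V₁` and `V₂`. -/
def localRep (hq : q ≠ 0) (τ : SquareTriangulation) (ρ₁ : TriangleAlg q →ₐ[ℂ] Module.End ℂ V₁)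
    (ρ₂ : TriangleAlg q →ₐ[ℂ] Module.End ℂ V₂) :
    ChekhovFock q τ →ₐ[ℂ] Module.End ℂ (V₁ ⊗[ℂ] V₂) :=
  ((Module.endTensorEndAlgHom (R := ℂ) (S := ℂ) (A := ℂ)).comp
    (Algebra.TensorProduct.map ρ₁ ρ₂)).comp (cfEmbed hq τ)

/-- The extension of a representation `ρ` to a fraction `a`: `ρ(a)` makes sense, with the value
`A`, if `a = P Q⁻¹ = Q'⁻¹ P'` with `ρ(Q)` and `ρ(Q')` invertible, and
`A = ρ(P) ρ(Q)⁻¹ = ρ(Q')⁻¹ ρ(P')`. -/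
def IsValueAt {ι : Type} {σ : ι → ι → ℤ} (ρ : Torus q σ →ₐ[ℂ] Module.End ℂ V)
    (a : Torus.Frac q σ) (A : Module.End ℂ V) : Prop :=
  (∃ P Q : Torus q σ, Q ∈ nonZeroDivisors (Torus q σ) ∧ IsUnit (ρ Q) ∧
    a * Torus.toFrac q σ Q = Torus.toFrac q σ P ∧ A * ρ Q = ρ P) ∧
  (∃ P Q : Torus q σ, Q ∈ nonZeroDivisors (Torus q σ) ∧ IsUnit (ρ Q) ∧
    Torus.toFrac q σ Q * a = Torus.toFrac q σ P ∧ ρ Q * A = ρ P)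

/-- `L` is an isomorphism between `ρ ∘ Φ` and `ρ'`: it is bijective, and for every `X'` in the
Chekhov-Fock algebra of `lam'`, `ρ(Φ(X'))` makes sense and `L ∘ ρ(Φ(X')) = ρ'(X') ∘ L`. -/
def IsIntertwiner (h : IsQRoot N q) (ρ : ChekhovFock q lam →ₐ[ℂ] Module.End ℂ (V₁ ⊗[ℂ] V₂))
    (ρ' : ChekhovFock q lam' →ₐ[ℂ] Module.End ℂ (V₁' ⊗[ℂ] V₂'))
    (L : V₁ ⊗[ℂ] V₂ →ₗ[ℂ] V₁' ⊗[ℂ] V₂') : Prop :=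
  Function.Bijective L ∧ ∀ X' : ChekhovFock q lam', ∃ A : Module.End ℂ (V₁ ⊗[ℂ] V₂),
    IsValueAt ρ (coordChange h X') A ∧ L ∘ₗ A = ρ' X' ∘ₗ L

/-- The operators `X`, `Y`, `Z = q Y⁻¹ X⁻¹` of a cyclic representation of the Weyl algebra. -/
def weylUnits (hq : q ≠ 0) (μ : Weyl q →ₐ[ℂ] Module.End ℂ V) (hμ : IsCyclic μ) :
    Fin 3 → (Module.End ℂ V)ˣ :=
  ![hμ.isUnit_X.unit, hμ.isUnit_Y.unit,
    Units.map (algebraMap ℂ (Module.End ℂ V)).toMonoidHom (Units.mk0 q hq) *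
      (hμ.isUnit_Y.unit⁻¹ * hμ.isUnit_X.unit⁻¹)]

theorem weylUnits_rel (hq : q ≠ 0) (μ : Weyl q →ₐ[ℂ] Module.End ℂ V) (hμ : IsCyclic μ)
    (i j : Fin 3) : (weylUnits hq μ hμ i).1 * (weylUnits hq μ hμ j).1 =
      q ^ (2 * triSigma i j) • ((weylUnits hq μ hμ j).1 * (weylUnits hq μ hμ i).1) := by
  have hxy : hμ.isUnit_X.unit.1 * hμ.isUnit_Y.unit.1 =
      q ^ (2 : ℤ) • (hμ.isUnit_Y.unit.1 * hμ.isUnit_X.unit.1) := rep_X_Y μ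
  have hq2 : q ^ (2 : ℤ) ≠ 0 := zpow_ne_zero _ hq
  have hz : (weylUnits hq μ hμ 2).1 = q • (hμ.isUnit_Y.unit⁻¹.1 * hμ.isUnit_X.unit⁻¹.1) := by
    rw [Algebra.smul_def]; rfl
  refine rel_of_lt hq (by decide) (weylUnits hq μ hμ) ?_ i j
  intro i j hij
  fin_cases i <;> fin_cases j <;> first | exact absurd hij (by decide) | skip
  · exact hxy
  · change hμ.isUnit_X.unit.1 * (weylUnits hq μ hμ 2).1 =
      q ^ (-2 : ℤ) • ((weylUnits hq μ hμ 2).1 * hμ.isUnit_X.unit.1)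
    rw [hz, mul_smul_comm, ← mul_assoc, inv_rel hq2 hxy, smul_mul_assoc, smul_mul_assoc, mul_assoc,
      mul_assoc, Units.mul_inv, Units.inv_mul, smul_comm, zpow_neg]
  · change hμ.isUnit_Y.unit.1 * (weylUnits hq μ hμ 2).1 =
      q ^ (2 : ℤ) • ((weylUnits hq μ hμ 2).1 * hμ.isUnit_Y.unit.1)
    have hyx : hμ.isUnit_Y.unit.1 * hμ.isUnit_X.unit⁻¹.1 =
        q ^ (2 : ℤ) • (hμ.isUnit_X.unit⁻¹.1 * hμ.isUnit_Y.unit.1) := by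
      have := inv_rel (inv_ne_zero hq2) (swap_rel hq2 hxy)
      rwa [inv_inv] at this
    rw [hz, mul_smul_comm, ← mul_assoc, Units.mul_inv, one_mul, smul_mul_assoc, mul_assoc,
      smul_comm, ← mul_smul_comm, ← hyx, ← mul_assoc, Units.inv_mul, one_mul]

/-- The representation of the triangle algebra that is induced by a cyclic representation of the
Weyl algebra: `X`, `Y` act as before and `Z` acts by `q Y⁻¹ X⁻¹`. -/
def triangleRep (hq : q ≠ 0) (μ : Weyl q →ₐ[ℂ] Module.End ℂ V) (hμ : IsCyclic μ) :
    TriangleAlg q →ₐ[ℂ] Module.End ℂ V :=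
  Torus.lift (weylUnits hq μ hμ) (weylUnits_rel hq μ hμ)

end LocalReps

/-! ### The three descriptions of a linear map -/

section Descriptions

variable {N : ℕ} {q : ℂ} {V₁ V₂ V₁' V₂' : Type u}
  [AddCommGroup V₁] [Module ℂ V₁] [AddCommGroup V₂] [Module ℂ V₂]
  [AddCommGroup V₁'] [Module ℂ V₁'] [AddCommGroup V₂'] [Module ℂ V₂']

/-- Under isomorphisms of `W`-spaces `V₁ ≅ V_(μ,ν)`, `V₂ ≅ V_μν`, `V₁' ≅ V_μ`, `V₂' ≅ V_ν`,
for some regular pair `(μ,ν)` of irreducible representations, `L` corresponds to a nonzero scalar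
multiple of the canonical map `Ω(μ,ν)`. -/
def IsCanonicalMap (N : ℕ) (ρ₁ : Weyl q →ₐ[ℂ] Module.End ℂ V₁) (ρ₂ : Weyl q →ₐ[ℂ] Module.End ℂ V₂)
    (ρ₁' : Weyl q →ₐ[ℂ] Module.End ℂ V₁') (ρ₂' : Weyl q →ₐ[ℂ] Module.End ℂ V₂')
    (L : V₁ ⊗[ℂ] V₂ →ₗ[ℂ] V₁' ⊗[ℂ] V₂') : Prop :=
  ∃ (Vμ Vν Vμν : Type u)
    (_ : AddCommGroup Vμ) (_ : Module ℂ Vμ) (_ : AddCommGroup Vν) (_ : Module ℂ Vν)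
    (_ : AddCommGroup Vμν) (_ : Module ℂ Vμν)
    (μ : Weyl q →ₐ[ℂ] Module.End ℂ Vμ) (ν : Weyl q →ₐ[ℂ] Module.End ℂ Vν)
    (μν : Weyl q →ₐ[ℂ] Module.End ℂ Vμν)
    (hreg : IsRegularPair μ ν)
    (e₁ : V₁ ≃ₗ[ℂ] cgSpace μ ν μν) (e₂ : V₂ ≃ₗ[ℂ] Vμν) (e₁' : V₁' ≃ₗ[ℂ] Vμ) (e₂' : V₂' ≃ₗ[ℂ] Vν)
    (c : ℂ),
    IsIrred μ ∧ IsIrred ν ∧ IsProductRep N μ ν μν ∧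
    IsRepIso ρ₁ (cgRep μν hreg) e₁ ∧ IsRepIso ρ₂ μν e₂ ∧ IsRepIso ρ₁' μ e₁' ∧
    IsRepIso ρ₂' ν e₂' ∧ c ≠ 0 ∧
    (TensorProduct.congr e₁' e₂').toLinearMap ∘ₗ L =
      c • (canonicalMap μ ν μν ∘ₗ (TensorProduct.congr e₁ e₂).toLinearMap)

/-- Under isomorphisms of `W`-spaces `V₁ ≅ V_(μ,ν)`, `V₂ ≅ V_(μν,σ)`, `V₁' ≅ V_(μ,νσ)`,
`V₂' ≅ V_(ν,σ)`, for some regular triple `(μ,ν,σ)` of irreducible representations, `L` corresponds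
to a nonzero scalar multiple of Kashaev's `6j`-symbol `R(μ,ν,σ)`. The regularity of the pairs
`(μ,ν)`, `(μν,σ)`, `(μ,νσ)`, `(ν,σ)`, on which the actions on the spaces of Clebsch-Gordan
operators depend, is a consequence of the regularity of the triple. -/
def IsKashaevSixJ (N : ℕ) (ρ₁ : Weyl q →ₐ[ℂ] Module.End ℂ V₁) (ρ₂ : Weyl q →ₐ[ℂ] Module.End ℂ V₂)
    (ρ₁' : Weyl q →ₐ[ℂ] Module.End ℂ V₁') (ρ₂' : Weyl q →ₐ[ℂ] Module.End ℂ V₂')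
    (L : V₁ ⊗[ℂ] V₂ →ₗ[ℂ] V₁' ⊗[ℂ] V₂') : Prop :=
  ∃ (Vμ Vν Vσ Vμν Vνσ Vμνσ : Type u)
    (_ : AddCommGroup Vμ) (_ : Module ℂ Vμ) (_ : AddCommGroup Vν) (_ : Module ℂ Vν)
    (_ : AddCommGroup Vσ) (_ : Module ℂ Vσ) (_ : AddCommGroup Vμν) (_ : Module ℂ Vμν)
    (_ : AddCommGroup Vνσ) (_ : Module ℂ Vνσ) (_ : AddCommGroup Vμνσ) (_ : Module ℂ Vμνσ)
    (μ : Weyl q →ₐ[ℂ] Module.End ℂ Vμ) (ν : Weyl q →ₐ[ℂ] Module.End ℂ Vν)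
    (σ : Weyl q →ₐ[ℂ] Module.End ℂ Vσ) (μν : Weyl q →ₐ[ℂ] Module.End ℂ Vμν)
    (νσ : Weyl q →ₐ[ℂ] Module.End ℂ Vνσ) (μνσ : Weyl q →ₐ[ℂ] Module.End ℂ Vμνσ)
    (h₁ : IsRegularPair μ ν) (h₂ : IsRegularPair μν σ)
    (h₃ : IsRegularPair μ νσ) (h₄ : IsRegularPair ν σ)
    (R : cgSpace μ ν μν ⊗[ℂ] cgSpace μν σ μνσ →ₗ[ℂ] cgSpace μ νσ μνσ ⊗[ℂ] cgSpace ν σ νσ)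
    (e₁ : V₁ ≃ₗ[ℂ] cgSpace μ ν μν) (e₂ : V₂ ≃ₗ[ℂ] cgSpace μν σ μνσ)
    (e₁' : V₁' ≃ₗ[ℂ] cgSpace μ νσ μνσ) (e₂' : V₂' ≃ₗ[ℂ] cgSpace ν σ νσ) (c : ℂ),
    IsIrred μ ∧ IsIrred ν ∧ IsIrred σ ∧ IsRegularTriple μ ν σ ∧
    IsProductRep N μ ν μν ∧ IsProductRep N ν σ νσ ∧
    IsProductRep N μν σ μνσ ∧ IsProductRep N μ νσ μνσ ∧
    IsSixJ μ ν σ μν νσ μνσ R ∧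
    IsRepIso ρ₁ (cgRep μν h₁) e₁ ∧ IsRepIso ρ₂ (cgRep μνσ h₂) e₂ ∧
    IsRepIso ρ₁' (cgRep μνσ h₃) e₁' ∧ IsRepIso ρ₂' (cgRep νσ h₄) e₂' ∧ c ≠ 0 ∧
    (TensorProduct.congr e₁' e₂').toLinearMap ∘ₗ L =
      c • (R ∘ₗ (TensorProduct.congr e₁ e₂).toLinearMap)

/-- The actions of the Weyl algebra on the four spaces are irreducible and cyclic, so that they
induce local representations of the two Chekhov-Fock algebras of the square, and `L` is an
intertwining operator for them. -/
def IsWeylIntertwiner (h : IsQRoot N q) (ρ₁ : Weyl q →ₐ[ℂ] Module.End ℂ V₁)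
    (ρ₂ : Weyl q →ₐ[ℂ] Module.End ℂ V₂) (ρ₁' : Weyl q →ₐ[ℂ] Module.End ℂ V₁')
    (ρ₂' : Weyl q →ₐ[ℂ] Module.End ℂ V₂') (L : V₁ ⊗[ℂ] V₂ →ₗ[ℂ] V₁' ⊗[ℂ] V₂') : Prop :=
  IsIrred ρ₁ ∧ IsIrred ρ₂ ∧ IsIrred ρ₁' ∧ IsIrred ρ₂' ∧
  ∃ (h₁ : IsCyclic ρ₁) (h₂ : IsCyclic ρ₂) (h₁' : IsCyclic ρ₁') (h₂' : IsCyclic ρ₂'),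
    IsIntertwiner h
      (localRep h.ne_zero SquareTriangulation.lam
        (triangleRep h.ne_zero ρ₁ h₁) (triangleRep h.ne_zero ρ₂ h₂))
      (localRep h.ne_zero SquareTriangulation.lam'
        (triangleRep h.ne_zero ρ₁' h₁') (triangleRep h.ne_zero ρ₂' h₂')) L

/-- `L` is an intertwining operator for a local representation of the quantum Teichmüller space of
the square that is given by arbitrary finite dimensional irreducible representations of the four
triangle algebras on `V₁`, `V₂`, `V₁'`, `V₂'`. -/
def IsLocalIntertwiner (h : IsQRoot N q) (L : V₁ ⊗[ℂ] V₂ →ₗ[ℂ] V₁' ⊗[ℂ] V₂') : Prop :=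
  FiniteDimensional ℂ V₁ ∧ FiniteDimensional ℂ V₂ ∧
  FiniteDimensional ℂ V₁' ∧ FiniteDimensional ℂ V₂' ∧
  ∃ (ρ₁ : TriangleAlg q →ₐ[ℂ] Module.End ℂ V₁) (ρ₂ : TriangleAlg q →ₐ[ℂ] Module.End ℂ V₂)
    (ρ₁' : TriangleAlg q →ₐ[ℂ] Module.End ℂ V₁') (ρ₂' : TriangleAlg q →ₐ[ℂ] Module.End ℂ V₂'),
    IsIrred ρ₁ ∧ IsIrred ρ₂ ∧ IsIrred ρ₁' ∧ IsIrred ρ₂' ∧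
    IsIntertwiner h (localRep h.ne_zero SquareTriangulation.lam ρ₁ ρ₂)
      (localRep h.ne_zero SquareTriangulation.lam' ρ₁' ρ₂') L

end Descriptions

end QTeich

end

/-! All descriptions are compared with one intermediate notion, `IsFlip`. It says that the four
representations are irreducible and cyclic, that L is bijective, and that conjugation by L turns 1 ⊗
ρ₂(w) into the action of w on V₁' ⊗ V₂' through Δ, and ρ₁(X⁻¹) ⊗ 1 and ρ₁(Y) ⊗ 1 into X⁻¹ ⊗ 1 + Y ⊗
Y⁻¹ and q⁻¹ Y ⊗ X⁻¹Y⁻¹. These are the properties of a canonical map f ⊗ v ↦ f(v) that can be stated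
without mentioning Hom spaces.

Two tools carry the representation theory. The first is Schur's lemma in tensor form,
`IsIrred.exists_eq_rTensor`: a map that commutes with an irreducible action on the second factor is
R ⊗ 1. The second is a calculus of parameters. If ab = q²ba then (a + b)^N = a^N + b^N
(`IsQRoot.add_pow`), so N-th powers of all the operators involved are computable scalars. A finite
dimensional representation whose parameters are those of an irreducible cyclic representation is a
multiple of it (`IsIrred.evaluation_bijective`). Hence canonical maps are bijective, and irreducible
cyclic representations are classified by their parameters.

Canonical maps. A canonical map is a flip. Conversely a flip sends v₁ to the equivariant map v₂ ↦
L(v₁ ⊗ v₂), and by Schur every Clebsch-Gordan operator arises in this way from a unique v₁.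

Intertwining operators. Being an intertwiner amounts to one relation for each edge of the square,
provided the denominators in the coordinate change act invertibly. With the operators of the target
pulled back along L, these relations and those of a flip imply each other by a computation in a
noncommutative ring (`coord_of_flip`, `flip_of_coord`), whose core is a pair of factorizations of 1
+ qX₅. The denominators all divide powers of the central element 1 + X₅^N, which acts for a flip by
a nonzero scalar. For arbitrary representations of the triangle algebras, ZXY acts by a scalar, and
a rescaling of some of the generators that preserves the relations brings Z to the form qY⁻¹X⁻¹ on
the two triangles where this is needed.

`6j`-symbols. Both sides of the five-term relation carry operators on the multiplicity spaces to
explicit operators on V_μ ⊗ V_ν ⊗ V_σ, and comparing these shows that R is a flip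
(`isFlip_of_isSixJ`). Conversely, the parameters of the target of a flip determine those of its
source, and a flip between given representations is unique up to a scalar. So it suffices to find a
regular triple for which V_(μ,νσ) and V_(ν,σ) have prescribed parameters, which is a system of
rational equations with an explicit solution (`exists_triple_params`). -/

noncomputable section

namespace QTeich

/-! ### Operators that correspond to each other under a linear map -/

section Intertwines

variable {V W U V' W' U' : Type*} [AddCommGroup V] [Module ℂ V] [AddCommGroup W] [Module ℂ W]
  [AddCommGroup U] [Module ℂ U] [AddCommGroup V'] [Module ℂ V'] [AddCommGroup W'] [Module ℂ W']
  [AddCommGroup U'] [Module ℂ U']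

/-- The linear map `f` carries the operator `A` to the operator `B`. -/
def Intertwines (f : V →ₗ[ℂ] W) (A : Module.End ℂ V) (B : Module.End ℂ W) : Prop :=
  f ∘ₗ A = B ∘ₗ f

namespace Intertwines

variable {f : V →ₗ[ℂ] W} {A A' : Module.End ℂ V} {B B' : Module.End ℂ W}

theorem apply (h : Intertwines f A B) (v : V) : f (A v) = B (f v) := LinearMap.congr_fun h v

theorem of_apply (h : ∀ v, f (A v) = B (f v)) : Intertwines f A B := LinearMap.ext h

theorem one : Intertwines f 1 1 := of_apply fun _ => rfl

theorem add (h : Intertwines f A B) (h' : Intertwines f A' B') :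
    Intertwines f (A + A') (B + B') :=
  of_apply fun v => by simp [h.apply, h'.apply]

theorem mul (h : Intertwines f A B) (h' : Intertwines f A' B') :
    Intertwines f (A * A') (B * B') :=
  of_apply fun v => by simp [h.apply, h'.apply]

theorem smul (c : ℂ) (h : Intertwines f A B) : Intertwines f (c • A) (c • B) :=
  of_apply fun v => by simp [h.apply]

theorem pow (h : Intertwines f A B) (n : ℕ) : Intertwines f (A ^ n) (B ^ n) := by
  induction n with
  | zero => exact one
  | succ n ih => rw [pow_succ, pow_succ]; exact ih.mul h

theorem smul_map (c : ℂ) (h : Intertwines f A B) : Intertwines (c • f) A B :=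
  of_apply fun v => by simp [h.apply]

/-- f C = D B f C = D f A C = D f. One-sided inverses are enough, and `f` need not be invertible. -/
theorem of_mul_eq_one {C : Module.End ℂ V} {D : Module.End ℂ W} (h : Intertwines f A B)
    (hA : A * C = 1) (hB : D * B = 1) : Intertwines f C D := by
  refine of_apply fun v => ?_
  have h₁ := h.apply (C v)
  have h₂ : A (C v) = v := LinearMap.congr_fun hA v
  have h₃ : D (B (f (C v))) = f (C v) := LinearMap.congr_fun hB _
  rw [← h₃, ← h₁, h₂]

theorem inverse (h : Intertwines f A B) (hA : IsUnit A) (hB : IsUnit B) :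
    Intertwines f (Ring.inverse A) (Ring.inverse B) :=
  h.of_mul_eq_one (Ring.mul_inverse_cancel _ hA) (Ring.inverse_mul_cancel _ hB)

theorem comp {g : W →ₗ[ℂ] U} {C : Module.End ℂ U} (hg : Intertwines g B C)
    (hf : Intertwines f A B) : Intertwines (g ∘ₗ f) A C :=
  of_apply fun v => by simp [hg.apply, hf.apply]

theorem tensor {g : V' →ₗ[ℂ] W'} {C : Module.End ℂ V'} {D : Module.End ℂ W'}
    (hf : Intertwines f A B) (hg : Intertwines g C D) :
    Intertwines (TensorProduct.map f g) (TensorProduct.map A C) (TensorProduct.map B D) := by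
  refine TensorProduct.ext' fun v v' => ?_
  simp [hf.apply, hg.apply]

theorem symm {e : V ≃ₗ[ℂ] W} (h : Intertwines e.toLinearMap A B) :
    Intertwines e.symm.toLinearMap B A :=
  of_apply fun w => by
    have := h.apply (e.symm w)
    simp only [LinearEquiv.coe_coe, LinearEquiv.apply_symm_apply] at this
    simp [← this]

theorem eq_left {A'' : Module.End ℂ V} (h : Intertwines f A B) (h' : Intertwines f A'' B)
    (hf : Function.Injective f) : A = A'' :=
  LinearMap.ext fun v => hf (by rw [h.apply, h'.apply])

/-- An operator that is carried to an injective operator by an injective map is injective. -/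
theorem isUnit_left [FiniteDimensional ℂ V] (h : Intertwines f A B) (hf : Function.Injective f)
    (hB : IsUnit B) : IsUnit A := by
  rw [LinearMap.isUnit_iff_ker_eq_bot, LinearMap.ker_eq_bot]
  intro v v' hv
  have := congrArg f hv
  rw [h.apply, h.apply] at this
  exact hf (((Module.End.isUnit_iff _).mp hB).1 this)

theorem isUnit_right [FiniteDimensional ℂ W] (h : Intertwines f A B)
    (hf : Function.Surjective f) (hA : IsUnit A) : IsUnit B := by
  rw [LinearMap.isUnit_iff_range_eq_top, LinearMap.range_eq_top]
  intro w
  obtain ⟨v, rfl⟩ := hf w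
  obtain ⟨v', rfl⟩ := ((Module.End.isUnit_iff _).mp hA).2 v
  exact ⟨f v', (h.apply v').symm⟩

end Intertwines

theorem intertwines_assoc (A : Module.End ℂ V) (B : Module.End ℂ W) (C : Module.End ℂ U) :
    Intertwines (TensorProduct.assoc ℂ V W U).toLinearMap
      (TensorProduct.map (TensorProduct.map A B) C)
      (TensorProduct.map A (TensorProduct.map B C)) :=
  TensorProduct.ext_threefold fun _ _ _ => rfl

theorem intertwines_comm (A : Module.End ℂ V) (B : Module.End ℂ W) :
    Intertwines (TensorProduct.comm ℂ V W).toLinearMap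
      (TensorProduct.map A B) (TensorProduct.map B A) :=
  TensorProduct.ext' fun _ _ => rfl

theorem intertwines_rightComm (A : Module.End ℂ V) (B : Module.End ℂ W) (C : Module.End ℂ U) :
    Intertwines (TensorProduct.rightComm ℂ V W U).toLinearMap
      (TensorProduct.map (TensorProduct.map A B) C)
      (TensorProduct.map (TensorProduct.map A C) B) :=
  TensorProduct.ext_threefold fun _ _ _ => rfl

theorem isUnit_map {A : Module.End ℂ V} {B : Module.End ℂ W} (hA : IsUnit A) (hB : IsUnit B) :
    IsUnit (TensorProduct.map A B) := by
  obtain ⟨a, rfl⟩ := hA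
  obtain ⟨b, rfl⟩ := hB
  refine ⟨⟨TensorProduct.map a.1 b.1, TensorProduct.map a⁻¹.1 b⁻¹.1, ?_, ?_⟩, rfl⟩ <;>
  simp [← TensorProduct.map_mul, TensorProduct.map_one]

theorem exists_dual_apply_ne_zero {v : V} (hv : v ≠ 0) : ∃ φ : Module.Dual ℂ V, φ v ≠ 0 := by
  by_contra hc
  push Not at hc
  exact hv ((Module.forall_dual_apply_eq_zero_iff ℂ v).mp hc)

theorem eq_of_rTensor_eq [Nontrivial V] {f g : W →ₗ[ℂ] U} (h : f.rTensor V = g.rTensor V) :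
    f = g := by
  obtain ⟨v, hv⟩ := exists_ne (0 : V)
  obtain ⟨φ, hφ⟩ := exists_dual_apply_ne_zero hv
  ext w
  have h₁ := congrArg (φ.lTensor U) (LinearMap.congr_fun h (w ⊗ₜ v))
  have h₂ := congrArg (TensorProduct.rid ℂ U) h₁
  simpa [hφ] using h₂

end Intertwines

/-! ### Powers of elements that commute up to a root of unity -/

section QPowers

variable {N : ℕ} {q : ℂ} {E : Type*} [Ring E] [Algebra ℂ E]

theorem pow_mul_of_mul_eq_smul {a b : E} {s : ℂ} (h : b * a = s • (a * b)) (n : ℕ) :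
    b ^ n * a = s ^ n • (a * b ^ n) := by
  induction n with
  | zero => simp
  | succ n ih =>
    rw [pow_succ, mul_assoc, h, mul_smul_comm, ← mul_assoc, ih, smul_mul_assoc, smul_smul,
      mul_assoc, pow_succ' s]

/-- Sorting the word abab...ab moves a `b` past a later `a` once for each pair of positions. -/
theorem mul_pow_of_mul_eq_smul {a b : E} {s : ℂ} (h : b * a = s • (a * b)) (n : ℕ) :
    (a * b) ^ n = s ^ n.choose 2 • (a ^ n * b ^ n) := by
  induction n with
  | zero => simp
  | succ n ih =>
    rw [pow_succ, ih, smul_mul_assoc, mul_assoc (a ^ n), ← mul_assoc (b ^ n),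
      pow_mul_of_mul_eq_smul h, smul_mul_assoc, mul_smul_comm, smul_smul, ← pow_add,
      Nat.choose_succ_succ' n 1, Nat.choose_one_right, add_comm n, pow_succ a, pow_succ b]
    simp only [mul_assoc]

/-- The left side is q^(N(N-1)) = (-1)^((N+1)(N-1)), and (N+1)(N-1) has the parity of N + 1. This is
the sign that the condition on q^N is designed to cancel in N-th powers. -/
theorem IsQRoot.pow_choose_two (h : IsQRoot N q) : (q ^ 2) ^ N.choose 2 = (-1) ^ (N + 1) := by
  rw [← pow_mul, Nat.choose_two_right, Nat.mul_div_cancel' (Nat.even_mul_pred_self N).two_dvd,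
    pow_mul, h.pow_eq, ← pow_mul]
  obtain ⟨n, rfl⟩ : ∃ n, N = n + 1 := ⟨N - 1, by have := h.pos; omega⟩
  rw [Nat.add_sub_cancel, mul_comm, Nat.mul_add n _ 1, mul_one, pow_add,
    (Nat.even_mul_succ_self n).neg_one_pow, one_mul, pow_add, pow_add]
  norm_num

/-- The factorization of T^N - (-z)^N over the N-th roots of unity, evaluated at T = 1. -/
theorem IsQRoot.prod_one_add (h : IsQRoot N q) (z : ℂ) :
    ∏ i ∈ Finset.range N, (1 + (q ^ 2) ^ i * z) = 1 - (-z) ^ N := by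
  have h₁ := X_pow_sub_C_eq_prod h.primitive h.pos (α := -z) rfl
  have h₂ := congrArg (Polynomial.eval 1) h₁
  simp only [Polynomial.eval_sub, Polynomial.eval_pow, Polynomial.eval_X, one_pow,
    Polynomial.eval_C, Polynomial.eval_prod] at h₂
  rw [h₂]
  exact Finset.prod_congr rfl fun i _ => by ring

/-- The `N`-th power of a sum, when the summands commute up to a primitive `N`-th root of unity. -/
theorem IsQRoot.add_pow (h : IsQRoot N q) {a b : E} (ha : IsUnit a)
    (hab : a * b = q ^ 2 • (b * a)) : (a + b) ^ N = a ^ N + b ^ N := by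
  obtain ⟨a, rfl⟩ := ha
  set t := b * a⁻¹.1 with ht
  have hta : t * a.1 = b := by rw [ht, mul_assoc, Units.inv_mul, mul_one]
  have hat : a.1 * t = q ^ 2 • (t * a.1) := by
    rw [ht, ← mul_assoc, hab, smul_mul_assoc, mul_assoc, mul_assoc, Units.mul_inv,
      Units.inv_mul]
  -- Since a + b = (1 + t)a and moving a past t costs q², the power (a + b)^n is the product of the
  -- 1 + q^(2i) t for i < n, times a^n. The factors are polynomials in the single element t, so for
  -- n = N the scalar product formula applies.
  let p : ℕ → Polynomial ℂ := fun n =>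
    ∏ i ∈ Finset.range n, (1 + Polynomial.C ((q ^ 2) ^ i) * Polynomial.X)
  have hp : ∀ n, (a.1 + b) ^ n = Polynomial.aeval t (p n) * a.1 ^ n := by
    intro n
    induction n with
    | zero => simp [p]
    | succ n ih =>
      have h₁ := pow_mul_of_mul_eq_smul hat n
      have h₂ : a.1 ^ n * (a.1 + b) = (1 + (q ^ 2) ^ n • t) * a.1 ^ (n + 1) := by
        rw [mul_add, ← pow_succ, ← hta, ← mul_assoc, h₁, smul_mul_assoc, mul_assoc, ← pow_succ,
          add_mul, one_mul, smul_mul_assoc]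
      have h₃ : Polynomial.aeval t (p (n + 1)) =
          Polynomial.aeval t (p n) * (1 + (q ^ 2) ^ n • t) := by
        simp only [p]
        rw [Finset.prod_range_succ, map_mul, map_add, map_one, map_mul, Polynomial.aeval_C,
          Polynomial.aeval_X, ← Algebra.smul_def]
      rw [pow_succ, ih, mul_assoc, h₂, h₃, mul_assoc]
  have hN : p N = 1 - (-Polynomial.X) ^ N := by
    refine Polynomial.funext fun z => ?_
    simp only [p, Polynomial.eval_prod, Polynomial.eval_add, Polynomial.eval_one,
      Polynomial.eval_mul, Polynomial.eval_C, Polynomial.eval_X, Polynomial.eval_sub,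
      Polynomial.eval_pow, Polynomial.eval_neg]
    exact h.prod_one_add z
  -- The sign from sorting (ta)^N is exactly the sign of t^N in 1 - (-t)^N.
  have hb : b ^ N = (-1 : ℂ) ^ (N + 1) • (t ^ N * a.1 ^ N) := by
    rw [← hta, mul_pow_of_mul_eq_smul hat, h.pow_choose_two]
  rw [hp, hN, hb, map_sub, map_one, map_pow, map_neg, Polynomial.aeval_X, sub_mul, one_mul,
    neg_pow t, pow_succ (-1 : ℂ), mul_neg_one, neg_smul, sub_eq_add_neg]
  congr 2
  rw [Algebra.smul_def, map_pow, map_neg, map_one, mul_assoc]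

end QPowers

/-! ### Irreducible representations -/

section Schur

variable {A : Type*} [Ring A] [Algebra ℂ A] {V V' U U' : Type*}
  [AddCommGroup V] [Module ℂ V] [AddCommGroup V'] [Module ℂ V']
  [AddCommGroup U] [Module ℂ U] [AddCommGroup U'] [Module ℂ U']

/-- Schur's lemma. -/
theorem IsIrred.exists_eq_smul_one [FiniteDimensional ℂ V] {μ : A →ₐ[ℂ] Module.End ℂ V}
    (hμ : IsIrred μ) {T : Module.End ℂ V} (hT : ∀ a, Commute T (μ a)) :
    ∃ c : ℂ, T = c • (1 : Module.End ℂ V) := by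
  have := hμ.1
  obtain ⟨c, hc⟩ := Module.End.exists_eigenvalue T
  refine ⟨c, ?_⟩
  have h := hμ.2 (T.eigenspace c) fun a v hv => by
    rw [Module.End.mem_eigenspace_iff] at hv ⊢
    have h₁ := LinearMap.congr_fun (hT a).eq v
    simp only [Module.End.mul_apply] at h₁
    rw [h₁, hv, map_smul]
  rcases h with h | h
  · exact absurd h hc
  · ext v
    have : v ∈ T.eigenspace c := h ▸ Submodule.mem_top
    simpa using Module.End.mem_eigenspace_iff.mp this

/-- The coordinates with respect to a basis of `U` are contractions with the dual functionals. -/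
theorem tensor_ext_dual [FiniteDimensional ℂ U] {s t : U ⊗[ℂ] V}
    (h : ∀ φ : Module.Dual ℂ U, TensorProduct.lid ℂ V (φ.rTensor V s) =
      TensorProduct.lid ℂ V (φ.rTensor V t)) : s = t := by
  let b := Module.finBasis ℂ U
  refine (TensorProduct.equivFinsuppOfBasisLeft b).injective (Finsupp.ext fun i => ?_)
  rw [TensorProduct.equivFinsuppOfBasisLeft_apply, TensorProduct.equivFinsuppOfBasisLeft_apply]
  exact h _

/-- A linear map of tensor products that commutes with an irreducible action on the second factor
acts on the first factor only. -/
theorem IsIrred.exists_eq_rTensor [FiniteDimensional ℂ V] [FiniteDimensional ℂ U']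
    {μ : A →ₐ[ℂ] Module.End ℂ V} (hμ : IsIrred μ) {T : U ⊗[ℂ] V →ₗ[ℂ] U' ⊗[ℂ] V}
    (hT : ∀ a, T ∘ₗ TensorProduct.map 1 (μ a) = TensorProduct.map 1 (μ a) ∘ₗ T) :
    ∃ R : U →ₗ[ℂ] U', T = R.rTensor V := by
  have := hμ.1
  -- The matrix coefficients of `T` in the first factor. Each is an endomorphism of `V` commuting
  -- with the irreducible action, hence a scalar.
  let D : U → Module.Dual ℂ U' → Module.End ℂ V := fun u φ =>
    (TensorProduct.lid ℂ V).toLinearMap ∘ₗ φ.rTensor V ∘ₗ T ∘ₗ TensorProduct.mk ℂ U V u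
  have hlid : ∀ (φ : Module.Dual ℂ U') (a : A) (t : U' ⊗[ℂ] V),
      TensorProduct.lid ℂ V (φ.rTensor V (TensorProduct.map 1 (μ a) t)) =
        μ a (TensorProduct.lid ℂ V (φ.rTensor V t)) := by
    intro φ a t
    induction t with
    | zero => simp
    | tmul x y => simp
    | add x y hx hy => simp only [map_add, hx, hy]
  have hD : ∀ u φ, ∃ c : ℂ, D u φ = c • (1 : Module.End ℂ V) := by
    intro u φ
    refine hμ.exists_eq_smul_one fun a => ?_
    ext v
    have h₁ := LinearMap.congr_fun (hT a) (u ⊗ₜ v)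
    simp only [LinearMap.comp_apply, TensorProduct.map_tmul, Module.End.one_apply] at h₁
    simp only [Module.End.mul_apply, D, LinearMap.comp_apply, LinearEquiv.coe_coe,
      TensorProduct.mk_apply, h₁, hlid]
  choose c hc using hD
  obtain ⟨v₀, hv₀⟩ := exists_ne (0 : V)
  obtain ⟨ψ, hψ⟩ := exists_dual_apply_ne_zero hv₀
  -- The scalars are read off at a fixed vector `v₀` with a fixed functional `ψ`, which makes `R`
  -- linear in `u` by construction.
  let R : U →ₗ[ℂ] U' := (ψ v₀)⁻¹ • ((TensorProduct.rid ℂ U').toLinearMap ∘ₗ ψ.lTensor U' ∘ₗ T ∘ₗ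
    (TensorProduct.mk ℂ U V).flip v₀)
  refine ⟨R, TensorProduct.ext' fun u v => tensor_ext_dual fun φ => ?_⟩
  have h₁ : TensorProduct.lid ℂ V (φ.rTensor V (T (u ⊗ₜ v))) = c u φ • v :=
    LinearMap.congr_fun (hc u φ) v
  have h₂ : TensorProduct.lid ℂ V (φ.rTensor V (T (u ⊗ₜ v₀))) = c u φ • v₀ :=
    LinearMap.congr_fun (hc u φ) v₀
  have h₃ : ∀ t : U' ⊗[ℂ] V, φ (TensorProduct.rid ℂ U' (ψ.lTensor U' t)) =
      ψ (TensorProduct.lid ℂ V (φ.rTensor V t)) := by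
    intro t
    induction t with
    | zero => simp
    | tmul x y => simp [mul_comm]
    | add x y hx hy => simp only [map_add, hx, hy]
  have h₄ : φ (R u) = c u φ := by
    simp only [R, LinearMap.smul_apply, LinearMap.comp_apply, LinearEquiv.coe_coe,
      LinearMap.flip_apply, TensorProduct.mk_apply, map_smul, h₃, h₂, smul_eq_mul]
    field_simp
  rw [h₁]
  simp [h₄]

/-- An operator on a tensor product that commutes with irreducible actions on the two factors is
a scalar. -/
theorem IsIrred.tensor_exists_eq_smul_one {B : Type*} [Ring B] [Algebra ℂ B]
    [FiniteDimensional ℂ U] [FiniteDimensional ℂ V]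
    {μ : A →ₐ[ℂ] Module.End ℂ U} {ν : B →ₐ[ℂ] Module.End ℂ V} (hμ : IsIrred μ) (hν : IsIrred ν)
    {T : Module.End ℂ (U ⊗[ℂ] V)} (h₁ : ∀ a, Commute T (TensorProduct.map (μ a) 1))
    (h₂ : ∀ b, Commute T (TensorProduct.map 1 (ν b))) :
    ∃ c : ℂ, T = c • (1 : Module.End ℂ (U ⊗[ℂ] V)) := by
  obtain ⟨R, hR⟩ := hν.exists_eq_rTensor (T := T) fun b => (h₂ b).eq
  have := hν.1
  obtain ⟨c, hc⟩ := hμ.exists_eq_smul_one (T := R) fun a => by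
    have h₃ := (h₁ a).eq
    rw [hR] at h₃
    refine eq_of_rTensor_eq (V := V) (TensorProduct.ext' fun u v => ?_)
    simpa using LinearMap.congr_fun h₃ (u ⊗ₜ v)
  exact ⟨c, by rw [hR, hc]; refine TensorProduct.ext' fun u v => ?_; simp [TensorProduct.smul_tmul']⟩

theorem IsRepIso.intertwines {μ : A →ₐ[ℂ] Module.End ℂ V} {μ' : A →ₐ[ℂ] Module.End ℂ V'}
    {e : V ≃ₗ[ℂ] V'} (h : IsRepIso μ μ' e) (a : A) : Intertwines e.toLinearMap (μ a) (μ' a) :=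
  Intertwines.of_apply (h a)

theorem IsIrred.of_isRepIso {μ : A →ₐ[ℂ] Module.End ℂ V} {μ' : A →ₐ[ℂ] Module.End ℂ V'}
    {e : V ≃ₗ[ℂ] V'} (h : IsRepIso μ μ' e) (hμ' : IsIrred μ') : IsIrred μ := by
  refine ⟨have := hμ'.1; e.toEquiv.nontrivial, fun p hp => ?_⟩
  have := hμ'.2 (p.map e.toLinearMap) (by
    rintro a _ ⟨v, hv, rfl⟩
    exact ⟨μ a v, hp a v hv, h a v⟩)
  rcases this with h₁ | h₁
  · left
    exact Submodule.map_injective_of_injective e.injective (h₁.trans (Submodule.map_bot _).symm)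
  · right
    rw [eq_top_iff]
    intro v _
    have : e v ∈ p.map e.toLinearMap := h₁ ▸ Submodule.mem_top
    obtain ⟨v', hv', h'⟩ := this
    rwa [← e.injective h']

theorem IsIrred.bijective_of_ne_zero {μ : A →ₐ[ℂ] Module.End ℂ V} {μ' : A →ₐ[ℂ] Module.End ℂ V'}
    (hμ : IsIrred μ) (hμ' : IsIrred μ') {f : V →ₗ[ℂ] V'} (hf : ∀ a v, f (μ a v) = μ' a (f v))
    (h0 : f ≠ 0) : Function.Bijective f := by
  constructor
  · rcases hμ.2 (LinearMap.ker f) (fun a v hv => by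
      rw [LinearMap.mem_ker] at hv ⊢; rw [hf, hv, map_zero]) with h | h
    · exact LinearMap.ker_eq_bot.mp h
    · exact absurd (LinearMap.ker_eq_top.mp h) h0
  · rcases hμ'.2 (LinearMap.range f) (by rintro a _ ⟨v, rfl⟩; exact ⟨μ a v, hf a v⟩) with h | h
    · exact absurd (LinearMap.range_eq_bot.mp h) h0
    · exact LinearMap.range_eq_top.mp h

end Schur

/-! ### Cyclic representations of the Weyl algebra -/

section Cyclic

variable {N : ℕ} {q : ℂ} {V V' U Vμ Vν : Type*}
  [AddCommGroup V] [Module ℂ V] [AddCommGroup V'] [Module ℂ V'] [AddCommGroup U] [Module ℂ U]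
  [AddCommGroup Vμ] [Module ℂ Vμ] [AddCommGroup Vν] [Module ℂ Vν]

theorem Weyl.intertwines_of_gen {μ : Weyl q →ₐ[ℂ] Module.End ℂ V}
    {μ' : Weyl q →ₐ[ℂ] Module.End ℂ V'} {f : V →ₗ[ℂ] V'}
    (hX : Intertwines f (μ (Weyl.X q)) (μ' (Weyl.X q)))
    (hY : Intertwines f (μ (Weyl.Y q)) (μ' (Weyl.Y q))) (w : Weyl q) :
    Intertwines f (μ w) (μ' w) := by
  have hXi : Intertwines f (μ (Weyl.Xinv q)) (μ' (Weyl.Xinv q)) :=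
    hX.of_mul_eq_one (rep_X_Xinv μ) (rep_Xinv_X μ')
  obtain ⟨a, rfl⟩ := Weyl.mk_surjective w
  induction a using FreeAlgebra.induction with
  | grade0 r =>
    rw [AlgHom.commutes, AlgHom.commutes, AlgHom.commutes, Algebra.algebraMap_eq_smul_one,
      Algebra.algebraMap_eq_smul_one]
    exact Intertwines.one.smul r
  | grade1 g =>
    cases g
    · exact hX
    · exact hXi
    · exact hY
  | mul a b ha hb => rw [map_mul, map_mul, map_mul]; exact ha.mul hb
  | add a b ha hb => rw [map_add, map_add, map_add]; exact ha.add hb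

/-- A subspace that is stable under an injective operator is stable under its inverse. -/
theorem mem_of_apply_mem [FiniteDimensional ℂ V] {T : Module.End ℂ V} (hT : IsUnit T)
    {p : Submodule ℂ V} (hp : ∀ v ∈ p, T v ∈ p) {v : V} (hv : T v ∈ p) : v ∈ p := by
  have hinj := ((Module.End.isUnit_iff _).mp hT).1
  have h : p.map T = p := by
    refine Submodule.eq_of_le_of_finrank_eq (Submodule.map_le_iff_le_comap.mpr hp) ?_
    exact (Submodule.equivMapOfInjective T hinj p).finrank_eq.symm
  rw [← h] at hv
  obtain ⟨v', hv', hvv⟩ := hv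
  rwa [← hinj hvv]

/-- Irreducibility of a representation of the Weyl algebra in terms of `X` and `Y`. -/
theorem IsIrred.of_gen [FiniteDimensional ℂ V] [Nontrivial V] {μ : Weyl q →ₐ[ℂ] Module.End ℂ V}
    (h : ∀ p : Submodule ℂ V, (∀ v ∈ p, μ (Weyl.X q) v ∈ p) → (∀ v ∈ p, μ (Weyl.Y q) v ∈ p) →
      p = ⊥ ∨ p = ⊤) : IsIrred μ :=
  ⟨inferInstance, fun p hp => h p (hp _) (hp _)⟩

/-- Finite dimension makes stability under X⁻¹ automatic: an injective operator that maps a subspace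
into itself maps it onto itself. -/
theorem IsIrred.gen [FiniteDimensional ℂ V] {μ : Weyl q →ₐ[ℂ] Module.End ℂ V}
    (hμ : IsIrred μ) (p : Submodule ℂ V) (hX : ∀ v ∈ p, μ (Weyl.X q) v ∈ p)
    (hY : ∀ v ∈ p, μ (Weyl.Y q) v ∈ p) : p = ⊥ ∨ p = ⊤ := by
  refine hμ.2 p fun w => ?_
  have hXi : ∀ v ∈ p, μ (Weyl.Xinv q) v ∈ p := fun v hv =>
    mem_of_apply_mem (Weyl.isUnit_map_X μ) hX (by
      have := LinearMap.congr_fun (rep_X_Xinv μ) v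
      simp only [Module.End.mul_apply, Module.End.one_apply] at this
      rwa [this])
  obtain ⟨a, rfl⟩ := Weyl.mk_surjective w
  induction a using FreeAlgebra.induction with
  | grade0 r =>
    intro v hv
    rw [AlgHom.commutes, AlgHom.commutes]
    exact p.smul_mem r hv
  | grade1 g =>
    cases g
    · exact hX
    · exact hXi
    · exact hY
  | mul a b ha hb => intro v hv; rw [map_mul, map_mul]; exact ha _ (hb _ hv)
  | add a b ha hb => intro v hv; rw [map_add, map_add]; exact p.add_mem (ha _ hv) (hb _ hv)

/-- Moving an N-th power costs (q²)^N = 1. Applied to X and Y, this makes X^N and Y^N central, so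
that they are scalars on irreducible representations. -/
theorem IsQRoot.commute_pow (h : IsQRoot N q) {E : Type*} [Ring E] [Algebra ℂ E] {a b : E}
    (hab : a * b = q ^ 2 • (b * a)) : Commute (a ^ N) b ∧ Commute a (b ^ N) := by
  have hq : q ^ 2 ≠ 0 := pow_ne_zero 2 h.ne_zero
  have h1 : (q ^ 2) ^ N = 1 := h.primitive.pow_eq_one
  constructor
  · have := pow_mul_of_mul_eq_smul hab N
    rwa [h1, one_smul] at this
  · have := pow_mul_of_mul_eq_smul (swap_rel hq hab) N
    rw [inv_pow, h1, inv_one, one_smul] at this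
    exact this.symm

theorem IsIrred.exists_hasParams (h : IsQRoot N q) [FiniteDimensional ℂ V]
    {μ : Weyl q →ₐ[ℂ] Module.End ℂ V} (hμ : IsIrred μ) : ∃ x y, HasParams N μ x y := by
  obtain ⟨h₁, h₂⟩ := h.commute_pow (rep_X_Y μ)
  obtain ⟨x, hx⟩ := hμ.exists_eq_smul_one (Weyl.commute_of_gen μ _ ((Commute.refl _).pow_left N) h₁)
  obtain ⟨y, hy⟩ := hμ.exists_eq_smul_one
    (Weyl.commute_of_gen μ _ h₂.symm ((Commute.refl _).pow_left N))
  exact ⟨x, y, hx, hy⟩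

theorem ne_zero_of_isUnit_smul_one [Nontrivial V] {c : ℂ}
    (h : IsUnit (c • (1 : Module.End ℂ V))) : c ≠ 0 := by
  rintro rfl
  rw [zero_smul] at h
  exact not_isUnit_zero h

theorem IsCyclic.params_ne_zero {μ : Weyl q →ₐ[ℂ] Module.End ℂ V} [Nontrivial V]
    (hμ : IsCyclic μ) {x y : ℂ} (hp : HasParams N μ x y) : x ≠ 0 ∧ y ≠ 0 :=
  ⟨ne_zero_of_isUnit_smul_one (hp.1 ▸ hμ.isUnit_X.pow N),
    ne_zero_of_isUnit_smul_one (hp.2 ▸ hμ.isUnit_Y.pow N)⟩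

theorem isUnit_of_pow_eq_smul_one (h : IsQRoot N q) {T : Module.End ℂ V} {c : ℂ} (hc : c ≠ 0)
    (hT : T ^ N = c • (1 : Module.End ℂ V)) : IsUnit T := by
  rw [← isUnit_pow_iff h.pos.ne', hT]
  exact isUnit_one.smul (Units.mk0 c hc)

theorem HasParams.isCyclic (h : IsQRoot N q) [FiniteDimensional ℂ V]
    {μ : Weyl q →ₐ[ℂ] Module.End ℂ V} {x y : ℂ} (hp : HasParams N μ x y) (hy : y ≠ 0) :
    IsCyclic μ :=
  ⟨inferInstance, Weyl.isUnit_map_X μ, isUnit_of_pow_eq_smul_one h hy hp.2⟩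

theorem HasParams.Xinv_pow {μ : Weyl q →ₐ[ℂ] Module.End ℂ V} {x y : ℂ}
    (hp : HasParams N μ x y) (hx : x ≠ 0) :
    μ (Weyl.Xinv q) ^ N = x⁻¹ • (1 : Module.End ℂ V) := by
  have hc : Commute (μ (Weyl.Xinv q)) (μ (Weyl.X q)) :=
    (rep_Xinv_X μ).trans (rep_X_Xinv μ).symm
  have := hc.mul_pow N
  rw [rep_Xinv_X, one_pow, hp.1, mul_smul_comm, mul_one] at this
  rw [this, smul_smul, inv_mul_cancel₀ hx, one_smul]

theorem HasParams.Yinv_pow {μ : Weyl q →ₐ[ℂ] Module.End ℂ V} {x y : ℂ}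
    (hp : HasParams N μ x y) (hμ : IsUnit (μ (Weyl.Y q))) (hy : y ≠ 0) :
    Ring.inverse (μ (Weyl.Y q)) ^ N = y⁻¹ • (1 : Module.End ℂ V) := by
  have hc : Commute (Ring.inverse (μ (Weyl.Y q))) (μ (Weyl.Y q)) :=
    commute_ringInverse hμ (Commute.refl _)
  have := hc.mul_pow N
  rw [Ring.inverse_mul_cancel _ hμ, one_pow, hp.2, mul_smul_comm, mul_one] at this
  rw [this, smul_smul, inv_mul_cancel₀ hy, one_smul]

/-- The summands Y ⊗ 1 and X⁻¹ ⊗ Y of Δ(Y) commute up to q², so the N-th power of their sum is the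
sum of their N-th powers. This is the origin of the formula for the parameters of μν. -/
theorem HasParams.tensorRep (h : IsQRoot N q) {μ : Weyl q →ₐ[ℂ] Module.End ℂ Vμ}
    {ν : Weyl q →ₐ[ℂ] Module.End ℂ Vν} {xμ yμ xν yν : ℂ} (hμ : HasParams N μ xμ yμ)
    (hν : HasParams N ν xν yν) (hx : xμ ≠ 0) (hy : yμ ≠ 0) :
    HasParams N (tensorRep μ ν) (xμ * xν) (xμ⁻¹ * yν + yμ) := by
  have hY := isUnit_of_pow_eq_smul_one h hy hμ.2
  constructor
  · rw [tensorRep_X, TensorProduct.map_pow, hμ.1, hν.1, TensorProduct.map_smul_left,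
      TensorProduct.map_smul_right, TensorProduct.map_one, smul_smul]
  · rw [tensorRep_Y, add_comm, h.add_pow (isUnit_map hY isUnit_one), TensorProduct.map_pow,
      TensorProduct.map_pow, hμ.2, hν.2, hμ.Xinv_pow hx, one_pow]
    · simp only [TensorProduct.map_smul_left, TensorProduct.map_smul_right, TensorProduct.map_one,
        smul_smul, ← add_smul]
      rw [add_comm, mul_comm yν]
    · rw [← TensorProduct.map_mul, ← TensorProduct.map_mul, rep_Y_Xinv, one_mul, mul_one,
        TensorProduct.map_smul_left]

end Cyclic

/-! ### Eigenvectors of X, and representations that are multiples of an irreducible one -/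

section Isotypic

variable {N : ℕ} {q : ℂ} {V V' U : Type*}
  [AddCommGroup V] [Module ℂ V] [AddCommGroup V'] [Module ℂ V'] [AddCommGroup U] [Module ℂ U]

theorem X_apply_Y_pow (τ : Weyl q →ₐ[ℂ] Module.End ℂ U) {ξ : ℂ} {u : U}
    (hu : τ (Weyl.X q) u = ξ • u) (i : ℕ) :
    τ (Weyl.X q) ((τ (Weyl.Y q) ^ i) u) = ((q ^ 2) ^ i * ξ) • (τ (Weyl.Y q) ^ i) u := by
  induction i with
  | zero => simpa using hu
  | succ i ih =>
    have h := LinearMap.congr_fun (rep_X_Y τ) ((τ (Weyl.Y q) ^ i) u)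
    simp only [Module.End.mul_apply, LinearMap.smul_apply] at h
    rw [pow_succ', Module.End.mul_apply, h, ih, map_smul, smul_smul, pow_succ' (q ^ 2), mul_assoc]

theorem IsQRoot.pow_mul_injective (h : IsQRoot N q) {ξ : ℂ} (hξ : ξ ≠ 0) :
    Function.Injective fun i : Fin N => (q ^ 2) ^ (i : ℕ) * ξ := fun i j hij =>
  Fin.ext (h.primitive.pow_inj i.2 j.2 (mul_right_cancel₀ hξ hij))

theorem hasEigenvector_Y_pow (τ : Weyl q →ₐ[ℂ] Module.End ℂ U) (hY : IsUnit (τ (Weyl.Y q)))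
    {ξ : ℂ} {u : U} (hu : τ (Weyl.X q) u = ξ • u) (hu0 : u ≠ 0) (i : ℕ) :
    (τ (Weyl.X q)).HasEigenvector ((q ^ 2) ^ i * ξ) ((τ (Weyl.Y q) ^ i) u) := by
  refine ⟨Module.End.mem_eigenspace_iff.mpr (X_apply_Y_pow τ hu i), fun h0 => hu0 ?_⟩
  exact ((Module.End.isUnit_iff _).mp (hY.pow i)).1 (h0.trans (map_zero _).symm)

/-- Each application of Y multiplies the eigenvalue of X by q², so these are eigenvectors for the N
distinct eigenvalues q^(2i) ξ. -/
theorem linearIndependent_Y_pow (h : IsQRoot N q) (τ : Weyl q →ₐ[ℂ] Module.End ℂ U)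
    (hY : IsUnit (τ (Weyl.Y q))) {ξ : ℂ} (hξ : ξ ≠ 0) {u : U} (hu : τ (Weyl.X q) u = ξ • u)
    (hu0 : u ≠ 0) : LinearIndependent ℂ fun i : Fin N => (τ (Weyl.Y q) ^ (i : ℕ)) u :=
  Module.End.eigenvectors_linearIndependent' (τ (Weyl.X q)) _ (h.pow_mul_injective hξ) _
    fun i => hasEigenvector_Y_pow τ hY hu hu0 i

theorem pow_apply_of_eigen {T : Module.End ℂ V} {ξ : ℂ} {v : V} (hv : T v = ξ • v) (n : ℕ) :
    (T ^ n) v = ξ ^ n • v := by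
  induction n with
  | zero => simp
  | succ n ih => rw [pow_succ, Module.End.mul_apply, hv, map_smul, ih, smul_smul, pow_succ']

theorem eigenvalue_ne_zero {T : Module.End ℂ V} (hT : IsUnit T) {ξ : ℂ} {v : V}
    (hv : T v = ξ • v) (hv0 : v ≠ 0) : ξ ≠ 0 := by
  rintro rfl
  rw [zero_smul] at hv
  exact hv0 (((Module.End.isUnit_iff _).mp hT).1 (hv.trans (map_zero _).symm))

/-- A nonzero stable subspace of a cyclic representation has dimension at least `N`. -/
theorem IsCyclic.le_finrank (h : IsQRoot N q) {τ : Weyl q →ₐ[ℂ] Module.End ℂ U}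
    (hτ : IsCyclic τ) {p : Submodule ℂ U} (hp : p ≠ ⊥) (hX : ∀ u ∈ p, τ (Weyl.X q) u ∈ p)
    (hY : ∀ u ∈ p, τ (Weyl.Y q) u ∈ p) : N ≤ Module.finrank ℂ p := by
  have := hτ.finite
  have : Nontrivial p := Submodule.nontrivial_iff_ne_bot.mpr hp
  obtain ⟨ξ, hξ⟩ := Module.End.exists_eigenvalue ((τ (Weyl.X q)).restrict hX)
  obtain ⟨⟨w, hwp⟩, hw⟩ := hξ.exists_hasEigenvector
  have hw0 : w ≠ 0 := fun h0 => hw.2 (Subtype.ext h0)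
  have hXw : τ (Weyl.X q) w = ξ • w := congrArg Subtype.val hw.apply_eq_smul
  have hli := linearIndependent_Y_pow h τ hτ.isUnit_Y
    (eigenvalue_ne_zero hτ.isUnit_X hXw hw0) hXw hw0
  have hmem : ∀ i : ℕ, (τ (Weyl.Y q) ^ i) w ∈ p := by
    intro i
    induction i with
    | zero => exact hwp
    | succ i ih => rw [pow_succ', Module.End.mul_apply]; exact hY _ ih
  have hli' : LinearIndependent ℂ fun i : Fin N => (⟨_, hmem i⟩ : p) :=
    LinearIndependent.of_comp p.subtype hli
  simpa using hli'.fintype_card_le_finrank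

/-- A nonzero invariant subspace already has dimension at least N. -/
theorem IsCyclic.isIrred_of_finrank (h : IsQRoot N q) {τ : Weyl q →ₐ[ℂ] Module.End ℂ U}
    (hτ : IsCyclic τ) (hN : Module.finrank ℂ U = N) : IsIrred τ := by
  have := hτ.finite
  have : Nontrivial U := Module.finrank_pos_iff (R := ℂ).mp (hN ▸ h.pos)
  refine IsIrred.of_gen fun p hX hY => or_iff_not_imp_left.mpr fun hp => ?_
  refine Submodule.eq_top_of_finrank_eq (le_antisymm (Submodule.finrank_le p) ?_)
  rw [hN]
  exact hτ.le_finrank h hp hX hY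

/-- A basis of an irreducible cyclic representation. -/
theorem IsIrred.exists_basis (h : IsQRoot N q) {κ : Weyl q →ₐ[ℂ] Module.End ℂ V}
    (hκ : IsIrred κ) (hc : IsCyclic κ) : ∃ (ξ : ℂ) (w : V) (b : Module.Basis (Fin N) ℂ V), ξ ≠ 0 ∧
      κ (Weyl.X q) w = ξ • w ∧ ∀ i, b i = (κ (Weyl.Y q) ^ (i : ℕ)) w := by
  have := hκ.1
  have := hc.finite
  obtain ⟨ξ, hξ⟩ := Module.End.exists_eigenvalue (κ (Weyl.X q))
  obtain ⟨w, hw⟩ := hξ.exists_hasEigenvector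
  have hXw := hw.apply_eq_smul
  have hξ0 := eigenvalue_ne_zero hc.isUnit_X hXw hw.2
  have hli := linearIndependent_Y_pow h κ hc.isUnit_Y hξ0 hXw hw.2
  obtain ⟨x, y, hp⟩ := hκ.exists_hasParams h
  have hmem : ∀ i : Fin N, (κ (Weyl.Y q) ^ (i : ℕ)) w ∈
      Submodule.span ℂ (Set.range fun i : Fin N => (κ (Weyl.Y q) ^ (i : ℕ)) w) :=
    fun i => Submodule.subset_span ⟨i, rfl⟩
  have htop := hκ.gen (Submodule.span ℂ (Set.range fun i : Fin N => (κ (Weyl.Y q) ^ (i : ℕ)) w))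
    (fun v hv => by
      induction hv using Submodule.span_induction with
      | mem v hv =>
        obtain ⟨i, rfl⟩ := hv
        simp only
        rw [X_apply_Y_pow κ hXw]
        exact Submodule.smul_mem _ _ (hmem i)
      | zero => rw [map_zero]; exact Submodule.zero_mem _
      | add a b _ _ ha hb => rw [map_add]; exact Submodule.add_mem _ ha hb
      | smul c a _ ha => rw [map_smul]; exact Submodule.smul_mem _ _ ha)
    (fun v hv => by
      induction hv using Submodule.span_induction with
      | mem v hv =>
        obtain ⟨i, rfl⟩ := hv
        simp only
        rw [← Module.End.mul_apply, ← pow_succ']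
        -- Y raises the index by one; from index N - 1 it returns to a multiple of `w`, because Y^N
        -- is a scalar.
        rcases Nat.lt_or_ge (i + 1) N with hi | hi
        · exact hmem ⟨i + 1, hi⟩
        · have : (i : ℕ) + 1 = N := le_antisymm i.2 hi
          rw [this, hp.2]
          exact Submodule.smul_mem _ y (hmem ⟨0, h.pos⟩)
      | zero => rw [map_zero]; exact Submodule.zero_mem _
      | add a b _ _ ha hb => rw [map_add]; exact Submodule.add_mem _ ha hb
      | smul c a _ ha => rw [map_smul]; exact Submodule.smul_mem _ _ ha)
  have hspan : ⊤ ≤ Submodule.span ℂ (Set.range fun i : Fin N => (κ (Weyl.Y q) ^ (i : ℕ)) w) := by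
    rcases htop with hb | ht
    · have : w ∈ (⊥ : Submodule ℂ V) := hb ▸ hmem ⟨0, h.pos⟩
      exact absurd ((Submodule.mem_bot ℂ).mp this) hw.2
    · exact ht.ge
  exact ⟨ξ, w, Module.Basis.mk hli hspan, hξ0, hXw, fun i => by rw [Module.Basis.mk_apply]⟩

theorem IsIrred.finrank_eq (h : IsQRoot N q) {κ : Weyl q →ₐ[ℂ] Module.End ℂ V}
    (hκ : IsIrred κ) (hc : IsCyclic κ) : Module.finrank ℂ V = N := by
  obtain ⟨ξ, w, b, -⟩ := hκ.exists_basis h hc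
  rw [Module.finrank_eq_card_basis b, Fintype.card_fin]

/-- The space of equivariant linear maps. -/
def homSubmodule (κ : Weyl q →ₐ[ℂ] Module.End ℂ V) (τ : Weyl q →ₐ[ℂ] Module.End ℂ U) :
    Submodule ℂ (V →ₗ[ℂ] U) where
  carrier := {f | ∀ w v, f (κ w v) = τ w (f v)}
  zero_mem' := by simp
  add_mem' := by
    intro f g hf hg w v
    simp [hf w v, hg w v]
  smul_mem' := by
    intro c f hf w v
    simp [hf w v]

/-- `T` is annihilated by T^N - x, which has simple roots because x ≠ 0, so it is diagonalizable. -/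
theorem iSup_eigenspace_eq_top_of_pow (h : IsQRoot N q) [FiniteDimensional ℂ U]
    {T : Module.End ℂ U} {x : ℂ} (hx : x ≠ 0) (hT : T ^ N = x • (1 : Module.End ℂ U)) :
    ⨆ c : ℂ, T.eigenspace c = ⊤ := by
  have hs : (Polynomial.X ^ N - Polynomial.C x : Polynomial ℂ).Separable :=
    Polynomial.separable_X_pow_sub_C x (Nat.cast_ne_zero.mpr h.pos.ne') hx
  refine Module.End.IsSemisimple.iSup_eigenspace_eq_top ?_
  refine Module.End.isSemisimple_of_squarefree_aeval_eq_zero hs.squarefree ?_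
  rw [map_sub, map_pow, Polynomial.aeval_X, Polynomial.aeval_C, hT, Algebra.algebraMap_eq_smul_one,
    sub_self]

/-- A representation with the same parameters as an irreducible cyclic representation is a
multiple of it. -/
theorem IsIrred.evaluation_bijective (h : IsQRoot N q) [FiniteDimensional ℂ U]
    {κ : Weyl q →ₐ[ℂ] Module.End ℂ V} (hκ : IsIrred κ) (hc : IsCyclic κ) {x y : ℂ}
    (hp : HasParams N κ x y) {τ : Weyl q →ₐ[ℂ] Module.End ℂ U} (hτ : HasParams N τ x y) :
    Function.Bijective (TensorProduct.lift (homSubmodule κ τ).subtype) := by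
  have := hκ.1
  obtain ⟨hx0, hy0⟩ := hc.params_ne_zero hp
  have hτc := hτ.isCyclic h hy0
  obtain ⟨ξ, w, b, hξ0, hXw, hb⟩ := hκ.exists_basis h hc
  have hw0 : w ≠ 0 := by
    have := b.ne_zero ⟨0, h.pos⟩
    rwa [hb] at this
  have hξx : ξ ^ N = x := by
    have h₂ := pow_apply_of_eigen hXw N
    rw [hp.1] at h₂
    exact (smul_left_injective ℂ hw0 h₂).symm
  -- the equivariant map given by an eigenvector
  have hext : ∀ u, τ (Weyl.X q) u = ξ • u → ∃ f : homSubmodule κ τ,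
      ∀ i : Fin N, f.1 (b i) = (τ (Weyl.Y q) ^ (i : ℕ)) u := by
    intro u hu
    let f : V →ₗ[ℂ] U := b.constr ℂ fun i : Fin N => (τ (Weyl.Y q) ^ (i : ℕ)) u
    have hf : ∀ i : Fin N, f (b i) = (τ (Weyl.Y q) ^ (i : ℕ)) u := fun i => b.constr_basis ℂ _ i
    refine ⟨⟨f, fun a v => ?_⟩, hf⟩
    refine (Weyl.intertwines_of_gen (f := f) ?_ ?_ a).apply v
    · refine b.ext fun i => ?_
      simp only [LinearMap.comp_apply]
      rw [hf, hb, X_apply_Y_pow κ hXw, X_apply_Y_pow τ hu, map_smul, ← hb, hf]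
    · refine b.ext fun i => ?_
      simp only [LinearMap.comp_apply]
      rw [hf, hb, ← Module.End.mul_apply, ← Module.End.mul_apply, ← pow_succ', ← pow_succ']
      -- At i = N - 1 both sides wrap around. They agree because Y^N is the same scalar `y` on `V`
      -- and on `U`.
      rcases Nat.lt_or_ge (i + 1) N with hi | hi
      · rw [← hf ⟨i + 1, hi⟩, hb]
      · have hi' : (i : ℕ) + 1 = N := le_antisymm i.2 hi
        have h₀ := hf ⟨0, h.pos⟩
        rw [hb] at h₀
        simp only [pow_zero, Module.End.one_apply] at h₀
        rw [hi', hp.2, hτ.2, LinearMap.smul_apply, LinearMap.smul_apply, map_smul]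
        simp [h₀]
  constructor
  · rw [injective_iff_map_eq_zero]
    intro t ht
    refine (TensorProduct.equivFinsuppOfBasisRight b).injective (Finsupp.ext fun i => ?_)
    -- With t = Σ g i ⊗ b i, the vectors g i (b i) = Y^i (g i w) lie in eigenspaces of X for
    -- distinct eigenvalues. Their sum vanishes, so each of them does. As Y is invertible, g i kills
    -- `w`, and hence the basis that `w` generates.
    set g := TensorProduct.equivFinsuppOfBasisRight (M := homSubmodule κ τ) b t with hg
    have ht' : t = ∑ i, g i ⊗ₜ b i := by
      rw [← (TensorProduct.equivFinsuppOfBasisRight b).symm_apply_apply t, ← hg,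
        TensorProduct.equivFinsuppOfBasisRight_symm_apply, Finsupp.sum_fintype _ _ (by simp)]
    rw [ht', map_sum] at ht
    simp only [TensorProduct.lift.tmul, Submodule.subtype_apply] at ht
    have hgi : ∀ i, (g i).1 (b i) = (τ (Weyl.Y q) ^ (i : ℕ)) ((g i).1 w) := by
      intro i
      have h₁ := (g i).2 (Weyl.Y q ^ (i : ℕ)) w
      rw [hb, ← map_pow, ← map_pow, h₁]
    have hgX : ∀ i, τ (Weyl.X q) ((g i).1 w) = ξ • (g i).1 w := by
      intro i
      have h₁ := (g i).2 (Weyl.X q) w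
      rw [hXw, map_smul] at h₁
      exact h₁.symm
    have hind := (Module.End.eigenspaces_iSupIndep (τ (Weyl.X q))).comp (h.pow_mul_injective hξ0)
    have hmem : ∀ i : Fin N, (g i).1 (b i) ∈
        (τ (Weyl.X q)).eigenspace ((q ^ 2) ^ (i : ℕ) * ξ) := fun i => by
      rw [hgi, Module.End.mem_eigenspace_iff]
      exact X_apply_Y_pow τ (hgX i) i
    have h₀ : (g i).1 (b i) = 0 := by
      refine Submodule.disjoint_def.mp (hind i) _ (hmem i) ?_
      rw [← Finset.add_sum_erase _ _ (Finset.mem_univ i), add_eq_zero_iff_eq_neg] at ht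
      rw [ht]
      refine Submodule.neg_mem _ (Submodule.sum_mem _ fun j hj => ?_)
      exact Submodule.mem_iSup_of_mem j
        (Submodule.mem_iSup_of_mem (Finset.ne_of_mem_erase hj) (hmem j))
    rw [hgi] at h₀
    have h₁ : (g i).1 w = 0 :=
      ((Module.End.isUnit_iff _).mp (hτc.isUnit_Y.pow i)).1 (h₀.trans (map_zero _).symm)
    rw [map_zero, Finsupp.zero_apply]
    refine Subtype.ext (b.ext fun j => ?_)
    have h₂ := (g i).2 (Weyl.Y q ^ (j : ℕ)) w
    rw [h₁, map_zero, map_pow, ← hb] at h₂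
    exact h₂
  -- X is diagonalizable on `U`, so it suffices to reach its eigenvectors.
  · rw [← LinearMap.range_eq_top, eq_top_iff, ← iSup_eigenspace_eq_top_of_pow h hx0 hτ.1]
    refine iSup_le fun c u hu => ?_
    rw [Module.End.mem_eigenspace_iff] at hu
    by_cases hu0 : u = 0
    · rw [hu0]; exact Submodule.zero_mem _
    have hcx : c ^ N = x := by
      have h₂ := pow_apply_of_eigen hu N
      rw [hτ.1] at h₂
      exact (smul_left_injective ℂ hu0 h₂).symm
    -- Both ξ and c are N-th roots of `x`, so ξ = q^(2j) c for some j < N, and Y^j u has the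
    -- eigenvalue ξ needed for an equivariant map out of `V`.
    have hroot : (ξ / c) ^ N = 1 := by
      rw [div_pow, hξx, hcx, div_self hx0]
    have hc0 := eigenvalue_ne_zero hτc.isUnit_X hu hu0
    have : NeZero N := ⟨h.pos.ne'⟩
    obtain ⟨j, hj, hjc⟩ := h.primitive.eq_pow_of_pow_eq_one hroot
    have hu' : τ (Weyl.X q) ((τ (Weyl.Y q) ^ j) u) = ξ • (τ (Weyl.Y q) ^ j) u := by
      rw [X_apply_Y_pow τ hu, hjc, div_mul_cancel₀ _ hc0]
    obtain ⟨f, hf⟩ := hext _ hu'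
    -- From Y^j u the vector u is recovered up to a scalar by N - j further applications of Y. The
    -- case j = 0 is separate because N is not an index of the basis.
    have key : ∃ i : Fin N, ∃ d : ℂ, d ≠ 0 ∧
        (τ (Weyl.Y q) ^ ((i : ℕ) + j)) = d • (1 : Module.End ℂ U) := by
      rcases Nat.eq_zero_or_pos j with rfl | hj0
      · exact ⟨⟨0, h.pos⟩, 1, one_ne_zero, by simp⟩
      · exact ⟨⟨N - j, by omega⟩, y, hy0, by rw [← hτ.2]; congr 1; simp; omega⟩
    obtain ⟨i, d, hd, hid⟩ := key
    refine ⟨(d⁻¹ • f) ⊗ₜ b i, ?_⟩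
    have h₁ := hf i
    rw [← Module.End.mul_apply, ← pow_add, hid] at h₁
    simp only [TensorProduct.lift.tmul, Submodule.subtype_apply, Submodule.coe_smul,
      LinearMap.smul_apply, h₁, Module.End.one_apply, smul_smul, inv_mul_cancel₀ hd, one_smul]

end Isotypic

/-! ### Canonical maps -/

section Canonical

variable {N : ℕ} {q : ℂ} {V V' Vμ Vν Vκ : Type*}
  [AddCommGroup V] [Module ℂ V] [AddCommGroup V'] [Module ℂ V']
  [AddCommGroup Vμ] [Module ℂ Vμ] [AddCommGroup Vν] [Module ℂ Vν] [AddCommGroup Vκ] [Module ℂ Vκ]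
  {μ : Weyl q →ₐ[ℂ] Module.End ℂ Vμ} {ν : Weyl q →ₐ[ℂ] Module.End ℂ Vν}
  {κ : Weyl q →ₐ[ℂ] Module.End ℂ Vκ}

/-- Irreducible cyclic representations with the same parameters are isomorphic. -/
theorem IsIrred.exists_isRepIso (h : IsQRoot N q) {κ : Weyl q →ₐ[ℂ] Module.End ℂ V}
    {κ' : Weyl q →ₐ[ℂ] Module.End ℂ V'} (hκ : IsIrred κ) (hκ' : IsIrred κ') (hc : IsCyclic κ)
    (hc' : IsCyclic κ') {x y : ℂ} (hp : HasParams N κ x y) (hp' : HasParams N κ' x y) :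
    ∃ e : V ≃ₗ[ℂ] V', IsRepIso κ κ' e := by
  have := hc'.finite
  have := hκ'.1
  have hb := (hκ.evaluation_bijective h hc hp hp').2
  obtain ⟨v, hv⟩ := exists_ne (0 : V')
  -- Evaluation is onto a nonzero space, so the equivariant maps are not all zero; a nonzero one is
  -- bijective by Schur's lemma.
  have : ∃ f : homSubmodule κ κ', f.1 ≠ 0 := by
    by_contra hcon
    push Not at hcon
    obtain ⟨t, rfl⟩ := hb v
    refine hv ?_
    induction t with
    | zero => exact map_zero _
    | tmul f u => simp [hcon f]
    | add a b ha hb =>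
      rw [map_add]
      by_cases h0 : TensorProduct.lift (homSubmodule κ κ').subtype a = 0
      · by_cases h1 : TensorProduct.lift (homSubmodule κ κ').subtype b = 0
        · rw [h0, h1, add_zero]
        · exact absurd (hb h1) h1
      · exact absurd (ha h0) h0
  obtain ⟨f, hf⟩ := this
  exact ⟨LinearEquiv.ofBijective f.1 (hκ.bijective_of_ne_zero hκ' f.2 hf), f.2⟩

theorem IsCyclic.of_isRepIso {κ : Weyl q →ₐ[ℂ] Module.End ℂ V} {κ' : Weyl q →ₐ[ℂ] Module.End ℂ V'}
    {e : V ≃ₗ[ℂ] V'} (he : IsRepIso κ κ' e) (hc : IsCyclic κ') : IsCyclic κ := by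
  have := hc.finite
  have : FiniteDimensional ℂ V := e.symm.finiteDimensional
  exact ⟨inferInstance, Weyl.isUnit_map_X κ,
    (he.intertwines (Weyl.Y q)).isUnit_left e.injective hc.isUnit_Y⟩

/-- The tensor product has the parameters of the product representation, so it is a multiple of it,
and the canonical map is the evaluation map of the isotypic decomposition. -/
theorem canonicalMap_bijective (h : IsQRoot N q) (hreg : IsRegularPair μ ν) (hμ : IsIrred μ)
    (hκ : IsProductRep N μ ν κ) : Function.Bijective (canonicalMap μ ν κ) := by
  have := hμ.1
  have := hreg.left.finite
  have := hreg.right.finite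
  obtain ⟨xμ, yμ, xν, yν, h₁, h₂, h₃⟩ := hκ.params
  obtain ⟨hx, hy⟩ := hreg.left.params_ne_zero h₁
  exact hκ.irred.evaluation_bijective h hκ.cyclic h₃ (h₁.tensorRep h h₂ hx hy)

theorem intertwines_canonicalMap (T : Module.End ℂ (Vμ ⊗[ℂ] Vν))
    (hT : ∀ w, Commute T (tensorRep μ ν w)) :
    Intertwines (canonicalMap μ ν κ) (TensorProduct.map (cgPost κ T hT) 1) T :=
  TensorProduct.ext' fun _ _ => rfl

theorem canonicalMap_Xinv (hreg : IsRegularPair μ ν) :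
    Intertwines (canonicalMap μ ν κ) (TensorProduct.map (cgRep κ hreg (Weyl.Xinv q)) 1)
      (cgOpX μ ν) := by
  rw [cgRep, Weyl.lift_Xinv]
  exact intertwines_canonicalMap _ _

theorem canonicalMap_Y (hreg : IsRegularPair μ ν) :
    Intertwines (canonicalMap μ ν κ) (TensorProduct.map (cgRep κ hreg (Weyl.Y q)) 1)
      (cgOpY μ ν) := by
  rw [cgRep, Weyl.lift_Y]
  exact intertwines_canonicalMap _ _

theorem canonicalMap_snd (w : Weyl q) :
    Intertwines (canonicalMap μ ν κ) (TensorProduct.map 1 (κ w)) (tensorRep μ ν w) :=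
  TensorProduct.ext' fun f v => f.2 w v

instance [FiniteDimensional ℂ Vμ] [FiniteDimensional ℂ Vν] [FiniteDimensional ℂ Vκ] :
    FiniteDimensional ℂ (cgSpace μ ν κ) :=
  inferInstanceAs (FiniteDimensional ℂ (cgSubmodule μ ν κ))

theorem isUnit_cgOpY (hq : q ≠ 0) (hμ : IsCyclic μ) (hν : IsCyclic ν) : IsUnit (cgOpY μ ν) := by
  have h₁ : IsUnit (ν (Weyl.Xinv q)) :=
    ⟨⟨_, _, rep_Xinv_X ν, rep_X_Xinv ν⟩, rfl⟩
  have h₂ : IsUnit (Ring.inverse (ν (Weyl.Y q))) := hν.isUnit_Y.ringInverse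
  exact (isUnit_map hμ.isUnit_Y (h₁.mul h₂)).smul (Units.mk0 _ (inv_ne_zero hq))

/-- Y acts by composition with an invertible operator, which is injective on the finite dimensional
space of Clebsch-Gordan operators. -/
theorem cgRep_isCyclic (hq : q ≠ 0) (hreg : IsRegularPair μ ν) (hκ : IsCyclic κ) :
    IsCyclic (cgRep κ hreg) := by
  have := hreg.left.finite
  have := hreg.right.finite
  have := hκ.finite
  refine ⟨inferInstance, Weyl.isUnit_map_X _, ?_⟩
  rw [LinearMap.isUnit_iff_ker_eq_bot, LinearMap.ker_eq_bot, cgRep, Weyl.lift_Y]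
  intro f g hfg
  refine Subtype.ext (LinearMap.ext fun v => ?_)
  have h₁ : cgOpY μ ν (f.1 v) = cgOpY μ ν (g.1 v) :=
    LinearMap.congr_fun (congrArg Subtype.val hfg) v
  exact ((Module.End.isUnit_iff _).mp (isUnit_cgOpY hq hreg.left hreg.right)).1 h₁

/-- By bijectivity of the canonical map the multiplicity space has dimension N · N / N = N, the
least possible for a nonzero cyclic representation. -/
theorem cgRep_isIrred (h : IsQRoot N q) (hreg : IsRegularPair μ ν) (hμ : IsIrred μ)
    (hν : IsIrred ν) (hκ : IsProductRep N μ ν κ) : IsIrred (cgRep κ hreg) := by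
  refine (cgRep_isCyclic h.ne_zero hreg hκ.cyclic).isIrred_of_finrank h ?_
  have h₁ := (LinearEquiv.ofBijective _ (canonicalMap_bijective h hreg hμ hκ)).finrank_eq
  rw [Module.finrank_tensorProduct, Module.finrank_tensorProduct, hμ.finrank_eq h hreg.left,
    hν.finrank_eq h hreg.right, hκ.irred.finrank_eq h hκ.cyclic] at h₁
  exact Nat.eq_of_mul_eq_mul_right h.pos h₁

end Canonical

/-! ### Flips -/

section Flip

variable {N : ℕ} {q : ℂ} {V₁ V₂ V₁' V₂' U₁ U₂ U₁' U₂' : Type*}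
  [AddCommGroup V₁] [Module ℂ V₁] [AddCommGroup V₂] [Module ℂ V₂]
  [AddCommGroup V₁'] [Module ℂ V₁'] [AddCommGroup V₂'] [Module ℂ V₂']
  [AddCommGroup U₁] [Module ℂ U₁] [AddCommGroup U₂] [Module ℂ U₂]
  [AddCommGroup U₁'] [Module ℂ U₁'] [AddCommGroup U₂'] [Module ℂ U₂']

/-- The common characterization of canonical maps, `6j`-symbols and intertwining operators: the
four actions are irreducible and cyclic, and `L` is an isomorphism that carries the operators of
`ρ₁`, `ρ₂` to those that occur in the definition of the canonical map. -/
structure IsFlip (ρ₁ : Weyl q →ₐ[ℂ] Module.End ℂ V₁) (ρ₂ : Weyl q →ₐ[ℂ] Module.End ℂ V₂)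
    (ρ₁' : Weyl q →ₐ[ℂ] Module.End ℂ V₁') (ρ₂' : Weyl q →ₐ[ℂ] Module.End ℂ V₂')
    (L : V₁ ⊗[ℂ] V₂ →ₗ[ℂ] V₁' ⊗[ℂ] V₂') : Prop where
  irred₁ : IsIrred ρ₁
  irred₂ : IsIrred ρ₂
  irred₁' : IsIrred ρ₁'
  irred₂' : IsIrred ρ₂'
  cyclic₁ : IsCyclic ρ₁
  cyclic₂ : IsCyclic ρ₂
  cyclic₁' : IsCyclic ρ₁'
  cyclic₂' : IsCyclic ρ₂'
  bijective : Function.Bijective L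
  fst_Xinv : Intertwines L (TensorProduct.map (ρ₁ (Weyl.Xinv q)) 1) (cgOpX ρ₁' ρ₂')
  fst_Y : Intertwines L (TensorProduct.map (ρ₁ (Weyl.Y q)) 1) (cgOpY ρ₁' ρ₂')
  snd : ∀ w, Intertwines L (TensorProduct.map 1 (ρ₂ w)) (tensorRep ρ₁' ρ₂' w)

theorem isFlip_canonicalMap (h : IsQRoot N q) {ρ₂ : Weyl q →ₐ[ℂ] Module.End ℂ V₂}
    {ρ₁' : Weyl q →ₐ[ℂ] Module.End ℂ V₁'} {ρ₂' : Weyl q →ₐ[ℂ] Module.End ℂ V₂'}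
    (hreg : IsRegularPair ρ₁' ρ₂') (h₁ : IsIrred ρ₁') (h₂ : IsIrred ρ₂')
    (hκ : IsProductRep N ρ₁' ρ₂' ρ₂) :
    IsFlip (cgRep ρ₂ hreg) ρ₂ ρ₁' ρ₂' (canonicalMap ρ₁' ρ₂' ρ₂) where
  irred₁ := cgRep_isIrred h hreg h₁ h₂ hκ
  irred₂ := hκ.irred
  irred₁' := h₁
  irred₂' := h₂
  cyclic₁ := cgRep_isCyclic h.ne_zero hreg hκ.cyclic
  cyclic₂ := hκ.cyclic
  cyclic₁' := hreg.left
  cyclic₂' := hreg.right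
  bijective := canonicalMap_bijective h hreg h₁ hκ
  fst_Xinv := canonicalMap_Xinv hreg
  fst_Y := canonicalMap_Y hreg
  snd := canonicalMap_snd

section Tensor

variable {ρ₁' : Weyl q →ₐ[ℂ] Module.End ℂ V₁'} {ρ₂' : Weyl q →ₐ[ℂ] Module.End ℂ V₂'}
  {τ₁' : Weyl q →ₐ[ℂ] Module.End ℂ U₁'} {τ₂' : Weyl q →ₐ[ℂ] Module.End ℂ U₂'}
  {f : V₁' →ₗ[ℂ] U₁'} {g : V₂' →ₗ[ℂ] U₂'}

theorem Intertwines.cgOpX (hf : ∀ w, Intertwines f (ρ₁' w) (τ₁' w))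
    (hg : ∀ w, Intertwines g (ρ₂' w) (τ₂' w)) (hρ : IsUnit (ρ₂' (Weyl.Y q)))
    (hτ : IsUnit (τ₂' (Weyl.Y q))) :
    Intertwines (TensorProduct.map f g) (cgOpX ρ₁' ρ₂') (cgOpX τ₁' τ₂') :=
  ((hf _).tensor Intertwines.one).add ((hf _).tensor ((hg _).inverse hρ hτ))

theorem Intertwines.cgOpY (hf : ∀ w, Intertwines f (ρ₁' w) (τ₁' w))
    (hg : ∀ w, Intertwines g (ρ₂' w) (τ₂' w)) (hρ : IsUnit (ρ₂' (Weyl.Y q)))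
    (hτ : IsUnit (τ₂' (Weyl.Y q))) :
    Intertwines (TensorProduct.map f g) (cgOpY ρ₁' ρ₂') (cgOpY τ₁' τ₂') :=
  ((hf _).tensor ((hg _).mul ((hg _).inverse hρ hτ))).smul _

theorem Intertwines.tensorRep (hf : ∀ w, Intertwines f (ρ₁' w) (τ₁' w))
    (hg : ∀ w, Intertwines g (ρ₂' w) (τ₂' w)) (w : Weyl q) :
    Intertwines (TensorProduct.map f g) (tensorRep ρ₁' ρ₂' w) (tensorRep τ₁' τ₂' w) := by
  refine Weyl.intertwines_of_gen ?_ ?_ w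
  · rw [tensorRep_X, tensorRep_X]
    exact (hf _).tensor (hg _)
  · rw [tensorRep_Y, tensorRep_Y]
    exact ((hf _).tensor (hg _)).add ((hf _).tensor Intertwines.one)

end Tensor

variable {ρ₁ : Weyl q →ₐ[ℂ] Module.End ℂ V₁} {ρ₂ : Weyl q →ₐ[ℂ] Module.End ℂ V₂}
  {ρ₁' : Weyl q →ₐ[ℂ] Module.End ℂ V₁'} {ρ₂' : Weyl q →ₐ[ℂ] Module.End ℂ V₂'}
  {L : V₁ ⊗[ℂ] V₂ →ₗ[ℂ] V₁' ⊗[ℂ] V₂'}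

/-- Every condition in `IsFlip` is invariant under isomorphisms of representations and nonzero
scalars. It therefore suffices to treat canonical maps and `6j`-symbols themselves, without the
isomorphisms in their descriptions. -/
theorem IsFlip.transport {τ₁ : Weyl q →ₐ[ℂ] Module.End ℂ U₁} {τ₂ : Weyl q →ₐ[ℂ] Module.End ℂ U₂}
    {τ₁' : Weyl q →ₐ[ℂ] Module.End ℂ U₁'} {τ₂' : Weyl q →ₐ[ℂ] Module.End ℂ U₂'}
    {M : U₁ ⊗[ℂ] U₂ →ₗ[ℂ] U₁' ⊗[ℂ] U₂'} (hM : IsFlip τ₁ τ₂ τ₁' τ₂' M)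
    {e₁ : V₁ ≃ₗ[ℂ] U₁} {e₂ : V₂ ≃ₗ[ℂ] U₂} {e₁' : V₁' ≃ₗ[ℂ] U₁'} {e₂' : V₂' ≃ₗ[ℂ] U₂'}
    (h₁ : IsRepIso ρ₁ τ₁ e₁) (h₂ : IsRepIso ρ₂ τ₂ e₂) (h₁' : IsRepIso ρ₁' τ₁' e₁')
    (h₂' : IsRepIso ρ₂' τ₂' e₂') {c : ℂ} (hc : c ≠ 0)
    (hL : (TensorProduct.congr e₁' e₂').toLinearMap ∘ₗ L =
      c • (M ∘ₗ (TensorProduct.congr e₁ e₂).toLinearMap)) : IsFlip ρ₁ ρ₂ ρ₁' ρ₂' L := by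
  have c₂' := hM.cyclic₂'.of_isRepIso h₂'
  have hL' : L = c • ((TensorProduct.congr e₁' e₂').symm.toLinearMap ∘ₗ M ∘ₗ
      (TensorProduct.congr e₁ e₂).toLinearMap) := by
    refine LinearMap.ext fun t => (TensorProduct.congr e₁' e₂').injective ?_
    have := LinearMap.congr_fun hL t
    simp only [LinearMap.comp_apply, LinearEquiv.coe_coe, LinearMap.smul_apply] at this ⊢
    rw [this, map_smul, LinearEquiv.apply_symm_apply]
  have key : ∀ {A A' B B'}, Intertwines (TensorProduct.congr e₁ e₂).toLinearMap A A' →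
      Intertwines M A' B' → Intertwines (TensorProduct.congr e₁' e₂').toLinearMap B B' →
      Intertwines L A B := by
    intro A A' B B' hA hAB hB
    rw [hL']
    exact (hB.symm.comp (hAB.comp hA)).smul_map c
  have i₁ := h₁.intertwines
  have i₂ := h₂.intertwines
  have i₁' := h₁'.intertwines
  have i₂' := h₂'.intertwines
  refine ⟨hM.irred₁.of_isRepIso h₁, hM.irred₂.of_isRepIso h₂, hM.irred₁'.of_isRepIso h₁',
    hM.irred₂'.of_isRepIso h₂', hM.cyclic₁.of_isRepIso h₁, hM.cyclic₂.of_isRepIso h₂,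
    hM.cyclic₁'.of_isRepIso h₁', c₂', ?_, ?_, ?_, ?_⟩
  · rw [hL']
    have h₃ : Function.Bijective ((TensorProduct.congr e₁' e₂').symm.toLinearMap ∘ₗ M ∘ₗ
      (TensorProduct.congr e₁ e₂).toLinearMap) :=
      (TensorProduct.congr e₁' e₂').symm.bijective.comp
        (hM.bijective.comp (TensorProduct.congr e₁ e₂).bijective)
    exact (MulAction.bijective₀ (α := V₁' ⊗[ℂ] V₂') hc).comp h₃
  · exact key ((i₁ _).tensor Intertwines.one) hM.fst_Xinv
      (Intertwines.cgOpX i₁' i₂' c₂'.isUnit_Y hM.cyclic₂'.isUnit_Y)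
  · exact key ((i₁ _).tensor Intertwines.one) hM.fst_Y
      (Intertwines.cgOpY i₁' i₂' c₂'.isUnit_Y hM.cyclic₂'.isUnit_Y)
  · exact fun w => key (Intertwines.one.tensor (i₂ w)) (hM.snd w)
      (Intertwines.tensorRep i₁' i₂' w)

theorem eq_smul_one_of_intertwines_left [Nontrivial V₂] (hL : Function.Injective L)
    {A : Module.End ℂ V₁} {c : ℂ}
    (h : Intertwines L (TensorProduct.map A 1) (c • 1)) : A = c • (1 : Module.End ℂ V₁) := by
  have h₁ := h.eq_left (Intertwines.one.smul c) hL
  refine eq_of_rTensor_eq (V := V₂) (TensorProduct.ext' fun u v => ?_)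
  simpa [TensorProduct.smul_tmul'] using LinearMap.congr_fun h₁ (u ⊗ₜ v)

theorem eq_smul_one_of_intertwines_right [Nontrivial V₁] (hL : Function.Injective L)
    {A : Module.End ℂ V₂} {c : ℂ}
    (h : Intertwines L (TensorProduct.map 1 A) (c • 1)) : A = c • (1 : Module.End ℂ V₂) := by
  have h₁ := h.eq_left (Intertwines.one.smul c) hL
  refine eq_of_rTensor_eq (V := V₁) (TensorProduct.ext' fun u v => ?_)
  refine (TensorProduct.comm ℂ V₂ V₁).injective ?_
  simpa [TensorProduct.smul_tmul'] using LinearMap.congr_fun h₁ (v ⊗ₜ u)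

/-- The summands Y ⊗ Y⁻¹ and X⁻¹ ⊗ 1 commute up to q², so `IsQRoot.add_pow` applies. -/
theorem cgOpX_pow (h : IsQRoot N q) (hc₁ : IsCyclic ρ₁') (hc₂ : IsCyclic ρ₂') {x₁ y₁ x₂ y₂ : ℂ}
    (h₁ : HasParams N ρ₁' x₁ y₁) (h₂ : HasParams N ρ₂' x₂ y₂) (hx₁ : x₁ ≠ 0) (hy₂ : y₂ ≠ 0) :
    cgOpX ρ₁' ρ₂' ^ N = (x₁⁻¹ + y₁ * y₂⁻¹) • (1 : Module.End ℂ (V₁' ⊗[ℂ] V₂')) := by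
  rw [cgOpX, add_comm, h.add_pow (isUnit_map hc₁.isUnit_Y hc₂.isUnit_Y.ringInverse),
    TensorProduct.map_pow, TensorProduct.map_pow, h₁.2, h₁.Xinv_pow hx₁,
    h₂.Yinv_pow hc₂.isUnit_Y hy₂, one_pow]
  · simp only [TensorProduct.map_smul_left, TensorProduct.map_smul_right, TensorProduct.map_one,
      smul_smul, ← add_smul]
    rw [add_comm, mul_comm y₁]
  · rw [← TensorProduct.map_mul, ← TensorProduct.map_mul, rep_Y_Xinv, one_mul, mul_one,
      TensorProduct.map_smul_left]

theorem cgOpY_pow (h : IsQRoot N q) (hc₂ : IsCyclic ρ₂') {x₁ y₁ x₂ y₂ : ℂ}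
    (h₁ : HasParams N ρ₁' x₁ y₁) (h₂ : HasParams N ρ₂' x₂ y₂) (hx₂ : x₂ ≠ 0) (hy₂ : y₂ ≠ 0) :
    cgOpY ρ₁' ρ₂' ^ N = (y₁ * x₂⁻¹ * y₂⁻¹) • (1 : Module.End ℂ (V₁' ⊗[ℂ] V₂')) := by
  have hq := swap_rel (pow_ne_zero 2 h.ne_zero) (rep_Xinv_Yinv ρ₂' hc₂.isUnit_Y)
  -- The factor q⁻¹ in the action of Y compensates the sign that arises from separating X⁻¹ and Y⁻¹
  -- in (X⁻¹Y⁻¹)^N.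
  have hsign : (q⁻¹) ^ N * ((q ^ 2)⁻¹) ^ N.choose 2 = 1 := by
    rw [inv_pow, inv_pow, h.pow_choose_two, h.pow_eq, ← mul_inv, ← mul_pow]
    norm_num
  rw [cgOpY, smul_pow, TensorProduct.map_pow, mul_pow_of_mul_eq_smul hq, h₁.2, h₂.Xinv_pow hx₂,
    h₂.Yinv_pow hc₂.isUnit_Y hy₂]
  simp only [TensorProduct.map_smul_left, TensorProduct.map_smul_right, TensorProduct.map_one,
    smul_smul, mul_smul_comm, mul_one]
  congr 1
  linear_combination (y₁ * x₂⁻¹ * y₂⁻¹) * hsign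

/-- The parameters of the actions on the source of a flip. -/
theorem IsFlip.params (h : IsQRoot N q) (hL : IsFlip ρ₁ ρ₂ ρ₁' ρ₂' L) {x₁ y₁ x₂ y₂ : ℂ}
    (h₁ : HasParams N ρ₁' x₁ y₁) (h₂ : HasParams N ρ₂' x₂ y₂) :
    HasParams N ρ₁ (x₁⁻¹ + y₁ * y₂⁻¹)⁻¹ (y₁ * x₂⁻¹ * y₂⁻¹) ∧
      HasParams N ρ₂ (x₁ * x₂) (x₁⁻¹ * y₂ + y₁) ∧ x₁⁻¹ + y₁ * y₂⁻¹ ≠ 0 := by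
  have := hL.irred₁.1
  have := hL.irred₂.1
  have := hL.irred₁'.1
  have := hL.irred₂'.1
  obtain ⟨hx₁, hy₁⟩ := hL.cyclic₁'.params_ne_zero h₁
  obtain ⟨hx₂, hy₂⟩ := hL.cyclic₂'.params_ne_zero h₂
  have hX := hL.fst_Xinv.pow N
  rw [cgOpX_pow h hL.cyclic₁' hL.cyclic₂' h₁ h₂ hx₁ hy₂, TensorProduct.map_pow, one_pow] at hX
  have hX' := eq_smul_one_of_intertwines_left hL.bijective.1 hX
  -- This is the scalar by which the invertible operator ρ₁(X⁻¹)^N acts.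
  have hne : x₁⁻¹ + y₁ * y₂⁻¹ ≠ 0 := by
    refine ne_zero_of_isUnit_smul_one (V := V₁) ?_
    rw [← hX']
    exact IsUnit.pow N ⟨⟨_, _, rep_Xinv_X ρ₁, rep_X_Xinv ρ₁⟩, rfl⟩
  have hY := hL.fst_Y.pow N
  rw [cgOpY_pow h hL.cyclic₂' h₁ h₂ hx₂ hy₂, TensorProduct.map_pow, one_pow] at hY
  have ht := h₁.tensorRep h h₂ hx₁ hy₁
  have hX₂ := (hL.snd (Weyl.X q)).pow N
  rw [ht.1, TensorProduct.map_pow, one_pow] at hX₂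
  have hY₂ := (hL.snd (Weyl.Y q)).pow N
  rw [ht.2, TensorProduct.map_pow, one_pow] at hY₂
  refine ⟨⟨?_, eq_smul_one_of_intertwines_left hL.bijective.1 hY⟩,
    ⟨eq_smul_one_of_intertwines_right hL.bijective.1 hX₂,
      eq_smul_one_of_intertwines_right hL.bijective.1 hY₂⟩, hne⟩
  have hc : Commute (ρ₁ (Weyl.X q)) (ρ₁ (Weyl.Xinv q)) :=
    (rep_X_Xinv ρ₁).trans (rep_Xinv_X ρ₁).symm
  have h₃ := hc.mul_pow N
  rw [rep_X_Xinv, one_pow, hX', mul_smul_comm, mul_one] at h₃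
  rw [h₃, smul_smul, inv_mul_cancel₀ hne, one_smul]

/-- Through `L`, the operator Δ(Y) on the target corresponds to 1 ⊗ ρ₂(Y), which is invertible. -/
theorem IsFlip.isRegularPair (hL : IsFlip ρ₁ ρ₂ ρ₁' ρ₂' L) : IsRegularPair ρ₁' ρ₂' := by
  have := hL.cyclic₁'.finite
  have := hL.cyclic₂'.finite
  refine ⟨hL.cyclic₁', hL.cyclic₂', inferInstance, Weyl.isUnit_map_X _, ?_⟩
  exact (hL.snd (Weyl.Y q)).isUnit_right hL.bijective.2 (isUnit_map isUnit_one hL.cyclic₂.isUnit_Y)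

theorem IsFlip.isProductRep (h : IsQRoot N q) (hL : IsFlip ρ₁ ρ₂ ρ₁' ρ₂' L) :
    IsProductRep N ρ₁' ρ₂' ρ₂ := by
  have := hL.cyclic₁'.finite
  have := hL.cyclic₂'.finite
  obtain ⟨x₁, y₁, h₁⟩ := hL.irred₁'.exists_hasParams h
  obtain ⟨x₂, y₂, h₂⟩ := hL.irred₂'.exists_hasParams h
  exact ⟨hL.irred₂, hL.cyclic₂, x₁, y₁, x₂, y₂, h₁, h₂, (hL.params h h₁ h₂).2.1⟩

/-- The Clebsch-Gordan operators given by the vectors of the first space of a flip. -/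
def IsFlip.toCG (hL : IsFlip ρ₁ ρ₂ ρ₁' ρ₂' L) : V₁ →ₗ[ℂ] cgSpace ρ₁' ρ₂' ρ₂ :=
  LinearMap.codRestrict (cgSubmodule ρ₁' ρ₂' ρ₂) ((TensorProduct.mk ℂ V₁ V₂).compr₂ L)
    fun v₁ w v₂ => (hL.snd w).apply (v₁ ⊗ₜ v₂)

/-- If v and v₂ are nonzero then so is v ⊗ v₂, which gives injectivity since `L` is injective. For
an equivariant f the map L⁻¹ ∘ f : V₂ → V₁ ⊗ V₂ commutes with ρ₂, so by Schur, with ℂ as the first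
factor of the source, it is v₂ ↦ r ⊗ v₂ for some r, and f comes from r. -/
theorem IsFlip.toCG_bijective (hL : IsFlip ρ₁ ρ₂ ρ₁' ρ₂' L) : Function.Bijective hL.toCG := by
  have := hL.cyclic₁.finite
  have := hL.cyclic₂.finite
  have := hL.irred₂.1
  constructor
  · rw [injective_iff_map_eq_zero]
    intro v hv
    by_contra hv0
    obtain ⟨v₂, hv₂⟩ := exists_ne (0 : V₂)
    obtain ⟨φ, hφ⟩ := exists_dual_apply_ne_zero hv0
    have h₁ : L (v ⊗ₜ v₂) = 0 := LinearMap.congr_fun (congrArg Subtype.val hv) v₂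
    have h₂ := hL.bijective.1 (h₁.trans (map_zero L).symm)
    have h₃ := congrArg (fun t => TensorProduct.lid ℂ V₂ (φ.rTensor V₂ t)) h₂
    simp [hφ, hv₂] at h₃
  · intro f
    let e := LinearEquiv.ofBijective L hL.bijective
    obtain ⟨R, hR⟩ := hL.irred₂.exists_eq_rTensor (U := ℂ)
      (T := e.symm.toLinearMap ∘ₗ f.1 ∘ₗ (TensorProduct.lid ℂ V₂).toLinearMap) fun w => by
        refine TensorProduct.ext' fun c v => ?_
        have h₁ : Intertwines e.toLinearMap (TensorProduct.map 1 (ρ₂ w)) (tensorRep ρ₁' ρ₂' w) :=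
          hL.snd w
        have h₂ := f.2 w v
        have h₃ := h₁.symm.apply (f.1 v)
        simp only [LinearEquiv.coe_coe] at h₃
        simp [h₂, h₃]
    refine ⟨R 1, Subtype.ext (LinearMap.ext fun v => ?_)⟩
    have h₄ := congrArg e (LinearMap.congr_fun hR (1 ⊗ₜ v))
    simp only [LinearMap.comp_apply, LinearEquiv.coe_coe, TensorProduct.lid_tmul, one_smul,
      LinearEquiv.apply_symm_apply, LinearMap.rTensor_tmul] at h₄
    exact h₄.symm

end Flip

/-! ### Flips are canonical maps -/

section CanonicalIff

variable {N : ℕ} {q : ℂ} {V₁ V₂ V₁' V₂' : Type u}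
  [AddCommGroup V₁] [Module ℂ V₁] [AddCommGroup V₂] [Module ℂ V₂]
  [AddCommGroup V₁'] [Module ℂ V₁'] [AddCommGroup V₂'] [Module ℂ V₂']
  {ρ₁ : Weyl q →ₐ[ℂ] Module.End ℂ V₁} {ρ₂ : Weyl q →ₐ[ℂ] Module.End ℂ V₂}
  {ρ₁' : Weyl q →ₐ[ℂ] Module.End ℂ V₁'} {ρ₂' : Weyl q →ₐ[ℂ] Module.End ℂ V₂'}
  {L : V₁ ⊗[ℂ] V₂ →ₗ[ℂ] V₁' ⊗[ℂ] V₂'}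

/-- A flip is realized with μ = ρ₁', ν = ρ₂' and μν = ρ₂ on the given spaces. Only V₁ has to be
replaced, by the Clebsch-Gordan operators that its vectors define. -/
theorem isCanonicalMap_iff_isFlip (h : IsQRoot N q) :
    IsCanonicalMap N ρ₁ ρ₂ ρ₁' ρ₂' L ↔ IsFlip ρ₁ ρ₂ ρ₁' ρ₂' L := by
  constructor
  · rintro ⟨Vμ, Vν, Vκ, _, _, _, _, _, _, μ, ν, κ, hreg, e₁, e₂, e₁', e₂', c, hμ, hν, hκ, h₁, h₂,
      h₁', h₂', hc, hL⟩
    exact (isFlip_canonicalMap h hreg hμ hν hκ).transport h₁ h₂ h₁' h₂' hc hL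
  · intro hL
    have hreg := hL.isRegularPair
    refine ⟨V₁', V₂', V₂, _, _, _, _, _, _, ρ₁', ρ₂', ρ₂, hreg,
      LinearEquiv.ofBijective _ hL.toCG_bijective, LinearEquiv.refl ℂ _, LinearEquiv.refl ℂ _,
      LinearEquiv.refl ℂ _, 1, hL.irred₁', hL.irred₂', hL.isProductRep h, ?_, fun _ _ => rfl,
      fun _ _ => rfl, fun _ _ => rfl, one_ne_zero, ?_⟩
    -- X⁻¹ is the generator whose action on Clebsch-Gordan operators needs no inverse; X follows by
    -- inversion.
    · have hX : Intertwines hL.toCG (ρ₁ (Weyl.Xinv q)) (cgRep ρ₂ hreg (Weyl.Xinv q)) := by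
        rw [cgRep, Weyl.lift_Xinv]
        refine Intertwines.of_apply fun v => Subtype.ext (LinearMap.ext fun v₂ => ?_)
        exact hL.fst_Xinv.apply (v ⊗ₜ v₂)
      have hY : Intertwines hL.toCG (ρ₁ (Weyl.Y q)) (cgRep ρ₂ hreg (Weyl.Y q)) := by
        rw [cgRep, Weyl.lift_Y]
        refine Intertwines.of_apply fun v => Subtype.ext (LinearMap.ext fun v₂ => ?_)
        exact hL.fst_Y.apply (v ⊗ₜ v₂)
      intro w v
      exact (Weyl.intertwines_of_gen
        (hX.of_mul_eq_one (rep_Xinv_X _) (rep_X_Xinv _)) hY w).apply v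
    · refine TensorProduct.ext' fun v₁ v₂ => ?_
      simp only [one_smul, LinearMap.comp_apply, LinearEquiv.coe_coe, TensorProduct.congr_tmul,
        LinearEquiv.refl_apply, LinearEquiv.ofBijective_apply]
      have h₁ : TensorProduct.congr (LinearEquiv.refl ℂ V₁') (LinearEquiv.refl ℂ V₂') =
        LinearEquiv.refl ℂ (V₁' ⊗[ℂ] V₂') := by ext; simp
      rw [h₁]
      rfl

end CanonicalIff

/-! ### The two systems of relations -/

section Relations

variable {q : ℂ} {E : Type*} [Ring E] [Algebra ℂ E]

theorem units_inv_eq_of_smul {a b : Eˣ} {s : ℂ} (h : a.1 = s • b.1) (hs : s ≠ 0) :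
    a⁻¹.1 = s⁻¹ • b⁻¹.1 := by
  refine Units.inv_eq_of_mul_eq_one_right ?_
  rw [h, smul_mul_assoc, mul_smul_comm, smul_smul, mul_inv_cancel₀ hs, one_smul, Units.mul_inv]

theorem inv_mul_inv_of_mul {a b : Eˣ} {s : ℂ} (hs : s ≠ 0) (h : a.1 * b.1 = s • (b.1 * a.1)) :
    a⁻¹.1 * b⁻¹.1 = s • (b⁻¹.1 * a⁻¹.1) := by
  have h₁ := units_inv_eq_of_smul (a := a * b) (b := b * a) h hs
  simp only [mul_inv_rev, Units.val_mul] at h₁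
  rw [h₁, smul_smul, mul_inv_cancel₀ hs, one_smul]

variable {x₁ y₁ x₂ y₂ a b c d : Eˣ}

/-- In the relations below, x₁, y₁ and x₂, y₂ stand for X, Y of ρ₁ and ρ₂ on the source, and a, b
and c, d for X, Y of ρ₁' and ρ₂' pulled back along L. Then y₁x₂ is the diagonal coordinate X₅.
Inverting qX₅ = abd⁻¹ and reordering a⁻¹b⁻¹ turns the q into the one needed for qX₅⁻¹. -/
theorem smul_inv_of_smul (hq : q ≠ 0) (hab : a.1 * b.1 = q ^ 2 • (b.1 * a.1))
    (hxy : q • (y₁.1 * x₂.1) = a.1 * b.1 * d⁻¹.1) (hc : Commute y₁ x₂) :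
    q • (y₁⁻¹.1 * x₂⁻¹.1) = d.1 * (a⁻¹.1 * b⁻¹.1) := by
  have h₁ : (y₁ * x₂).1 = q⁻¹ • (a * b * d⁻¹).1 := by
    rw [Units.val_mul, Units.val_mul, Units.val_mul, ← hxy, smul_smul, inv_mul_cancel₀ hq, one_smul]
  have h₂ := units_inv_eq_of_smul h₁ (inv_ne_zero hq)
  rw [hc.eq] at h₂
  simp only [mul_inv_rev, Units.val_mul, inv_inv] at h₂
  rw [h₂, smul_smul, inv_mul_inv_of_mul (pow_ne_zero 2 hq) hab, mul_smul_comm, ← sq]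

/-- The relations satisfied by a flip imply those of an intertwining operator. -/
theorem coord_of_flip (hq : q ≠ 0) (hab : a.1 * b.1 = q ^ 2 • (b.1 * a.1))
    (hcd : c.1 * d.1 = q ^ 2 • (d.1 * c.1)) (hac : Commute a c) (had : Commute a d)
    (hbc : Commute b c) (hbd : Commute b d) (hyx : Commute y₁ x₂)
    (hx₂ : x₂.1 = a.1 * c.1) (hy₂ : y₂.1 = a⁻¹.1 * d.1 + b.1)
    (hx₁ : x₁⁻¹.1 = a⁻¹.1 + b.1 * d⁻¹.1) (hy₁ : y₁.1 = q⁻¹ • (b.1 * (c⁻¹.1 * d⁻¹.1))) :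
    (1 + q • (y₁.1 * x₂.1)) * x₁.1 = a.1 ∧
    y₂.1 = (1 + q • (y₁⁻¹.1 * x₂⁻¹.1)) * b.1 ∧
    (1 + q • (y₁.1 * x₂.1)) * (q • (y₂⁻¹.1 * x₂⁻¹.1)) = q • (d⁻¹.1 * c⁻¹.1) ∧
    q • (y₁⁻¹.1 * x₁⁻¹.1) = (1 + q • (y₁⁻¹.1 * x₂⁻¹.1)) * c.1 ∧
    (y₁.1 * x₂.1) * (q • (b⁻¹.1 * a⁻¹.1) * d.1) = 1 := by
  have hq2 : q ^ 2 ≠ 0 := pow_ne_zero 2 hq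
  -- The two reorderings, of c⁻¹d⁻¹ and of ba, use up the factor q²; c cancels because it commutes
  -- with a.
  have hxy : q • (y₁.1 * x₂.1) = a.1 * b.1 * d⁻¹.1 := by
    rw [hy₁, hx₂, smul_mul_assoc, smul_smul, mul_inv_cancel₀ hq, one_smul,
      inv_mul_inv_of_mul hq2 hcd, mul_smul_comm, smul_mul_assoc, hab, smul_mul_assoc]
    have : b.1 * (d⁻¹.1 * c⁻¹.1) * (a.1 * c.1) = b.1 * a.1 * d⁻¹.1 := by
      have h : b * (d⁻¹ * c⁻¹) * (a * c) = b * a * d⁻¹ := by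
        rw [hac.eq, mul_assoc, mul_assoc d⁻¹, ← mul_assoc c⁻¹, inv_mul_cancel, one_mul,
          ← had.inv_right.eq, mul_assoc]
      exact congrArg Units.val h
    rw [this]
  have hv := smul_inv_of_smul hq hab hxy hyx
  -- The two factorizations of 1 + qX₅, as a x₁⁻¹ and as (cd)⁻¹ x₂y₂, make the relations of the
  -- edges 01 and 23 immediate.
  have hA : 1 + a.1 * b.1 * d⁻¹.1 = a.1 * x₁⁻¹.1 := by
    rw [hx₁, mul_add, Units.mul_inv, mul_assoc]
  have hu : 1 + a.1 * b.1 * d⁻¹.1 = d⁻¹.1 * c⁻¹.1 * (x₂.1 * y₂.1) := by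
    have h₁ : d⁻¹ * c⁻¹ * (a * c * (a⁻¹ * d)) = 1 := by
      rw [hac.eq, mul_assoc d⁻¹, mul_assoc c, inv_mul_cancel_left, mul_inv_cancel_left,
        inv_mul_cancel]
    have h₂ : d⁻¹ * c⁻¹ * (a * c * b) = a * b * d⁻¹ := by
      rw [hac.eq, mul_assoc d⁻¹, mul_assoc c, inv_mul_cancel_left,
        (had.mul_left hbd).inv_right.eq]
    have h₁' := congrArg Units.val h₁
    have h₂' := congrArg Units.val h₂
    simp only [Units.val_mul, Units.val_one] at h₁' h₂'
    rw [hx₂, hy₂, mul_add, mul_add, h₁', h₂']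
  refine ⟨?_, ?_, ?_, ?_, ?_⟩
  · rw [hxy, hA, mul_assoc, Units.inv_mul, mul_one]
  · rw [hv, hy₂, add_mul, one_mul, mul_assoc, mul_assoc, Units.inv_mul, mul_one, add_comm]
    congr 1
    exact congrArg Units.val had.inv_left.eq
  · rw [hxy, hu, mul_smul_comm]
    congr 1
    rw [mul_assoc, mul_assoc, mul_assoc, ← mul_assoc y₂.1, Units.mul_inv, one_mul, Units.mul_inv,
      mul_one]
  · have h₁ := units_inv_eq_of_smul (b := b * (c⁻¹ * d⁻¹)) hy₁ (inv_ne_zero hq)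
    simp only [mul_inv_rev, Units.val_mul, inv_inv] at h₁
    have h₂ : c.1 = q ^ 2 • (d.1 * c.1 * d⁻¹.1) := by
      rw [← smul_mul_assoc, ← hcd, mul_assoc, Units.mul_inv, mul_one]
    have h₃ : d.1 * c.1 * b⁻¹.1 * (b.1 * d⁻¹.1) = d.1 * c.1 * d⁻¹.1 := by
      rw [mul_assoc, ← mul_assoc b⁻¹.1, Units.inv_mul, one_mul]
    have h₄ : d.1 * c.1 * b⁻¹.1 * a⁻¹.1 = d.1 * (b⁻¹.1 * a⁻¹.1) * c.1 := by
      have : d * c * b⁻¹ * a⁻¹ = d * (b⁻¹ * a⁻¹) * c := by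
        rw [mul_assoc, mul_assoc, mul_assoc, ← (hbc.inv_left.mul_left hac.inv_left).eq]
      exact congrArg Units.val this
    rw [hv, h₁, hx₁, smul_mul_assoc, smul_smul, ← sq, mul_add, h₃, h₄, smul_add, ← h₂, add_mul,
      one_mul, inv_mul_inv_of_mul hq2 hab, mul_smul_comm, smul_mul_assoc, add_comm]
  · rw [smul_mul_assoc, mul_smul_comm, ← smul_mul_assoc, hxy]
    have : a * b * d⁻¹ * (b⁻¹ * a⁻¹ * d) = 1 := by
      rw [(hbd.inv_left.mul_left had.inv_left).eq]
      group
    exact congrArg Units.val this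

/-- The relations satisfied by an intertwining operator imply those of a flip. -/
theorem flip_of_coord (hq : q ≠ 0) (hab : a.1 * b.1 = q ^ 2 • (b.1 * a.1))
    (hcd : c.1 * d.1 = q ^ 2 • (d.1 * c.1)) (hac : Commute a c) (had : Commute a d)
    (hbd : Commute b d) (hyx : Commute y₁ x₂)
    (r₁ : (1 + q • (y₁.1 * x₂.1)) * x₁.1 = a.1)
    (r₂ : y₂.1 = (1 + q • (y₁⁻¹.1 * x₂⁻¹.1)) * b.1)
    (r₄ : q • (y₁⁻¹.1 * x₁⁻¹.1) = (1 + q • (y₁⁻¹.1 * x₂⁻¹.1)) * c.1)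
    (r₅ : (y₁.1 * x₂.1) * (q • (b⁻¹.1 * a⁻¹.1) * d.1) = 1) :
    x₂.1 = a.1 * c.1 ∧ y₂.1 = a⁻¹.1 * d.1 + b.1 ∧ x₁⁻¹.1 = a⁻¹.1 + b.1 * d⁻¹.1 ∧
      y₁.1 = q⁻¹ • (b.1 * (c⁻¹.1 * d⁻¹.1)) := by
  have hq2 : q ^ 2 ≠ 0 := pow_ne_zero 2 hq
  -- The relation of the diagonal alone gives qX₅. Those of the edges 01 and 03 then give x₁⁻¹ and
  -- y₂.
  have hxy : q • (y₁.1 * x₂.1) = a.1 * b.1 * d⁻¹.1 := by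
    have h₁ : (q • (y₁.1 * x₂.1)) * (b⁻¹ * a⁻¹ * d).1 = 1 := by
      rw [smul_mul_assoc, mul_smul_comm] at r₅
      simpa [mul_assoc] using r₅
    rw [Units.eq_inv_of_mul_eq_one_right h₁]
    have : (b⁻¹ * a⁻¹ * d)⁻¹ = a * b * d⁻¹ := by
      rw [mul_inv_rev, mul_inv_rev, inv_inv, inv_inv, (had.mul_left hbd).inv_right.eq]
    rw [this, Units.val_mul, Units.val_mul]
  have hv := smul_inv_of_smul hq hab hxy hyx
  have hx₁ : x₁⁻¹.1 = a⁻¹.1 + b.1 * d⁻¹.1 := by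
    refine (Units.eq_inv_of_mul_eq_one_right ?_).symm
    have : a⁻¹.1 + b.1 * d⁻¹.1 = a⁻¹.1 * (1 + a.1 * b.1 * d⁻¹.1) := by
      rw [mul_add, mul_one, ← mul_assoc, ← mul_assoc, Units.inv_mul, one_mul]
    rw [this, ← hxy, mul_assoc, r₁, Units.inv_mul]
  have hy₂ : y₂.1 = a⁻¹.1 * d.1 + b.1 := by
    rw [r₂, hv, add_mul, one_mul, mul_assoc, mul_assoc, Units.inv_mul, mul_one, add_comm]
    congr 1
    exact congrArg Units.val had.inv_left.eq.symm
  -- the common factor of both sides of `r₄`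
  have hunit : 1 + q • (y₁⁻¹.1 * x₂⁻¹.1) = (y₂ * b⁻¹).1 := by
    rw [Units.val_mul, r₂, mul_assoc, Units.mul_inv, mul_one]
  have hfac : x₁⁻¹.1 = (y₂ * b⁻¹).1 * (b.1 * d⁻¹.1) := by
    rw [← hunit, hv, hx₁, add_mul, one_mul, add_comm]
    congr 1
    have : a⁻¹ = d * (a⁻¹ * b⁻¹) * (b * d⁻¹) := by
      rw [mul_assoc, mul_assoc, inv_mul_cancel_left, had.inv_left.inv_right.eq, mul_inv_cancel_left]
    exact congrArg Units.val this
  -- The unit y₂b⁻¹ equals 1 + q y₁⁻¹x₂⁻¹ and so commutes with y₁⁻¹. It can be cancelled on the left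
  -- of `r₄`, leaving q y₁⁻¹bd⁻¹ = c, which determines y₁; then X₅ = y₁x₂ determines x₂.
  have hcomm : y₁⁻¹.1 * (y₂ * b⁻¹).1 = (y₂ * b⁻¹).1 * y₁⁻¹.1 := by
    rw [← hunit, mul_add, add_mul, mul_one, one_mul, mul_smul_comm, smul_mul_assoc, mul_assoc]
    congr 3
    exact congrArg Units.val hyx.inv_inv.eq
  have hc : q • (y₁⁻¹.1 * (b.1 * d⁻¹.1)) = c.1 := by
    rw [hunit, hfac, ← mul_assoc, hcomm, mul_assoc, ← mul_smul_comm] at r₄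
    exact (Units.mul_right_inj _).mp r₄
  have hy₁ : y₁.1 = q • (b.1 * (d⁻¹.1 * c⁻¹.1)) := by
    rw [← mul_assoc, ← smul_mul_assoc]
    refine (Units.eq_mul_inv_iff_mul_eq c).mpr ?_
    rw [← hc, mul_smul_comm, ← mul_assoc, Units.mul_inv, one_mul]
  refine ⟨?_, hy₂, hx₁, ?_⟩
  · have h₁ : x₂.1 = y₁⁻¹.1 * (q⁻¹ • (a.1 * b.1 * d⁻¹.1)) := by
      rw [← hxy, smul_smul, inv_mul_cancel₀ hq, one_smul, ← mul_assoc, Units.inv_mul, one_mul]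
    have h₂ := units_inv_eq_of_smul (b := b * (d⁻¹ * c⁻¹)) hy₁ hq
    simp only [mul_inv_rev, Units.val_mul, inv_inv] at h₂
    rw [h₁, h₂, hab]
    simp only [smul_mul_assoc, mul_smul_comm, smul_smul]
    have h₃ : c * d * b⁻¹ * (b * a * d⁻¹) = a * c := by
      rw [mul_assoc, mul_assoc b, inv_mul_cancel_left, mul_assoc, had.inv_right.eq,
        mul_inv_cancel_left, hac.eq]
    have h₃' := congrArg Units.val h₃
    simp only [Units.val_mul] at h₃'
    rw [h₃']
    convert one_smul ℂ (a.1 * c.1) using 2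
    field_simp
  · rw [hy₁, inv_mul_inv_of_mul hq2 hcd, mul_smul_comm, smul_smul]
    congr 1
    field_simp

end Relations

/-! ### Values of a representation at fractions -/

section Fractions

variable {N : ℕ} {q : ℂ} {ι : Type} {σ : ι → ι → ℤ} {V : Type*} [AddCommGroup V] [Module ℂ V]

theorem Torus.toFrac_injective : Function.Injective (Torus.toFrac q σ) :=
  OreLocalization.numeratorHom_inj fun _ ha => ha.2.1

/-- If aQ = P, then bP = cQ already in the algebra, and ρ(Q) can be cancelled. This extracts
relations between operators from an intertwiner without any assumption on ρ(b). -/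
theorem IsValueAt.mul_eq {ρ : Torus q σ →ₐ[ℂ] Module.End ℂ V} {a : Torus.Frac q σ}
    {A : Module.End ℂ V} (h : IsValueAt ρ a A) {b c : Torus q σ}
    (hbc : Torus.toFrac q σ b * a = Torus.toFrac q σ c) : ρ b * A = ρ c := by
  obtain ⟨P, Q, -, hQ, h₁, h₂⟩ := h.1
  have h₃ : b * P = c * Q := by
    refine Torus.toFrac_injective ?_
    rw [map_mul, map_mul, ← h₁, ← mul_assoc, hbc]
  refine hQ.mul_right_cancel ?_
  rw [mul_assoc, h₂, ← map_mul, h₃, map_mul]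

variable {B : Type*} [Ring B] [Algebra ℂ B]

/-- The elements `b` whose image `Φ b` has a power of `D` as a denominator, with value `ψ b` under
the representation `ρ`, for which `D` acts by the scalar `d`. -/
def HasValueWith (ρ : Torus q σ →ₐ[ℂ] Module.End ℂ V) (Φ : B →ₐ[ℂ] Torus.Frac q σ)
    (ψ : B →ₐ[ℂ] Module.End ℂ V) (D : Torus q σ) (d : ℂ) (b : B) : Prop :=
  ∃ (k : ℕ) (P : Torus q σ), Torus.toFrac q σ (D ^ k) * Φ b = Torus.toFrac q σ P ∧
    ρ P = d ^ k • ψ b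

namespace HasValueWith

variable {ρ : Torus q σ →ₐ[ℂ] Module.End ℂ V} {Φ : B →ₐ[ℂ] Torus.Frac q σ}
  {ψ : B →ₐ[ℂ] Module.End ℂ V} {D : Torus q σ} {d : ℂ}

theorem of_algebraMap (c : ℂ) : HasValueWith ρ Φ ψ D d (algebraMap ℂ B c) :=
  ⟨0, algebraMap ℂ _ c, by simp, by simp⟩

theorem map_pow_eq (hd : ρ D = d • (1 : Module.End ℂ V)) (k : ℕ) :
    ρ (D ^ k) = d ^ k • (1 : Module.End ℂ V) := by
  rw [map_pow, hd, smul_pow, one_pow]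

theorem mul (hD : D ∈ Torus.denominators q σ) {a b : B} (ha : HasValueWith ρ Φ ψ D d a)
    (hb : HasValueWith ρ Φ ψ D d b) : HasValueWith ρ Φ ψ D d (a * b) := by
  obtain ⟨k, P, h₁, h₂⟩ := ha
  obtain ⟨l, Q, h₃, h₄⟩ := hb
  have hc : P * D ^ l = D ^ l * P := Submonoid.mem_center_iff.mp (pow_mem hD.1 l) P
  refine ⟨l + k, P * Q, ?_, ?_⟩
  · rw [pow_add, map_mul, map_mul, mul_assoc, ← mul_assoc _ (Φ a), h₁, ← mul_assoc, ← map_mul, ← hc,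
      map_mul, mul_assoc, h₃, map_mul]
  · rw [map_mul, map_mul, h₂, h₄, smul_mul_assoc, mul_smul_comm, smul_smul, pow_add, mul_comm]

theorem add (hd : ρ D = d • (1 : Module.End ℂ V)) {a b : B} (ha : HasValueWith ρ Φ ψ D d a)
    (hb : HasValueWith ρ Φ ψ D d b) : HasValueWith ρ Φ ψ D d (a + b) := by
  obtain ⟨k, P, h₁, h₂⟩ := ha
  obtain ⟨l, Q, h₃, h₄⟩ := hb
  refine ⟨k + l, D ^ l * P + D ^ k * Q, ?_, ?_⟩
  · rw [map_add Φ, mul_add, map_add, map_mul, map_mul, ← h₁, ← h₃, ← mul_assoc, ← mul_assoc,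
      ← map_mul, ← map_mul, ← pow_add, ← pow_add, add_comm l]
  · rw [map_add, map_mul, map_mul, h₂, h₄, map_pow_eq hd, map_pow_eq hd, map_add]
    simp only [smul_mul_assoc, one_mul, smul_smul, smul_add, pow_add]
    rw [mul_comm (d ^ l)]

/-- If the numerator P of Φ(b) divides a power of D, then D^m Φ(b⁻¹) = P'PΦ(b)⁻¹ = P'D^k. -/
theorem inv (hd : ρ D = d • (1 : Module.End ℂ V)) {b : Bˣ} {k m : ℕ} {P P' : Torus q σ}
    (h₁ : Torus.toFrac q σ (D ^ k) * Φ b.1 = Torus.toFrac q σ P) (h₂ : ρ P = d ^ k • ψ b.1)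
    (h₃ : P' * P = D ^ m) : HasValueWith ρ Φ ψ D d b⁻¹.1 := by
  refine ⟨m, P' * D ^ k, ?_, ?_⟩
  · rw [← h₃, map_mul, ← h₁, map_mul, mul_assoc, mul_assoc, ← map_mul, Units.mul_inv, map_one,
      mul_one]
  · have h₄ : d ^ k • (ρ P' * ψ b.1) = d ^ m • (1 : Module.End ℂ V) := by
      rw [← mul_smul_comm, ← h₂, ← map_mul, h₃, map_pow_eq hd]
    have h₅ := congrArg (· * ψ b⁻¹.1) h₄
    simp only [smul_mul_assoc, one_mul, mul_assoc] at h₅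
    rw [← map_mul, Units.mul_inv, map_one, mul_one] at h₅
    rw [map_mul, map_pow_eq hd, mul_smul_comm, mul_one, h₅]

/-- D is central and acts by a nonzero scalar, so its powers serve as both left and right
denominators. -/
theorem isValueAt (hD : D ∈ Torus.denominators q σ) (hd : ρ D = d • (1 : Module.End ℂ V))
    (hd0 : d ≠ 0) {b : B} (hb : HasValueWith ρ Φ ψ D d b) : IsValueAt ρ (Φ b) (ψ b) := by
  obtain ⟨k, P, h₁, h₂⟩ := hb
  have hDk : D ^ k ∈ Torus.denominators q σ := pow_mem hD k
  have hu : IsUnit (Torus.toFrac q σ (D ^ k)) :=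
    OreLocalization.numerator_isUnit (⟨_, hDk⟩ : Torus.denominators q σ)
  have hρ : IsUnit (ρ (D ^ k)) := by
    rw [map_pow_eq hd]
    exact isUnit_one.smul (Units.mk0 _ (pow_ne_zero k hd0))
  have h₃ : Φ b * Torus.toFrac q σ (D ^ k) = Torus.toFrac q σ P := by
    refine hu.mul_left_cancel ?_
    rw [← mul_assoc, h₁, ← map_mul, ← map_mul, Submonoid.mem_center_iff.mp hDk.1 P]
  refine ⟨⟨P, D ^ k, hDk.2, hρ, h₃, ?_⟩, ⟨P, D ^ k, hDk.2, hρ, h₁, ?_⟩⟩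
  · rw [map_pow_eq hd, mul_smul_comm, mul_one, h₂]
  · rw [map_pow_eq hd, smul_mul_assoc, one_mul, h₂]

end HasValueWith

/-- Since (-q)^N = -1, the cofactor is the geometric sum of the powers of -qy. Thus the noncentral
denominators of the coordinate change divide elements 1 + y^N. -/
theorem IsQRoot.exists_one_add_mul (h : IsQRoot N q) {A : Type*} [Ring A] [Algebra ℂ A] (y : A) :
    ∃ g : A, (1 + q • y) * g = 1 + y ^ N ∧ g * (1 + q • y) = 1 + y ^ N := by
  have hz : (-(q • y)) ^ N = - y ^ N := by
    rw [← neg_smul, smul_pow, neg_pow, h.pow_eq, ← pow_add, show N + (N + 1) = 2 * N + 1 by ring,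
      pow_succ, pow_mul]
    simp
  have h₁ := mul_neg_geom_sum (-(q • y)) N
  have h₂ := geom_sum_mul_neg (-(q • y)) N
  rw [hz, sub_neg_eq_add, sub_neg_eq_add] at h₁ h₂
  exact ⟨_, h₁, h₂⟩

end Fractions

/-! ### Local representations -/

section Local

variable {N : ℕ} {q : ℂ} {V W V₁ V₂ V₁' V₂' : Type*}
  [AddCommGroup V] [Module ℂ V] [AddCommGroup W] [Module ℂ W]
  [AddCommGroup V₁] [Module ℂ V₁] [AddCommGroup V₂] [Module ℂ V₂]
  [AddCommGroup V₁'] [Module ℂ V₁'] [AddCommGroup V₂'] [Module ℂ V₂']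

/-- The operators on the source of an isomorphism that correspond to operators on its target. -/
def pullback {L : V →ₗ[ℂ] W} (hL : Function.Bijective L) :
    Module.End ℂ W →ₐ[ℂ] Module.End ℂ V :=
  ((LinearEquiv.ofBijective L hL).symm.conjAlgEquiv ℂ).toAlgHom

theorem intertwines_pullback {L : V →ₗ[ℂ] W} (hL : Function.Bijective L) (B : Module.End ℂ W) :
    Intertwines L (pullback hL B) B :=
  Intertwines.of_apply fun v => by
    change LinearEquiv.ofBijective L hL ((LinearEquiv.ofBijective L hL).symm (B (L v))) = _
    rw [LinearEquiv.apply_symm_apply]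

theorem intertwines_iff {L : V →ₗ[ℂ] W} (hL : Function.Bijective L) {A : Module.End ℂ V}
    {B : Module.End ℂ W} : Intertwines L A B ↔ A = pullback hL B :=
  ⟨fun h => h.eq_left (intertwines_pullback hL B) hL.1, fun h => h ▸ intertwines_pullback hL B⟩

/-- The tensor product of two invertible operators. -/
def mapUnits (a : (Module.End ℂ V)ˣ) (b : (Module.End ℂ W)ˣ) : (Module.End ℂ (V ⊗[ℂ] W))ˣ where
  val := TensorProduct.map a.1 b.1
  inv := TensorProduct.map a⁻¹.1 b⁻¹.1
  val_inv := by simp [← TensorProduct.map_mul, TensorProduct.map_one]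
  inv_val := by simp [← TensorProduct.map_mul, TensorProduct.map_one]

theorem mapUnits_commute (a : (Module.End ℂ V)ˣ) (b : (Module.End ℂ W)ˣ) :
    Commute (mapUnits a 1) (mapUnits 1 b) := by
  refine Units.ext ?_
  simp [mapUnits, ← TensorProduct.map_mul]

/-- The invertible operators of a representation of the triangle algebra. -/
def triUnit (τ : TriangleAlg q →ₐ[ℂ] Module.End ℂ V) (i : Fin 3) : (Module.End ℂ V)ˣ :=
  Units.map τ.toMonoidHom (Torus.X q triSigma i)

theorem triUnit_val (τ : TriangleAlg q →ₐ[ℂ] Module.End ℂ V) (i : Fin 3) :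
    (triUnit τ i).1 = τ (Torus.X q triSigma i) := rfl

/-- Stated for units so that the values on inverse generators are available as well. -/
theorem map_localRep (hq : q ≠ 0) (t : SquareTriangulation)
    (τ₁ : TriangleAlg q →ₐ[ℂ] Module.End ℂ V₁) (τ₂ : TriangleAlg q →ₐ[ℂ] Module.End ℂ V₂)
    (i : Fin 5) : Units.map (localRep hq t τ₁ τ₂).toMonoidHom (Torus.X q t.sigma i) =
      mapUnits (Units.map τ₁.toMonoidHom (side q t.T₁ i))
        (Units.map τ₂.toMonoidHom (side q t.T₂ i)) := by
  refine Units.ext ?_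
  change localRep hq t τ₁ τ₂ (Torus.X q t.sigma i) = _
  refine TensorProduct.ext' fun v w => ?_
  simp [localRep, cfEmbed, unitTmul, mapUnits, Module.endTensorEndAlgHom_apply]

section Values

variable (hq : q ≠ 0) (τ₁ : TriangleAlg q →ₐ[ℂ] Module.End ℂ V₁)
  (τ₂ : TriangleAlg q →ₐ[ℂ] Module.End ℂ V₂)

open SquareTriangulation

theorem map_localRep_of {t : SquareTriangulation} {i : Fin 5} {u v : (TriangleAlg q)ˣ}
    (hu : side q t.T₁ i = u) (hv : side q t.T₂ i = v) :
    Units.map (localRep hq t τ₁ τ₂).toMonoidHom (Torus.X q t.sigma i) =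
      mapUnits (Units.map τ₁.toMonoidHom u) (Units.map τ₂.toMonoidHom v) := by
  rw [map_localRep, hu, hv]

theorem localRep_lam_zero : localRep hq lam τ₁ τ₂ (Torus.X q lam.sigma 0) =
    (mapUnits (triUnit τ₁ 0) 1).1 := by
  have := map_localRep_of hq τ₁ τ₂ (t := lam) (i := 0) (side_apply q lam.inj₁ 0)
    (side_of_ne q (by decide))
  rw [map_one] at this
  exact congrArg Units.val this

theorem localRep_lam_one : localRep hq lam τ₁ τ₂ (Torus.X q lam.sigma 1) =
    (mapUnits 1 (triUnit τ₂ 1)).1 := by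
  have := map_localRep_of hq τ₁ τ₂ (t := lam) (i := 1) (side_of_ne q (by decide))
    (side_apply q lam.inj₂ 1)
  rw [map_one] at this
  exact congrArg Units.val this

theorem localRep_lam_two : localRep hq lam τ₁ τ₂ (Torus.X q lam.sigma 2) =
    (mapUnits 1 (triUnit τ₂ 2)).1 := by
  have := map_localRep_of hq τ₁ τ₂ (t := lam) (i := 2) (side_of_ne q (by decide))
    (side_apply q lam.inj₂ 2)
  rw [map_one] at this
  exact congrArg Units.val this

theorem localRep_lam_three : localRep hq lam τ₁ τ₂ (Torus.X q lam.sigma 3) =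
    (mapUnits (triUnit τ₁ 2) 1).1 := by
  have := map_localRep_of hq τ₁ τ₂ (t := lam) (i := 3) (side_apply q lam.inj₁ 2)
    (side_of_ne q (by decide))
  rw [map_one] at this
  exact congrArg Units.val this

theorem map_localRep_lam_four :
    Units.map (localRep hq lam τ₁ τ₂).toMonoidHom (Torus.X q lam.sigma 4) =
      mapUnits (triUnit τ₁ 1) (triUnit τ₂ 0) :=
  map_localRep_of hq τ₁ τ₂ (t := lam) (i := 4) (side_apply q lam.inj₁ 1) (side_apply q lam.inj₂ 0)

theorem localRep_lam_four : localRep hq lam τ₁ τ₂ (Torus.X q lam.sigma 4) =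
    (mapUnits (triUnit τ₁ 1) (triUnit τ₂ 0)).1 :=
  congrArg Units.val (map_localRep_lam_four hq τ₁ τ₂)

theorem localRep_lam_four_inv : localRep hq lam τ₁ τ₂ (Torus.X q lam.sigma 4)⁻¹.1 =
    (mapUnits (triUnit τ₁ 1) (triUnit τ₂ 0))⁻¹.1 :=
  congrArg (fun u => u⁻¹.1) (map_localRep_lam_four hq τ₁ τ₂)

theorem localRep_lam'_zero : localRep hq lam' τ₁ τ₂ (Torus.X q lam'.sigma 0) =
    (mapUnits (triUnit τ₁ 0) 1).1 := by
  have := map_localRep_of hq τ₁ τ₂ (t := lam') (i := 0) (side_apply q lam'.inj₁ 0)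
    (side_of_ne q (by decide))
  rw [map_one] at this
  exact congrArg Units.val this

theorem localRep_lam'_one : localRep hq lam' τ₁ τ₂ (Torus.X q lam'.sigma 1) =
    (mapUnits (triUnit τ₁ 1) 1).1 := by
  have := map_localRep_of hq τ₁ τ₂ (t := lam') (i := 1) (side_apply q lam'.inj₁ 1)
    (side_of_ne q (by decide))
  rw [map_one] at this
  exact congrArg Units.val this

theorem localRep_lam'_two : localRep hq lam' τ₁ τ₂ (Torus.X q lam'.sigma 2) =
    (mapUnits 1 (triUnit τ₂ 2)).1 := by
  have := map_localRep_of hq τ₁ τ₂ (t := lam') (i := 2) (side_of_ne q (by decide))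
    (side_apply q lam'.inj₂ 2)
  rw [map_one] at this
  exact congrArg Units.val this

theorem localRep_lam'_three : localRep hq lam' τ₁ τ₂ (Torus.X q lam'.sigma 3) =
    (mapUnits 1 (triUnit τ₂ 0)).1 := by
  have := map_localRep_of hq τ₁ τ₂ (t := lam') (i := 3) (side_of_ne q (by decide))
    (side_apply q lam'.inj₂ 0)
  rw [map_one] at this
  exact congrArg Units.val this

theorem localRep_lam'_four : localRep hq lam' τ₁ τ₂ (Torus.X q lam'.sigma 4) =
    (mapUnits (triUnit τ₁ 2) (triUnit τ₂ 1)).1 :=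
  congrArg Units.val
    (map_localRep_of hq τ₁ τ₂ (t := lam') (i := 4) (side_apply q lam'.inj₁ 2)
      (side_apply q lam'.inj₂ 1))

end Values

open SquareTriangulation

theorem coordChange_X (h : IsQRoot N q) (i : Fin 5) :
    coordChange h (Torus.X q lam'.sigma i) = (coordImage h i).1 := Torus.lift_X _ _ i

theorem coordChange_fst (h : IsQRoot N q) {i j : Fin 5} (hij : coordImage h i = fracA h * fracX q j) :
    coordChange h (Torus.X q lam'.sigma i) = Torus.toFrac q lam.sigma
      ((1 + q • (Torus.X q lam.sigma 4).1) * Torus.X q lam.sigma j) := by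
  rw [coordChange_X, hij, Units.val_mul, fracA_val, map_mul, map_add, map_one, map_smul]
  rfl

/-- The images for the edges 03 and 12 are genuine fractions, so their relations are kept with the
denominator cleared. -/
theorem coordChange_snd (h : IsQRoot N q) {i j : Fin 5}
    (hij : coordImage h i = (fracB h)⁻¹ * fracX q j) :
    Torus.toFrac q lam.sigma (1 + q • (Torus.X q lam.sigma 4)⁻¹.1) *
      coordChange h (Torus.X q lam'.sigma i) =
        Torus.toFrac q lam.sigma (Torus.X q lam.sigma j) := by
  have hB : Torus.toFrac q lam.sigma (1 + q • (Torus.X q lam.sigma 4)⁻¹.1) = (fracB h).1 := by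
    rw [fracB_val, map_add, map_one, map_smul]
    rfl
  rw [coordChange_X, hij, hB, Units.val_mul, ← mul_assoc, Units.mul_inv, one_mul]
  rfl

theorem coordChange_four (h : IsQRoot N q) :
    coordChange h (Torus.X q lam'.sigma 4) =
      Torus.toFrac q lam.sigma (Torus.X q lam.sigma 4)⁻¹.1 := by
  rw [coordChange_X]
  rfl

variable {τ₁ : TriangleAlg q →ₐ[ℂ] Module.End ℂ V₁} {τ₂ : TriangleAlg q →ₐ[ℂ] Module.End ℂ V₂}
  {τ₁' : TriangleAlg q →ₐ[ℂ] Module.End ℂ V₁'} {τ₂' : TriangleAlg q →ₐ[ℂ] Module.End ℂ V₂'}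
  {L : V₁ ⊗[ℂ] V₂ →ₗ[ℂ] V₁' ⊗[ℂ] V₂'}

/-- The relations between the operators of two local representations that are satisfied by an
intertwining operator. -/
theorem IsIntertwiner.relations (h : IsQRoot N q) (hL : Function.Bijective L)
    (hI : IsIntertwiner h (localRep h.ne_zero lam τ₁ τ₂) (localRep h.ne_zero lam' τ₁' τ₂') L) :
    (1 + q • (mapUnits (triUnit τ₁ 1) (triUnit τ₂ 0)).1) * (mapUnits (triUnit τ₁ 0) 1).1 =
      pullback hL (mapUnits (triUnit τ₁' 0) 1).1 ∧
    (1 + q • (mapUnits (triUnit τ₁ 1) (triUnit τ₂ 0))⁻¹.1) *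
      pullback hL (mapUnits (triUnit τ₁' 1) 1).1 = (mapUnits 1 (triUnit τ₂ 1)).1 ∧
    (1 + q • (mapUnits (triUnit τ₁ 1) (triUnit τ₂ 0))⁻¹.1) *
      pullback hL (mapUnits 1 (triUnit τ₂' 0)).1 = (mapUnits (triUnit τ₁ 2) 1).1 ∧
    (mapUnits (triUnit τ₁ 1) (triUnit τ₂ 0)).1 *
      pullback hL (mapUnits (triUnit τ₁' 2) (triUnit τ₂' 1)).1 = 1 := by
  have key : ∀ X', IsValueAt (localRep h.ne_zero lam τ₁ τ₂) (coordChange h X')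
      (pullback hL (localRep h.ne_zero lam' τ₁' τ₂' X')) := by
    intro X'
    obtain ⟨A, hA, hAL⟩ := hI.2 X'
    rwa [(intertwines_iff hL).mp hAL] at hA
  refine ⟨?_, ?_, ?_, ?_⟩
  · have := (key (Torus.X q lam'.sigma 0)).mul_eq (b := 1)
      (c := (1 + q • (Torus.X q lam.sigma 4).1) * Torus.X q lam.sigma 0)
      (by rw [map_one, one_mul]; exact coordChange_fst h (j := 0) rfl)
    rw [map_one, one_mul, localRep_lam'_zero, map_mul, map_add, map_one, map_smul,
      localRep_lam_four, localRep_lam_zero] at this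
    exact this.symm
  · have := (key (Torus.X q lam'.sigma 1)).mul_eq (coordChange_snd h (j := 1) rfl)
    rwa [localRep_lam'_one, map_add, map_one, map_smul, localRep_lam_four_inv,
      localRep_lam_one] at this
  · have := (key (Torus.X q lam'.sigma 3)).mul_eq (coordChange_snd h (j := 3) rfl)
    rwa [localRep_lam'_three, map_add, map_one, map_smul, localRep_lam_four_inv,
      localRep_lam_three] at this
  · have := (key (Torus.X q lam'.sigma 4)).mul_eq (b := Torus.X q lam.sigma 4) (c := 1) (by
      rw [coordChange_four, ← map_mul, Units.mul_inv])
    rwa [localRep_lam'_four, localRep_lam_four, map_one] at this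

/-- The relations between the operators of two local representations that characterize an
intertwining operator. -/
theorem isIntertwiner_of_relations (h : IsQRoot N q) (hL : Function.Bijective L) {d : ℂ}
    (hd0 : d ≠ 0) (hd : 1 + (mapUnits (triUnit τ₁ 1) (triUnit τ₂ 0)).1 ^ N =
      d • (1 : Module.End ℂ (V₁ ⊗[ℂ] V₂)))
    (r₁ : (1 + q • (mapUnits (triUnit τ₁ 1) (triUnit τ₂ 0)).1) * (mapUnits (triUnit τ₁ 0) 1).1 =
      pullback hL (mapUnits (triUnit τ₁' 0) 1).1)
    (r₂ : (1 + q • (mapUnits (triUnit τ₁ 1) (triUnit τ₂ 0))⁻¹.1) *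
      pullback hL (mapUnits (triUnit τ₁' 1) 1).1 = (mapUnits 1 (triUnit τ₂ 1)).1)
    (r₃ : (1 + q • (mapUnits (triUnit τ₁ 1) (triUnit τ₂ 0)).1) * (mapUnits 1 (triUnit τ₂ 2)).1 =
      pullback hL (mapUnits 1 (triUnit τ₂' 2)).1)
    (r₄ : (1 + q • (mapUnits (triUnit τ₁ 1) (triUnit τ₂ 0))⁻¹.1) *
      pullback hL (mapUnits 1 (triUnit τ₂' 0)).1 = (mapUnits (triUnit τ₁ 2) 1).1)
    (r₅ : (mapUnits (triUnit τ₁ 1) (triUnit τ₂ 0)).1 *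
      pullback hL (mapUnits (triUnit τ₁' 2) (triUnit τ₂' 1)).1 = 1) :
    IsIntertwiner h (localRep h.ne_zero lam τ₁ τ₂) (localRep h.ne_zero lam' τ₁' τ₂') L := by
  set ρ := localRep h.ne_zero lam τ₁ τ₂ with hρ
  set ρ' := localRep h.ne_zero lam' τ₁' τ₂' with hρ'
  set ψ := (pullback hL).comp ρ' with hψ
  -- A common central denominator. Elements whose value has a power of D as denominator are closed
  -- under sums and products, so it suffices to treat the generators and their inverses.
  set D := 1 + (Torus.X q lam.sigma 4).1 ^ N with hDdef
  have hD : D ∈ Torus.denominators q lam.sigma := Torus.one_add_pow_mem_denominators h 4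
  have hρD : ρ D = d • (1 : Module.End ℂ (V₁ ⊗[ℂ] V₂)) := by
    rw [hDdef, map_add, map_one, map_pow, hρ, localRep_lam_four, hd]
  obtain ⟨g, hg₁, hg₂⟩ := h.exists_one_add_mul (Torus.X q lam.sigma 4).1
  obtain ⟨g', hg₁', hg₂'⟩ := h.exists_one_add_mul (Torus.X q lam.sigma 4)⁻¹.1
  have hXN : (1 + (Torus.X q lam.sigma 4)⁻¹.1 ^ N) * (Torus.X q lam.sigma 4).1 ^ N = D := by
    rw [add_mul, one_mul, ← Units.val_pow_eq_pow_val, ← Units.val_pow_eq_pow_val, inv_pow,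
      Units.inv_mul, Units.val_pow_eq_pow_val, add_comm]
  -- edges of the first kind
  have hfst : ∀ (i j : Fin 5), coordImage h i = fracA h * fracX q j →
      (1 + q • (mapUnits (triUnit τ₁ 1) (triUnit τ₂ 0)).1) * ρ (Torus.X q lam.sigma j) =
        ψ (Torus.X q lam'.sigma i) →
      HasValueWith ρ (coordChange h) ψ D d (Torus.X q lam'.sigma i).1 ∧
        HasValueWith ρ (coordChange h) ψ D d (Torus.X q lam'.sigma i)⁻¹.1 := by
    intro i j hij hr
    have h₁ : Torus.toFrac q lam.sigma (D ^ 0) * coordChange h (Torus.X q lam'.sigma i) =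
        Torus.toFrac q lam.sigma
          ((1 + q • (Torus.X q lam.sigma 4).1) * Torus.X q lam.sigma j) := by
      rw [pow_zero, map_one, one_mul, coordChange_fst h hij]
    have h₂ : ρ ((1 + q • (Torus.X q lam.sigma 4).1) * Torus.X q lam.sigma j) =
        d ^ 0 • ψ (Torus.X q lam'.sigma i) := by
      rw [pow_zero, one_smul, ← hr, map_mul, map_add, map_one, map_smul]
      rw [hρ, localRep_lam_four]
    -- The image itself needs no denominator. For its inverse, X_j⁻¹ g times the numerator (1 +
    -- qX₅)X_j is D.
    refine ⟨⟨0, _, h₁, h₂⟩, HasValueWith.inv hρD (m := 1)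
      (P' := (Torus.X q lam.sigma j)⁻¹.1 * g) h₁ h₂ ?_⟩
    rw [mul_assoc, ← mul_assoc g, hg₂, ← Submonoid.mem_center_iff.mp hD.1, ← mul_assoc,
      Units.inv_mul, one_mul, pow_one]
  -- edges of the second kind
  have hsnd : ∀ (i j : Fin 5), coordImage h i = (fracB h)⁻¹ * fracX q j →
      (1 + q • (mapUnits (triUnit τ₁ 1) (triUnit τ₂ 0))⁻¹.1) * ψ (Torus.X q lam'.sigma i) =
        ρ (Torus.X q lam.sigma j) →
      HasValueWith ρ (coordChange h) ψ D d (Torus.X q lam'.sigma i).1 ∧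
        HasValueWith ρ (coordChange h) ψ D d (Torus.X q lam'.sigma i)⁻¹.1 := by
    intro i j hij hr
    -- 1 + qX₅⁻¹ divides 1 + X₅^(-N), which becomes D after multiplication by X₅^N.
    have hgD : (Torus.X q lam.sigma 4).1 ^ N * g' * (1 + q • (Torus.X q lam.sigma 4)⁻¹.1) = D := by
      have hc : Commute ((Torus.X q lam.sigma 4).1 ^ N) (1 + (Torus.X q lam.sigma 4)⁻¹.1 ^ N) := by
        refine (Commute.one_right _).add_right (Commute.pow_pow ?_ _ _)
        exact (Units.mul_inv _).trans (Units.inv_mul _).symm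
      rw [mul_assoc, hg₂', hc.eq, hXN]
    have hDg : (1 + q • (Torus.X q lam.sigma 4)⁻¹.1) * ((Torus.X q lam.sigma 4).1 ^ N * g') = D := by
      have hc : Commute (1 + q • (Torus.X q lam.sigma 4)⁻¹.1) ((Torus.X q lam.sigma 4).1 ^ N) := by
        refine (Commute.one_left _).add_left (Commute.smul_left (Commute.pow_right ?_ _) _)
        exact (Units.inv_mul _).trans (Units.mul_inv _).symm
      have hc' : Commute ((Torus.X q lam.sigma 4).1 ^ N) (1 + (Torus.X q lam.sigma 4)⁻¹.1 ^ N) := by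
        refine (Commute.one_right _).add_right (Commute.pow_pow ?_ _ _)
        exact (Units.mul_inv _).trans (Units.inv_mul _).symm
      rw [← mul_assoc, hc.eq, mul_assoc, hg₁', hc'.eq, hXN]
    have h₁ : Torus.toFrac q lam.sigma (D ^ 1) * coordChange h (Torus.X q lam'.sigma i) =
        Torus.toFrac q lam.sigma
          ((Torus.X q lam.sigma 4).1 ^ N * g' * Torus.X q lam.sigma j) := by
      rw [pow_one, ← hgD, map_mul, mul_assoc, coordChange_snd h hij, ← map_mul]
    have h₂ : ρ ((Torus.X q lam.sigma 4).1 ^ N * g' * Torus.X q lam.sigma j) =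
        d ^ 1 • ψ (Torus.X q lam'.sigma i) := by
      have h₃ : ρ (1 + q • (Torus.X q lam.sigma 4)⁻¹.1) =
          1 + q • (mapUnits (triUnit τ₁ 1) (triUnit τ₂ 0))⁻¹.1 := by
        rw [map_add, map_one, map_smul, hρ, localRep_lam_four_inv]
      rw [map_mul, ← hr, ← h₃, ← mul_assoc, ← map_mul, hgD, hρD, smul_mul_assoc, one_mul, pow_one]
    refine ⟨⟨1, _, h₁, h₂⟩, HasValueWith.inv hρD (m := 1)
      (P' := (Torus.X q lam.sigma j)⁻¹.1 * (1 + q • (Torus.X q lam.sigma 4)⁻¹.1)) h₁ h₂ ?_⟩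
    rw [mul_assoc, ← mul_assoc (1 + _), hDg, ← Submonoid.mem_center_iff.mp hD.1, ← mul_assoc,
      Units.inv_mul, one_mul, pow_one]
  have hlast : HasValueWith ρ (coordChange h) ψ D d (Torus.X q lam'.sigma 4).1 ∧
      HasValueWith ρ (coordChange h) ψ D d (Torus.X q lam'.sigma 4)⁻¹.1 := by
    have h₁ : Torus.toFrac q lam.sigma (D ^ 0) * coordChange h (Torus.X q lam'.sigma 4) =
        Torus.toFrac q lam.sigma (Torus.X q lam.sigma 4)⁻¹.1 := by
      rw [pow_zero, map_one, one_mul, coordChange_four]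
    have h₂ : ρ (Torus.X q lam.sigma 4)⁻¹.1 = d ^ 0 • ψ (Torus.X q lam'.sigma 4) := by
      rw [pow_zero, one_smul, hρ, localRep_lam_four_inv]
      refine Units.inv_eq_of_mul_eq_one_right ?_
      rw [hψ, AlgHom.comp_apply, hρ', localRep_lam'_four, r₅]
    exact ⟨⟨0, _, h₁, h₂⟩, HasValueWith.inv hρD (m := 0) (P' := (Torus.X q lam.sigma 4).1) h₁ h₂
      (by rw [Units.mul_inv, pow_zero])⟩
  have h0 := hfst 0 0 rfl (by
    rw [hψ, AlgHom.comp_apply, hρ, hρ', localRep_lam'_zero, localRep_lam_zero, r₁])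
  have h1 := hsnd 1 1 rfl (by
    rw [hψ, AlgHom.comp_apply, hρ, hρ', localRep_lam'_one, localRep_lam_one, r₂])
  have h2 := hfst 2 2 rfl (by
    rw [hψ, AlgHom.comp_apply, hρ, hρ', localRep_lam'_two, localRep_lam_two, r₃])
  have h3 := hsnd 3 3 rfl (by
    rw [hψ, AlgHom.comp_apply, hρ, hρ', localRep_lam'_three, localRep_lam_three, r₄])
  have hall : ∀ i, HasValueWith ρ (coordChange h) ψ D d (Torus.X q lam'.sigma i).1 ∧
      HasValueWith ρ (coordChange h) ψ D d (Torus.X q lam'.sigma i)⁻¹.1 := by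
    intro i
    fin_cases i
    exacts [h0, h1, h2, h3, hlast]
  refine ⟨hL, fun X' => ⟨ψ X', ?_, intertwines_pullback hL _⟩⟩
  refine HasValueWith.isValueAt hD hρD hd0 ?_
  induction X' using Torus.induction with
  | hc c => exact HasValueWith.of_algebraMap c
  | hX i => exact (hall i).1
  | hXi i => exact (hall i).2
  | hm a b ha hb => exact ha.mul hD hb
  | ha a b ha hb => exact ha.add hρD hb

end Local

/-! ### Flips and intertwining operators -/

section FlipIntertwiner

open SquareTriangulation

variable {N : ℕ} {q : ℂ} {V W V₁ V₂ V₁' V₂' : Type*}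
  [AddCommGroup V] [Module ℂ V] [AddCommGroup W] [Module ℂ W]
  [AddCommGroup V₁] [Module ℂ V₁] [AddCommGroup V₂] [Module ℂ V₂]
  [AddCommGroup V₁'] [Module ℂ V₁'] [AddCommGroup V₂'] [Module ℂ V₂']

/-- The invertible operator `X`. -/
def unitX (ρ : Weyl q →ₐ[ℂ] Module.End ℂ V) : (Module.End ℂ V)ˣ :=
  ⟨ρ (Weyl.X q), ρ (Weyl.Xinv q), rep_X_Xinv ρ, rep_Xinv_X ρ⟩

/-- The invertible operator `Y`. -/
def unitY {ρ : Weyl q →ₐ[ℂ] Module.End ℂ V} (h : IsCyclic ρ) : (Module.End ℂ V)ˣ :=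
  ⟨ρ (Weyl.Y q), Ring.inverse (ρ (Weyl.Y q)), Ring.mul_inverse_cancel _ h.isUnit_Y,
    Ring.inverse_mul_cancel _ h.isUnit_Y⟩

theorem mapUnits_mul (a c : (Module.End ℂ V)ˣ) (b d : (Module.End ℂ W)ˣ) :
    mapUnits (a * c) (b * d) = mapUnits a b * mapUnits c d :=
  Units.ext (TensorProduct.map_mul _ _ _ _)

theorem mapUnits_inv (a : (Module.End ℂ V)ˣ) (b : (Module.End ℂ W)ˣ) :
    (mapUnits a b)⁻¹ = mapUnits a⁻¹ b⁻¹ := Units.ext rfl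

theorem mapUnits_eq (a : (Module.End ℂ V)ˣ) (b : (Module.End ℂ W)ˣ) :
    mapUnits a b = mapUnits a 1 * mapUnits 1 b := by
  rw [← mapUnits_mul, mul_one, one_mul]

theorem mapUnits_rel_left {a b : (Module.End ℂ V)ˣ} {s : ℂ} (h : a.1 * b.1 = s • (b.1 * a.1)) :
    (mapUnits a (1 : (Module.End ℂ W)ˣ)).1 * (mapUnits b 1).1 =
      s • ((mapUnits b (1 : (Module.End ℂ W)ˣ)).1 * (mapUnits a 1).1) := by
  simp only [mapUnits, ← TensorProduct.map_mul, h, TensorProduct.map_smul_left]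

theorem mapUnits_rel_right {a b : (Module.End ℂ W)ˣ} {s : ℂ} (h : a.1 * b.1 = s • (b.1 * a.1)) :
    (mapUnits (1 : (Module.End ℂ V)ˣ) a).1 * (mapUnits 1 b).1 =
      s • ((mapUnits (1 : (Module.End ℂ V)ˣ) b).1 * (mapUnits 1 a).1) := by
  simp only [mapUnits, ← TensorProduct.map_mul, h, TensorProduct.map_smul_right]

theorem tensorRep_X_eq_units (ρ₁' : Weyl q →ₐ[ℂ] Module.End ℂ V₁')
    (ρ₂' : Weyl q →ₐ[ℂ] Module.End ℂ V₂') : tensorRep ρ₁' ρ₂' (Weyl.X q) =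
      (mapUnits (unitX ρ₁') 1).1 * (mapUnits 1 (unitX ρ₂')).1 := by
  rw [tensorRep_X, ← Units.val_mul, ← mapUnits_eq]
  rfl

theorem tensorRep_Y_eq_units {ρ₁' : Weyl q →ₐ[ℂ] Module.End ℂ V₁'}
    {ρ₂' : Weyl q →ₐ[ℂ] Module.End ℂ V₂'} (h₁ : IsCyclic ρ₁') (h₂ : IsCyclic ρ₂') :
    tensorRep ρ₁' ρ₂' (Weyl.Y q) = (mapUnits (unitX ρ₁') 1)⁻¹.1 * (mapUnits 1 (unitY h₂)).1 +
      (mapUnits (unitY h₁) 1).1 := by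
  rw [tensorRep_Y, ← Units.val_mul, mapUnits_inv, inv_one, ← mapUnits_eq]
  rfl

theorem cgOpX_eq_units {ρ₁' : Weyl q →ₐ[ℂ] Module.End ℂ V₁'}
    {ρ₂' : Weyl q →ₐ[ℂ] Module.End ℂ V₂'} (h₁ : IsCyclic ρ₁') (h₂ : IsCyclic ρ₂') :
    cgOpX ρ₁' ρ₂' = (mapUnits (unitX ρ₁') 1)⁻¹.1 +
      (mapUnits (unitY h₁) 1).1 * (mapUnits 1 (unitY h₂))⁻¹.1 := by
  rw [mapUnits_inv 1, inv_one, ← Units.val_mul, ← mapUnits_eq]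
  rfl

theorem cgOpY_eq_units {ρ₁' : Weyl q →ₐ[ℂ] Module.End ℂ V₁'}
    {ρ₂' : Weyl q →ₐ[ℂ] Module.End ℂ V₂'} (h₁ : IsCyclic ρ₁') (h₂ : IsCyclic ρ₂') :
    cgOpY ρ₁' ρ₂' = q⁻¹ • ((mapUnits (unitY h₁) 1).1 *
      ((mapUnits 1 (unitX ρ₂'))⁻¹.1 * (mapUnits 1 (unitY h₂))⁻¹.1)) := by
  rw [mapUnits_inv, mapUnits_inv, inv_one, ← Units.val_mul, ← Units.val_mul, ← mapUnits_mul,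
    mul_one, ← mapUnits_eq]
  rfl

variable {ρ₁ : Weyl q →ₐ[ℂ] Module.End ℂ V₁} {ρ₂ : Weyl q →ₐ[ℂ] Module.End ℂ V₂}
  {ρ₁' : Weyl q →ₐ[ℂ] Module.End ℂ V₁'} {ρ₂' : Weyl q →ₐ[ℂ] Module.End ℂ V₂'}
  {L : V₁ ⊗[ℂ] V₂ →ₗ[ℂ] V₁' ⊗[ℂ] V₂'}

theorem unitX_mul_unitY {ρ : Weyl q →ₐ[ℂ] Module.End ℂ V} (h : IsCyclic ρ) :
    (unitX ρ).1 * (unitY h).1 = q ^ 2 • ((unitY h).1 * (unitX ρ).1) := rep_X_Y ρ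

theorem algHom_rel {A B : Type*} [Ring A] [Algebra ℂ A] [Ring B] [Algebra ℂ B] (f : A →ₐ[ℂ] B)
    {a b : A} {s : ℂ} (h : a * b = s • (b * a)) : f a * f b = s • (f b * f a) := by
  rw [← map_mul, h, map_smul, map_mul]

/-- An isomorphism is a flip if its relations are those of an intertwining operator, up to
a rescaling of the operators. -/
theorem isFlip_of_isIntertwiner (h : IsQRoot N q)
    {τ₁ : TriangleAlg q →ₐ[ℂ] Module.End ℂ V₁} {τ₂ : TriangleAlg q →ₐ[ℂ] Module.End ℂ V₂}
    {τ₁' : TriangleAlg q →ₐ[ℂ] Module.End ℂ V₁'} {τ₂' : TriangleAlg q →ₐ[ℂ] Module.End ℂ V₂'}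
    (i₁ : IsIrred ρ₁) (i₂ : IsIrred ρ₂) (i₁' : IsIrred ρ₁') (i₂' : IsIrred ρ₂')
    (c₁ : IsCyclic ρ₁) (c₂ : IsCyclic ρ₂) (c₁' : IsCyclic ρ₁') (c₂' : IsCyclic ρ₂') {s t : ℂ}
    (hX₁ : ρ₁ (Weyl.X q) = s • (triUnit τ₁ 0).1) (hY₁ : ρ₁ (Weyl.Y q) = (triUnit τ₁ 1).1)
    (hZ₁ : (triUnit τ₁ 2).1 = q • ((unitY c₁)⁻¹.1 * (unitX ρ₁)⁻¹.1))
    (hX₂ : ρ₂ (Weyl.X q) = (triUnit τ₂ 0).1) (hY₂ : ρ₂ (Weyl.Y q) = t • (triUnit τ₂ 1).1)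
    (hX₁' : ρ₁' (Weyl.X q) = s • (triUnit τ₁' 0).1)
    (hY₁' : ρ₁' (Weyl.Y q) = t • (triUnit τ₁' 1).1)
    (hZ₁' : (triUnit τ₁' 2).1 = q • ((unitY c₁')⁻¹.1 * (unitX ρ₁')⁻¹.1))
    (hX₂' : ρ₂' (Weyl.X q) = (triUnit τ₂' 0).1) (hY₂' : ρ₂' (Weyl.Y q) = (triUnit τ₂' 1).1)
    (hI : IsIntertwiner h (localRep h.ne_zero lam τ₁ τ₂) (localRep h.ne_zero lam' τ₁' τ₂') L) :
    IsFlip ρ₁ ρ₂ ρ₁' ρ₂' L := by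
  have hL : Function.Bijective L := hI.1
  obtain ⟨r₁, r₂, r₄, r₅⟩ := hI.relations h hL
  set φ := pullback hL with hφ
  have hYX : mapUnits (triUnit τ₁ 1) (triUnit τ₂ 0) =
      mapUnits (unitY c₁) 1 * mapUnits 1 (unitX ρ₂) := by
    rw [← mapUnits_eq]
    exact Units.ext (by simp only [mapUnits, unitY, unitX, hY₁, hX₂])
  rw [hYX] at r₁ r₂ r₄ r₅
  have hcomm : Commute (mapUnits (unitY c₁) 1) (mapUnits (1 : (Module.End ℂ V₁)ˣ) (unitX ρ₂)) :=
    mapUnits_commute _ _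
  have hinv : (mapUnits (unitY c₁) 1 * mapUnits 1 (unitX ρ₂))⁻¹ =
      (mapUnits (unitY c₁) 1)⁻¹ * (mapUnits (1 : (Module.End ℂ V₁)ˣ) (unitX ρ₂))⁻¹ := by
    rw [mul_inv_rev, hcomm.inv_inv.eq]
  rw [hinv] at r₂ r₄
  simp only [Units.val_mul] at r₁ r₂ r₄ r₅
  have hc : ∀ (u : (Module.End ℂ V₁')ˣ) (v : (Module.End ℂ V₂')ˣ),
      Commute (Units.map φ.toMonoidHom (mapUnits u 1)) (Units.map φ.toMonoidHom (mapUnits 1 v)) :=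
    fun u v => (mapUnits_commute u v).map _
  have hx₁ : (mapUnits (unitX ρ₁) (1 : (Module.End ℂ V₂)ˣ)).1 =
      s • (mapUnits (triUnit τ₁ 0) 1).1 := by
    simp only [mapUnits, unitX, hX₁, TensorProduct.map_smul_left]
  have hy₂ : (mapUnits (1 : (Module.End ℂ V₁)ˣ) (unitY c₂)).1 =
      t • (mapUnits 1 (triUnit τ₂ 1)).1 := by
    simp only [mapUnits, unitY, hY₂, TensorProduct.map_smul_right]
  have hx₁' : (mapUnits (unitX ρ₁') (1 : (Module.End ℂ V₂')ˣ)).1 =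
      s • (mapUnits (triUnit τ₁' 0) 1).1 := by
    simp only [mapUnits, unitX, hX₁', TensorProduct.map_smul_left]
  have hy₁' : (mapUnits (unitY c₁') (1 : (Module.End ℂ V₂')ˣ)).1 =
      t • (mapUnits (triUnit τ₁' 1) 1).1 := by
    simp only [mapUnits, unitY, hY₁', TensorProduct.map_smul_left]
  have hx₂' : mapUnits (1 : (Module.End ℂ V₁')ˣ) (unitX ρ₂') = mapUnits 1 (triUnit τ₂' 0) :=
    Units.ext (by simp only [mapUnits, unitX, hX₂'])
  have hz₁ : (mapUnits (triUnit τ₁ 2) (1 : (Module.End ℂ V₂)ˣ)).1 =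
      q • ((mapUnits (unitY c₁) 1)⁻¹.1 * (mapUnits (unitX ρ₁) 1)⁻¹.1) := by
    rw [mapUnits_inv, mapUnits_inv, inv_one, ← Units.val_mul, ← mapUnits_mul, mul_one]
    simp only [mapUnits, hZ₁, TensorProduct.map_smul_left, Units.val_mul]
  have hz₁' : (mapUnits (triUnit τ₁' 2) (triUnit τ₂' 1)).1 =
      q • ((mapUnits (unitY c₁') 1)⁻¹.1 * (mapUnits (unitX ρ₁') 1)⁻¹.1) *
        (mapUnits 1 (unitY c₂')).1 := by
    rw [mapUnits_inv, mapUnits_inv, inv_one, smul_mul_assoc, ← Units.val_mul, ← mapUnits_mul,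
      ← Units.val_mul, mul_one, ← mapUnits_eq]
    simp only [mapUnits, hZ₁', TensorProduct.map_smul_left, Units.val_mul, unitY, hY₂']
  -- The scalar s multiplies x₁ and a, the scalar t multiplies y₂ and b, and the other operators are
  -- unchanged, so `r₁` and `r₂` survive the rescaling. In `r₄` and `r₅` the third generators enter
  -- only through their normalized forms.
  obtain ⟨f₁, f₂, f₃, f₄⟩ := flip_of_coord (q := q)
    (x₁ := mapUnits (unitX ρ₁) 1) (y₁ := mapUnits (unitY c₁) 1)
    (x₂ := mapUnits 1 (unitX ρ₂)) (y₂ := mapUnits 1 (unitY c₂))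
    (a := Units.map φ.toMonoidHom (mapUnits (unitX ρ₁') 1))
    (b := Units.map φ.toMonoidHom (mapUnits (unitY c₁') 1))
    (c := Units.map φ.toMonoidHom (mapUnits 1 (unitX ρ₂')))
    (d := Units.map φ.toMonoidHom (mapUnits 1 (unitY c₂'))) h.ne_zero
    (algHom_rel φ (mapUnits_rel_left (unitX_mul_unitY c₁')))
    (algHom_rel φ (mapUnits_rel_right (unitX_mul_unitY c₂')))
    (hc _ _) (hc _ _) (hc _ _) hcomm
    (by
      change _ = φ (mapUnits (unitX ρ₁') 1).1
      rw [hx₁, hx₁', mul_smul_comm, r₁, map_smul])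
    (by
      change _ = _ * φ (mapUnits (unitY c₁') 1).1
      rw [hy₂, hy₁', map_smul, mul_smul_comm, r₂])
    (by
      change _ = _ * φ (mapUnits 1 (unitX ρ₂')).1
      rw [hx₂', r₄, hz₁])
    (by
      change _ * (q • (φ (mapUnits (unitY c₁') 1)⁻¹.1 * φ (mapUnits (unitX ρ₁') 1)⁻¹.1) *
        φ (mapUnits 1 (unitY c₂')).1) = 1
      rw [← map_mul, ← map_smul, ← map_mul, ← hz₁', r₅])
  have hsX : Intertwines L (TensorProduct.map 1 (ρ₂ (Weyl.X q)))
      (tensorRep ρ₁' ρ₂' (Weyl.X q)) := by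
    rw [intertwines_iff hL, tensorRep_X_eq_units, map_mul]
    exact f₁
  have hsY : Intertwines L (TensorProduct.map 1 (ρ₂ (Weyl.Y q)))
      (tensorRep ρ₁' ρ₂' (Weyl.Y q)) := by
    rw [intertwines_iff hL, tensorRep_Y_eq_units c₁' c₂', map_add, map_mul]
    exact f₂
  refine ⟨i₁, i₂, i₁', i₂', c₁, c₂, c₁', c₂', hL, ?_, ?_, ?_⟩
  · rw [intertwines_iff hL, cgOpX_eq_units c₁' c₂', map_add, map_mul]
    exact f₃
  · rw [intertwines_iff hL, cgOpY_eq_units c₁' c₂', map_smul, map_mul, map_mul]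
    exact f₄
  · exact Weyl.intertwines_of_gen (μ := (Module.End.lTensorAlgHom ℂ V₂ V₁).comp ρ₂)
      (μ' := tensorRep ρ₁' ρ₂') hsX hsY

theorem triUnit_triangleRep (hq : q ≠ 0) {ρ : Weyl q →ₐ[ℂ] Module.End ℂ V} (hρ : IsCyclic ρ)
    (i : Fin 3) : triUnit (triangleRep hq ρ hρ) i = weylUnits hq ρ hρ i :=
  Units.ext (Torus.lift_X _ _ i)

theorem triUnit_triangleRep_zero (hq : q ≠ 0) {ρ : Weyl q →ₐ[ℂ] Module.End ℂ V}
    (hρ : IsCyclic ρ) : triUnit (triangleRep hq ρ hρ) 0 = unitX ρ := by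
  rw [triUnit_triangleRep]
  exact Units.ext rfl

theorem triUnit_triangleRep_one (hq : q ≠ 0) {ρ : Weyl q →ₐ[ℂ] Module.End ℂ V}
    (hρ : IsCyclic ρ) : triUnit (triangleRep hq ρ hρ) 1 = unitY hρ := by
  rw [triUnit_triangleRep]
  exact Units.ext rfl

theorem triUnit_triangleRep_two (hq : q ≠ 0) {ρ : Weyl q →ₐ[ℂ] Module.End ℂ V}
    (hρ : IsCyclic ρ) :
    (triUnit (triangleRep hq ρ hρ) 2).1 = q • ((unitY hρ)⁻¹.1 * (unitX ρ)⁻¹.1) := by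
  have hX : hρ.isUnit_X.unit = unitX ρ := Units.ext rfl
  have hY : hρ.isUnit_Y.unit = unitY hρ := Units.ext rfl
  rw [triUnit_triangleRep, ← hX, ← hY, Algebra.smul_def]
  rfl

/-- Besides the relations from `coord_of_flip`, the denominators must act invertibly. The element 1
+ X₅^N acts by x₁(x₁⁻¹ + y₁y₂⁻¹), in terms of the parameters of ρ₁' and ρ₂', and this is nonzero by
`IsFlip.params`. -/
theorem IsFlip.isWeylIntertwiner (h : IsQRoot N q) (hL : IsFlip ρ₁ ρ₂ ρ₁' ρ₂' L) :
    IsIntertwiner h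
      (localRep h.ne_zero lam
        (triangleRep h.ne_zero ρ₁ hL.cyclic₁) (triangleRep h.ne_zero ρ₂ hL.cyclic₂))
      (localRep h.ne_zero lam'
        (triangleRep h.ne_zero ρ₁' hL.cyclic₁') (triangleRep h.ne_zero ρ₂' hL.cyclic₂')) L := by
  have hb := hL.bijective
  have c₁ := hL.cyclic₁
  have c₂ := hL.cyclic₂
  have c₁' := hL.cyclic₁'
  have c₂' := hL.cyclic₂'
  have := c₁'.finite
  have := c₂'.finite
  have := hL.irred₁'.1
  obtain ⟨x₁, y₁, p₁⟩ := hL.irred₁'.exists_hasParams h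
  obtain ⟨x₂, y₂, p₂⟩ := hL.irred₂'.exists_hasParams h
  have := hL.irred₂'.1
  obtain ⟨hx₁, -⟩ := c₁'.params_ne_zero p₁
  obtain ⟨hx₂, hy₂⟩ := c₂'.params_ne_zero p₂
  obtain ⟨p₃, p₄, hne⟩ := hL.params h p₁ p₂
  set φ := pullback hb with hφ
  have hcomm : Commute (mapUnits (unitY c₁) 1) (mapUnits (1 : (Module.End ℂ V₁)ˣ) (unitX ρ₂)) :=
    mapUnits_commute _ _
  have hYX : mapUnits (unitY c₁) (unitX ρ₂) = mapUnits (unitY c₁) 1 * mapUnits 1 (unitX ρ₂) :=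
    mapUnits_eq _ _
  have hinv : (mapUnits (unitY c₁) (unitX ρ₂))⁻¹ =
      (mapUnits (unitY c₁) 1)⁻¹ * (mapUnits (1 : (Module.End ℂ V₁)ˣ) (unitX ρ₂))⁻¹ := by
    rw [hYX, mul_inv_rev, hcomm.inv_inv.eq]
  have hc : ∀ (u : (Module.End ℂ V₁')ˣ) (v : (Module.End ℂ V₂')ˣ),
      Commute (Units.map φ.toMonoidHom (mapUnits u 1)) (Units.map φ.toMonoidHom (mapUnits 1 v)) :=
    fun u v => (mapUnits_commute u v).map _
  have f₁ := (intertwines_iff hb).mp (hL.snd (Weyl.X q))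
  have f₂ := (intertwines_iff hb).mp (hL.snd (Weyl.Y q))
  have f₃ := (intertwines_iff hb).mp hL.fst_Xinv
  have f₄ := (intertwines_iff hb).mp hL.fst_Y
  rw [tensorRep_X_eq_units, map_mul] at f₁
  rw [tensorRep_Y_eq_units c₁' c₂', map_add, map_mul] at f₂
  rw [cgOpX_eq_units c₁' c₂', map_add, map_mul] at f₃
  rw [cgOpY_eq_units c₁' c₂', map_smul, map_mul, map_mul] at f₄
  obtain ⟨r₁, r₂, r₃, r₄, r₅⟩ := coord_of_flip (q := q)
    (x₁ := mapUnits (unitX ρ₁) 1) (y₁ := mapUnits (unitY c₁) 1)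
    (x₂ := mapUnits 1 (unitX ρ₂)) (y₂ := mapUnits 1 (unitY c₂))
    (a := Units.map φ.toMonoidHom (mapUnits (unitX ρ₁') 1))
    (b := Units.map φ.toMonoidHom (mapUnits (unitY c₁') 1))
    (c := Units.map φ.toMonoidHom (mapUnits 1 (unitX ρ₂')))
    (d := Units.map φ.toMonoidHom (mapUnits 1 (unitY c₂'))) h.ne_zero
    (algHom_rel φ (mapUnits_rel_left (unitX_mul_unitY c₁')))
    (algHom_rel φ (mapUnits_rel_right (unitX_mul_unitY c₂')))
    (hc _ _) (hc _ _) (hc _ _) (hc _ _) hcomm f₁ f₂ f₃ f₄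
  refine isIntertwiner_of_relations h hb (mul_ne_zero hx₁ hne) ?_ ?_ ?_ ?_ ?_ ?_ <;>
    simp only [triUnit_triangleRep_zero, triUnit_triangleRep_one]
  · have h₁ : (mapUnits (unitY c₁) (unitX ρ₂)).1 ^ N =
        (y₁ * x₂⁻¹ * y₂⁻¹ * (x₁ * x₂)) • (1 : Module.End ℂ (V₁ ⊗[ℂ] V₂)) := by
      simp only [mapUnits, unitY, unitX, TensorProduct.map_pow, p₃.2, p₄.1]
      rw [TensorProduct.map_smul_left, TensorProduct.map_smul_right, TensorProduct.map_one,
        smul_smul]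
    rw [h₁]
    nth_rewrite 1 [← one_smul ℂ (1 : Module.End ℂ (V₁ ⊗[ℂ] V₂))]
    rw [← add_smul]
    congr 1
    field_simp
  · rw [hYX, Units.val_mul]
    exact r₁
  · rw [hinv, Units.val_mul]
    exact r₂.symm
  · have h₁ : (mapUnits 1 (triUnit (triangleRep h.ne_zero ρ₂ c₂) 2)).1 =
        q • ((mapUnits (1 : (Module.End ℂ V₁)ˣ) (unitY c₂))⁻¹.1 * (mapUnits 1 (unitX ρ₂))⁻¹.1) := by
      rw [mapUnits_inv, mapUnits_inv, inv_one, ← Units.val_mul, ← mapUnits_mul, mul_one]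
      simp only [mapUnits, triUnit_triangleRep_two, TensorProduct.map_smul_right, Units.val_mul]
    have h₂ : (mapUnits 1 (triUnit (triangleRep h.ne_zero ρ₂' c₂') 2)).1 =
        q • ((mapUnits (1 : (Module.End ℂ V₁')ˣ) (unitY c₂'))⁻¹.1 *
          (mapUnits 1 (unitX ρ₂'))⁻¹.1) := by
      rw [mapUnits_inv, mapUnits_inv, inv_one, ← Units.val_mul, ← mapUnits_mul, mul_one]
      simp only [mapUnits, triUnit_triangleRep_two, TensorProduct.map_smul_right, Units.val_mul]
    rw [hYX, Units.val_mul, h₁, h₂, map_smul, map_mul]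
    exact r₃
  · have h₁ : (mapUnits (triUnit (triangleRep h.ne_zero ρ₁ c₁) 2) (1 : (Module.End ℂ V₂)ˣ)).1 =
        q • ((mapUnits (unitY c₁) 1)⁻¹.1 * (mapUnits (unitX ρ₁) 1)⁻¹.1) := by
      rw [mapUnits_inv, mapUnits_inv, inv_one, ← Units.val_mul, ← mapUnits_mul, mul_one]
      simp only [mapUnits, triUnit_triangleRep_two, TensorProduct.map_smul_left, Units.val_mul]
    rw [hinv, Units.val_mul, h₁]
    exact r₄.symm
  · have h₁ : (mapUnits (triUnit (triangleRep h.ne_zero ρ₁' c₁') 2) (unitY c₂')).1 =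
        q • ((mapUnits (unitY c₁') 1)⁻¹.1 * (mapUnits (unitX ρ₁') 1)⁻¹.1) *
          (mapUnits 1 (unitY c₂')).1 := by
      rw [mapUnits_inv, mapUnits_inv, inv_one, smul_mul_assoc, ← Units.val_mul, ← mapUnits_mul,
        ← Units.val_mul, mul_one, ← mapUnits_eq]
      simp only [mapUnits, triUnit_triangleRep_two, TensorProduct.map_smul_left, Units.val_mul]
    rw [hYX, Units.val_mul, h₁, map_mul, map_smul, map_mul]
    exact r₅

theorem IsIrred.triangleRep (hq : q ≠ 0) {ρ : Weyl q →ₐ[ℂ] Module.End ℂ V} (hρ : IsIrred ρ)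
    (hc : IsCyclic ρ) : IsIrred (triangleRep hq ρ hc) := by
  have := hc.finite
  refine ⟨hρ.1, fun p hp => hρ.gen p ?_ ?_⟩
  · intro v hv
    have := hp (Torus.X q triSigma 0) v hv
    rwa [← triUnit_val, triUnit_triangleRep_zero] at this
  · intro v hv
    have := hp (Torus.X q triSigma 1) v hv
    rwa [← triUnit_val, triUnit_triangleRep_one] at this

end FlipIntertwiner

/-! ### Irreducible representations of the triangle algebra -/

section Triangle

open SquareTriangulation

variable {N : ℕ} {q : ℂ} {V : Type*} [AddCommGroup V] [Module ℂ V]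
  {τ : TriangleAlg q →ₐ[ℂ] Module.End ℂ V}

theorem triUnit_rel (i j : Fin 3) : (triUnit τ i).1 * (triUnit τ j).1 =
    q ^ (2 * triSigma i j) • ((triUnit τ j).1 * (triUnit τ i).1) :=
  algHom_rel τ (Torus.X_mul_X i j)

/-- The third operator of an irreducible representation of the triangle algebra. -/
theorem IsIrred.exists_triUnit_two (hq : q ≠ 0) [FiniteDimensional ℂ V] (hτ : IsIrred τ) :
    ∃ c : ℂ, c ≠ 0 ∧ (triUnit τ 2).1 = c • ((triUnit τ 1)⁻¹.1 * (triUnit τ 0)⁻¹.1) := by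
  have := hτ.1
  -- ZXY comes from a central element, because each row of the commutation exponents adds up to 0;
  -- so it is a scalar by Schur's lemma.
  let T : (Module.End ℂ V)ˣ := triUnit τ 2 * (triUnit τ 0 * triUnit τ 1)
  have hT : ∀ i, Commute (triUnit τ i).1 T.1 := by
    intro i
    have h : ∀ {a b c d : Module.End ℂ V} {s t r : ℂ}, a * b = s • (b * a) → a * c = t • (c * a) →
        a * d = r • (d * a) → a * (b * (c * d)) = (s * (t * r)) • (b * (c * d) * a) := by
      intro a b c d s t r h₁ h₂ h₃
      rw [← mul_assoc, h₁, smul_mul_assoc, mul_assoc, ← mul_assoc a c, h₂, smul_mul_assoc,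
        mul_smul_comm, mul_assoc c, h₃, mul_smul_comm, mul_smul_comm, smul_smul, smul_smul]
      simp only [mul_assoc]
    have h₁ := h (triUnit_rel (τ := τ) i 2) (triUnit_rel (τ := τ) i 0) (triUnit_rel (τ := τ) i 1)
    have h₂ : q ^ (2 * triSigma i 2) * (q ^ (2 * triSigma i 0) * q ^ (2 * triSigma i 1)) = 1 := by
      rw [← zpow_add₀ hq, ← zpow_add₀ hq]
      have hσ : ∀ i : Fin 3, 2 * triSigma i 2 + (2 * triSigma i 0 + 2 * triSigma i 1) = 0 := by
        decide
      rw [hσ, zpow_zero]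
    rw [h₂, one_smul] at h₁
    exact h₁
  obtain ⟨c, hc⟩ := hτ.exists_eq_smul_one (T := T.1) fun a => by
    induction a using Torus.induction with
    | hc c => rw [AlgHom.commutes]; exact Algebra.commute_algebraMap_right c _
    | hX i => exact (hT i).symm
    | hXi i => exact ((hT i).units_inv_left (u := triUnit τ i)).symm
    | hm a b ha hb => rw [map_mul]; exact ha.mul_right hb
    | ha a b ha hb => rw [map_add]; exact ha.add_right hb
  refine ⟨c, ne_zero_of_isUnit_smul_one (hc ▸ T.isUnit), ?_⟩
  have h₁ : triUnit τ 2 = T * ((triUnit τ 1)⁻¹ * (triUnit τ 0)⁻¹) := by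
    simp only [T]
    group
  rw [h₁, Units.val_mul, hc, smul_mul_assoc, one_mul, Units.val_mul]

/-- The action of the Weyl algebra given by a representation of the triangle algebra, with `X` and
`Y` multiplied by scalars. -/
def weylOfTriangle (τ : TriangleAlg q →ₐ[ℂ] Module.End ℂ V) {s : ℂ} (hs : s ≠ 0) (t : ℂ) :
    Weyl q →ₐ[ℂ] Module.End ℂ V :=
  Weyl.lift (s • (triUnit τ 0).1) (s⁻¹ • (triUnit τ 0)⁻¹.1) (t • (triUnit τ 1).1)
    (by rw [smul_mul_assoc, mul_smul_comm, smul_smul, mul_inv_cancel₀ hs, one_smul, Units.mul_inv])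
    (by rw [smul_mul_assoc, mul_smul_comm, smul_smul, inv_mul_cancel₀ hs, one_smul, Units.inv_mul])
    (by
      have h : (triUnit τ 0).1 * (triUnit τ 1).1 =
          q ^ (2 : ℤ) • ((triUnit τ 1).1 * (triUnit τ 0).1) := triUnit_rel 0 1
      rw [smul_mul_assoc, mul_smul_comm, h, smul_mul_assoc, mul_smul_comm, zpow_ofNat]
      simp only [smul_smul]
      congr 1
      ring)

theorem weylOfTriangle_X {s : ℂ} (hs : s ≠ 0) (t : ℂ) :
    weylOfTriangle τ hs t (Weyl.X q) = s • (triUnit τ 0).1 := Weyl.lift_X ..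

theorem weylOfTriangle_Y {s : ℂ} (hs : s ≠ 0) (t : ℂ) :
    weylOfTriangle τ hs t (Weyl.Y q) = t • (triUnit τ 1).1 := Weyl.lift_Y ..

theorem weylOfTriangle_isCyclic [FiniteDimensional ℂ V] {s t : ℂ} (hs : s ≠ 0) (ht : t ≠ 0) :
    IsCyclic (weylOfTriangle τ hs t) :=
  ⟨inferInstance, Weyl.isUnit_map_X _, by
    rw [weylOfTriangle_Y]
    exact (triUnit τ 1).isUnit.smul (Units.mk0 t ht)⟩

/-- Z is a multiple of Y⁻¹X⁻¹, so a subspace stable under X and Y is stable under the whole triangle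
algebra. -/
theorem weylOfTriangle_isIrred (hq : q ≠ 0) [FiniteDimensional ℂ V] (hτ : IsIrred τ) {s t : ℂ}
    (hs : s ≠ 0) (ht : t ≠ 0) : IsIrred (weylOfTriangle τ hs t) := by
  have := hτ.1
  obtain ⟨c, -, hc⟩ := hτ.exists_triUnit_two hq
  refine IsIrred.of_gen fun p hX hY => ?_
  have hinv : ∀ i, (∀ v ∈ p, (triUnit τ i).1 v ∈ p) → ∀ v ∈ p, (triUnit τ i)⁻¹.1 v ∈ p := by
    intro i hi v hv
    refine mem_of_apply_mem (triUnit τ i).isUnit hi ?_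
    rwa [← Module.End.mul_apply, Units.mul_inv]
  have h0 : ∀ v ∈ p, (triUnit τ 0).1 v ∈ p := by
    intro v hv
    have := p.smul_mem s⁻¹ (hX v hv)
    rwa [weylOfTriangle_X, LinearMap.smul_apply, smul_smul, inv_mul_cancel₀ hs, one_smul] at this
  have h1 : ∀ v ∈ p, (triUnit τ 1).1 v ∈ p := by
    intro v hv
    have := p.smul_mem t⁻¹ (hY v hv)
    rwa [weylOfTriangle_Y, LinearMap.smul_apply, smul_smul, inv_mul_cancel₀ ht, one_smul] at this
  have h2 : ∀ v ∈ p, (triUnit τ 2).1 v ∈ p := by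
    intro v hv
    rw [hc]
    exact p.smul_mem c (hinv 1 h1 _ (hinv 0 h0 v hv))
  have hall : ∀ i, ∀ v ∈ p, (triUnit τ i).1 v ∈ p := by
    intro i
    fin_cases i
    exacts [h0, h1, h2]
  refine hτ.2 p fun a => ?_
  induction a using Torus.induction with
  | hc c => intro v hv; rw [AlgHom.commutes]; exact p.smul_mem c hv
  | hX i => exact hall i
  | hXi i => exact hinv i (hall i)
  | hm a b ha hb => intro v hv; rw [map_mul]; exact ha _ (hb _ hv)
  | ha a b ha hb => intro v hv; rw [map_add]; exact p.add_mem (ha _ hv) (hb _ hv)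

theorem weylOfTriangle_two {s t c : ℂ} (hs : s ≠ 0) (ht : t ≠ 0)
    (hc : (triUnit τ 2).1 = c • ((triUnit τ 1)⁻¹.1 * (triUnit τ 0)⁻¹.1)) (hst : s * t * c = q)
    (hcyc : IsCyclic (weylOfTriangle τ hs t)) :
    (triUnit τ 2).1 = q • ((unitY hcyc)⁻¹.1 * (unitX (weylOfTriangle τ hs t))⁻¹.1) := by
  have hX := units_inv_eq_of_smul (a := unitX (weylOfTriangle τ hs t)) (b := triUnit τ 0)
    (weylOfTriangle_X hs t) hs
  have hY := units_inv_eq_of_smul (a := unitY hcyc) (b := triUnit τ 1) (weylOfTriangle_Y hs t) ht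
  rw [hc, hX, hY, smul_mul_assoc, mul_smul_comm, smul_smul, smul_smul]
  congr 1
  rw [← hst]
  field_simp

end Triangle

/-! ### Intertwining operators are flips, for Weyl and for triangle representations -/

section LocalIff

variable {N : ℕ} {q : ℂ} {V₁ V₂ V₁' V₂' : Type u}
  [AddCommGroup V₁] [Module ℂ V₁] [AddCommGroup V₂] [Module ℂ V₂]
  [AddCommGroup V₁'] [Module ℂ V₁'] [AddCommGroup V₂'] [Module ℂ V₂']
  {ρ₁ : Weyl q →ₐ[ℂ] Module.End ℂ V₁} {ρ₂ : Weyl q →ₐ[ℂ] Module.End ℂ V₂}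
  {ρ₁' : Weyl q →ₐ[ℂ] Module.End ℂ V₁'} {ρ₂' : Weyl q →ₐ[ℂ] Module.End ℂ V₂'}
  {L : V₁ ⊗[ℂ] V₂ →ₗ[ℂ] V₁' ⊗[ℂ] V₂'}

theorem isWeylIntertwiner_iff_isFlip (h : IsQRoot N q) :
    IsWeylIntertwiner h ρ₁ ρ₂ ρ₁' ρ₂' L ↔ IsFlip ρ₁ ρ₂ ρ₁' ρ₂' L := by
  constructor
  · rintro ⟨i₁, i₂, i₁', i₂', c₁, c₂, c₁', c₂', hI⟩
    refine isFlip_of_isIntertwiner (s := 1) (t := 1) h i₁ i₂ i₁' i₂' c₁ c₂ c₁' c₂' ?_ ?_ ?_ ?_ ?_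
      ?_ ?_ ?_ ?_ ?_ hI
    all_goals
      simp only [one_smul, triUnit_triangleRep_zero, triUnit_triangleRep_one,
        triUnit_triangleRep_two]
      try rfl
  · intro hL
    exact ⟨hL.irred₁, hL.irred₂, hL.irred₁', hL.irred₂', hL.cyclic₁, hL.cyclic₂, hL.cyclic₁',
      hL.cyclic₂', hL.isWeylIntertwiner h⟩

theorem isLocalIntertwiner_iff_exists_isFlip (h : IsQRoot N q) :
    IsLocalIntertwiner h L ↔ ∃ (ρ₁ : Weyl q →ₐ[ℂ] Module.End ℂ V₁)
      (ρ₂ : Weyl q →ₐ[ℂ] Module.End ℂ V₂) (ρ₁' : Weyl q →ₐ[ℂ] Module.End ℂ V₁')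
      (ρ₂' : Weyl q →ₐ[ℂ] Module.End ℂ V₂'), IsFlip ρ₁ ρ₂ ρ₁' ρ₂' L := by
  constructor
  · rintro ⟨_, _, _, _, τ₁, τ₂, τ₁', τ₂', i₁, i₂, i₁', i₂', hI⟩
    have hq := h.ne_zero
    obtain ⟨c, hc0, hc⟩ := i₁.exists_triUnit_two hq
    obtain ⟨c', hc0', hc'⟩ := i₁'.exists_triUnit_two hq
    -- Z = qY⁻¹X⁻¹ requires s c = q on T₁ and s t c' = q on T₁', hence s = q/c and t = c/c'. On T₂
    -- and T₂' no normalization is needed: Z belongs there to the edge 23, whose relation does not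
    -- enter `flip_of_coord`.
    have hs : q / c ≠ 0 := div_ne_zero hq hc0
    have ht : c / c' ≠ 0 := div_ne_zero hc0 hc0'
    have h1 := one_ne_zero (α := ℂ)
    exact ⟨weylOfTriangle τ₁ hs 1, weylOfTriangle τ₂ h1 (c / c'), weylOfTriangle τ₁' hs (c / c'),
      weylOfTriangle τ₂' h1 1, isFlip_of_isIntertwiner (s := q / c) (t := c / c') h
        (weylOfTriangle_isIrred hq i₁ hs h1) (weylOfTriangle_isIrred hq i₂ h1 ht)
        (weylOfTriangle_isIrred hq i₁' hs ht) (weylOfTriangle_isIrred hq i₂' h1 h1)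
        (weylOfTriangle_isCyclic hs h1) (weylOfTriangle_isCyclic h1 ht)
        (weylOfTriangle_isCyclic hs ht) (weylOfTriangle_isCyclic h1 h1)
        (weylOfTriangle_X _ _) (by rw [weylOfTriangle_Y, one_smul])
        (weylOfTriangle_two hs h1 hc (by field_simp) _)
        (by rw [weylOfTriangle_X, one_smul]) (weylOfTriangle_Y _ _)
        (weylOfTriangle_X _ _) (weylOfTriangle_Y _ _)
        (weylOfTriangle_two hs ht hc' (by field_simp) _)
        (by rw [weylOfTriangle_X, one_smul]) (by rw [weylOfTriangle_Y, one_smul]) hI⟩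
  · rintro ⟨ρ₁, ρ₂, ρ₁', ρ₂', hL⟩
    have hq := h.ne_zero
    exact ⟨hL.cyclic₁.finite, hL.cyclic₂.finite, hL.cyclic₁'.finite, hL.cyclic₂'.finite, _, _, _, _,
      hL.irred₁.triangleRep hq _, hL.irred₂.triangleRep hq _, hL.irred₁'.triangleRep hq _,
      hL.irred₂'.triangleRep hq _, hL.isWeylIntertwiner h⟩

end LocalIff

/-! ### The two sides of the five-term relation -/

section SixJ

variable {N : ℕ} {q : ℂ} {Vμ Vν Vσ Vμν Vνσ Vμνσ : Type*}
  [AddCommGroup Vμ] [Module ℂ Vμ] [AddCommGroup Vν] [Module ℂ Vν] [AddCommGroup Vσ] [Module ℂ Vσ]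
  [AddCommGroup Vμν] [Module ℂ Vμν] [AddCommGroup Vνσ] [Module ℂ Vνσ]
  [AddCommGroup Vμνσ] [Module ℂ Vμνσ]

section Maps

variable (μ : Weyl q →ₐ[ℂ] Module.End ℂ Vμ) (ν : Weyl q →ₐ[ℂ] Module.End ℂ Vν)
  (σ : Weyl q →ₐ[ℂ] Module.End ℂ Vσ) (μν : Weyl q →ₐ[ℂ] Module.End ℂ Vμν)
  (νσ : Weyl q →ₐ[ℂ] Module.End ℂ Vνσ) (μνσ : Weyl q →ₐ[ℂ] Module.End ℂ Vμνσ)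

/-- `Ω₁₂(μ,ν) Ω₂₃(μν,σ)`. -/
def fiveTermRight : (cgSpace μ ν μν ⊗[ℂ] cgSpace μν σ μνσ) ⊗[ℂ] Vμνσ →ₗ[ℂ]
    Vμ ⊗[ℂ] (Vν ⊗[ℂ] Vσ) :=
  (TensorProduct.assoc ℂ Vμ Vν Vσ).toLinearMap ∘ₗ (canonicalMap μ ν μν).rTensor Vσ ∘ₗ
    (TensorProduct.assoc ℂ (cgSpace μ ν μν) Vμν Vσ).symm.toLinearMap ∘ₗ
    (canonicalMap μν σ μνσ).lTensor (cgSpace μ ν μν) ∘ₗ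
    (TensorProduct.assoc ℂ (cgSpace μ ν μν) (cgSpace μν σ μνσ) Vμνσ).toLinearMap

/-- `Ω₂₃(ν,σ) Ω₁₃(μ,νσ)`. -/
def fiveTermLeft : (cgSpace μ νσ μνσ ⊗[ℂ] cgSpace ν σ νσ) ⊗[ℂ] Vμνσ →ₗ[ℂ]
    Vμ ⊗[ℂ] (Vν ⊗[ℂ] Vσ) :=
  (canonicalMap ν σ νσ).lTensor Vμ ∘ₗ
    (TensorProduct.comm ℂ Vνσ (cgSpace ν σ νσ)).toLinearMap.lTensor Vμ ∘ₗ
    (TensorProduct.assoc ℂ Vμ Vνσ (cgSpace ν σ νσ)).toLinearMap ∘ₗ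
    (canonicalMap μ νσ μνσ).rTensor (cgSpace ν σ νσ) ∘ₗ
    (TensorProduct.rightComm ℂ (cgSpace μ νσ μνσ) (cgSpace ν σ νσ) Vμνσ).toLinearMap

variable {μ ν σ μν νσ μνσ}

theorem isSixJ_iff
    {R : cgSpace μ ν μν ⊗[ℂ] cgSpace μν σ μνσ →ₗ[ℂ] cgSpace μ νσ μνσ ⊗[ℂ] cgSpace ν σ νσ} :
    IsSixJ μ ν σ μν νσ μνσ R ↔
      fiveTermLeft μ ν σ νσ μνσ ∘ₗ R.rTensor Vμνσ = fiveTermRight μ ν σ μν μνσ := Iff.rfl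

theorem lTensor_bijective {V W : Type*} [AddCommGroup V] [Module ℂ V] [AddCommGroup W] [Module ℂ W]
    (U : Type*) [AddCommGroup U] [Module ℂ U] {f : V →ₗ[ℂ] W} (hf : Function.Bijective f) :
    Function.Bijective (f.lTensor U) :=
  (LinearEquiv.lTensor U (LinearEquiv.ofBijective f hf)).bijective

theorem rTensor_bijective {V W : Type*} [AddCommGroup V] [Module ℂ V] [AddCommGroup W] [Module ℂ W]
    (U : Type*) [AddCommGroup U] [Module ℂ U] {f : V →ₗ[ℂ] W} (hf : Function.Bijective f) :
    Function.Bijective (f.rTensor U) :=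
  (LinearEquiv.rTensor U (LinearEquiv.ofBijective f hf)).bijective

theorem fiveTermRight_bijective (h₁ : Function.Bijective (canonicalMap μ ν μν))
    (h₂ : Function.Bijective (canonicalMap μν σ μνσ)) :
    Function.Bijective (fiveTermRight μ ν σ μν μνσ) :=
  (TensorProduct.assoc ℂ Vμ Vν Vσ).bijective.comp ((rTensor_bijective Vσ h₁).comp
    ((TensorProduct.assoc ℂ (cgSpace μ ν μν) Vμν Vσ).symm.bijective.comp
    ((lTensor_bijective (cgSpace μ ν μν) h₂).comp
    (TensorProduct.assoc ℂ (cgSpace μ ν μν) (cgSpace μν σ μνσ) Vμνσ).bijective)))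

theorem fiveTermLeft_bijective (h₁ : Function.Bijective (canonicalMap μ νσ μνσ))
    (h₂ : Function.Bijective (canonicalMap ν σ νσ)) :
    Function.Bijective (fiveTermLeft μ ν σ νσ μνσ) :=
  (lTensor_bijective Vμ h₂).comp
    ((lTensor_bijective Vμ (f := (TensorProduct.comm ℂ Vνσ (cgSpace ν σ νσ)).toLinearMap)
      (TensorProduct.comm ℂ Vνσ (cgSpace ν σ νσ)).bijective).comp
    ((TensorProduct.assoc ℂ Vμ Vνσ (cgSpace ν σ νσ)).bijective.comp
    ((rTensor_bijective (cgSpace ν σ νσ) h₁).comp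
    (TensorProduct.rightComm ℂ (cgSpace μ νσ μνσ) (cgSpace ν σ νσ) Vμνσ).bijective)))

theorem intertwines_assoc_symm {V W U : Type*} [AddCommGroup V] [Module ℂ V] [AddCommGroup W]
    [Module ℂ W] [AddCommGroup U] [Module ℂ U] (A : Module.End ℂ V) (B : Module.End ℂ W)
    (C : Module.End ℂ U) : Intertwines (TensorProduct.assoc ℂ V W U).symm.toLinearMap
      (TensorProduct.map A (TensorProduct.map B C))
      (TensorProduct.map (TensorProduct.map A B) C) :=
  (intertwines_assoc A B C).symm

theorem intertwines_id {V : Type*} [AddCommGroup V] [Module ℂ V] (A : Module.End ℂ V) :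
    Intertwines LinearMap.id A A := rfl

/-- The last steps of the right hand side, for an operator on the second and third factor. -/
theorem intertwines_right_aux (w : Weyl q) (C : Module.End ℂ Vσ) :
    Intertwines ((canonicalMap μ ν μν).rTensor Vσ ∘ₗ
      (TensorProduct.assoc ℂ (cgSpace μ ν μν) Vμν Vσ).symm.toLinearMap)
      (TensorProduct.map 1 (TensorProduct.map (μν w) C))
      (TensorProduct.map (tensorRep μ ν w) C) :=
  ((canonicalMap_snd w).tensor (intertwines_id C)).comp (intertwines_assoc_symm _ _ _)

/-- An operator on V_(μ,ν) passes through Ω(μν,σ) unchanged and is affected only by Ω(μ,ν). -/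
theorem intertwines_right_fst {T : Module.End ℂ (cgSpace μ ν μν)}
    {S : Module.End ℂ (Vμ ⊗[ℂ] Vν)} {S' : Module.End ℂ (Vμ ⊗[ℂ] (Vν ⊗[ℂ] Vσ))}
    (hT : Intertwines (canonicalMap μ ν μν) (TensorProduct.map T 1) S)
    (hS : Intertwines (TensorProduct.assoc ℂ Vμ Vν Vσ).toLinearMap (TensorProduct.map S 1) S') :
    Intertwines (fiveTermRight μ ν σ μν μνσ) (TensorProduct.map (TensorProduct.map T 1) 1) S' := by
  have h₁ := intertwines_assoc T (1 : Module.End ℂ (cgSpace μν σ μνσ)) (1 : Module.End ℂ Vμνσ)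
  have h₂ : Intertwines ((canonicalMap μν σ μνσ).lTensor (cgSpace μ ν μν))
      (TensorProduct.map T (TensorProduct.map 1 1)) (TensorProduct.map T (TensorProduct.map 1 1)) := by
    rw [TensorProduct.map_one, TensorProduct.map_one]
    exact (intertwines_id T).tensor Intertwines.one
  have h₃ := intertwines_assoc_symm T (1 : Module.End ℂ Vμν) (1 : Module.End ℂ Vσ)
  exact hS.comp ((hT.tensor (intertwines_id 1)).comp (h₃.comp (h₂.comp h₁)))

theorem intertwines_right {T : Module.End ℂ (cgSpace μν σ μνσ)} {W : Module.End ℂ Vμνσ}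
    {S : Module.End ℂ (Vμν ⊗[ℂ] Vσ)} {S' : Module.End ℂ ((Vμ ⊗[ℂ] Vν) ⊗[ℂ] Vσ)}
    {S'' : Module.End ℂ (Vμ ⊗[ℂ] (Vν ⊗[ℂ] Vσ))}
    (hT : Intertwines (canonicalMap μν σ μνσ) (TensorProduct.map T W) S)
    (hS : Intertwines ((canonicalMap μ ν μν).rTensor Vσ ∘ₗ
      (TensorProduct.assoc ℂ (cgSpace μ ν μν) Vμν Vσ).symm.toLinearMap)
      (TensorProduct.map 1 S) S')
    (hS' : Intertwines (TensorProduct.assoc ℂ Vμ Vν Vσ).toLinearMap S' S'') :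
    Intertwines (fiveTermRight μ ν σ μν μνσ) (TensorProduct.map (TensorProduct.map 1 T) W) S'' :=
  hS'.comp (hS.comp (((intertwines_id 1).tensor hT).comp (intertwines_assoc _ _ _)))

theorem intertwines_left_aux (A : Module.End ℂ Vμ) {B : Module.End ℂ Vνσ}
    {U : Module.End ℂ (cgSpace ν σ νσ)} {S : Module.End ℂ (Vν ⊗[ℂ] Vσ)}
    (hS : Intertwines (canonicalMap ν σ νσ) (TensorProduct.map U B) S) :
    Intertwines ((canonicalMap ν σ νσ).lTensor Vμ ∘ₗ
      (TensorProduct.comm ℂ Vνσ (cgSpace ν σ νσ)).toLinearMap.lTensor Vμ ∘ₗ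
      (TensorProduct.assoc ℂ Vμ Vνσ (cgSpace ν σ νσ)).toLinearMap)
      (TensorProduct.map (TensorProduct.map A B) U) (TensorProduct.map A S) :=
  ((intertwines_id A).tensor hS).comp
    (((intertwines_id A).tensor (intertwines_comm B U)).comp (intertwines_assoc A B U))

theorem intertwines_left {T : Module.End ℂ (cgSpace μ νσ μνσ)} {U : Module.End ℂ (cgSpace ν σ νσ)}
    {W : Module.End ℂ Vμνσ} {S : Module.End ℂ (Vμ ⊗[ℂ] Vνσ)}
    {S' : Module.End ℂ (Vμ ⊗[ℂ] (Vν ⊗[ℂ] Vσ))}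
    (hT : Intertwines (canonicalMap μ νσ μνσ) (TensorProduct.map T W) S)
    (hS : Intertwines ((canonicalMap ν σ νσ).lTensor Vμ ∘ₗ
      (TensorProduct.comm ℂ Vνσ (cgSpace ν σ νσ)).toLinearMap.lTensor Vμ ∘ₗ
      (TensorProduct.assoc ℂ Vμ Vνσ (cgSpace ν σ νσ)).toLinearMap)
      (TensorProduct.map S U) S') :
    Intertwines (fiveTermLeft μ ν σ νσ μνσ) (TensorProduct.map (TensorProduct.map T U) W) S' :=
  hS.comp ((hT.tensor (intertwines_id U)).comp (intertwines_rightComm T U W))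

/-- Coassociativity of Δ, checked on X and Y. -/
theorem tensorRep_assoc (w : Weyl q) :
    Intertwines (TensorProduct.assoc ℂ Vμ Vν Vσ).toLinearMap
      (tensorRep (tensorRep μ ν) σ w) (tensorRep μ (tensorRep ν σ) w) := by
  refine Weyl.intertwines_of_gen ?_ ?_ w
  · simp only [tensorRep_X]
    exact intertwines_assoc _ _ _
  · rw [tensorRep_Y (tensorRep μ ν) σ, tensorRep_Y μ (tensorRep ν σ), tensorRep_Y μ ν,
      tensorRep_Y ν σ, tensorRep_Xinv, TensorProduct.map_add_left,
      TensorProduct.map_add_right, ← add_assoc]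
    refine ((intertwines_assoc _ _ _).add (intertwines_assoc _ _ _)).add ?_
    have := intertwines_assoc (μ (Weyl.Y q)) (1 : Module.End ℂ Vν) (1 : Module.End ℂ Vσ)
    rwa [TensorProduct.map_one (M := Vν)] at this

/-- Both sides of the five-term relation are equivariant from V_μνσ to the triple tensor product.
This is what makes Schur's lemma produce the `6j`-symbol. -/
theorem fiveTermRight_thd (w : Weyl q) :
    Intertwines (fiveTermRight μ ν σ μν μνσ) (TensorProduct.map 1 (μνσ w))
      (tensorRep μ (tensorRep ν σ) w) := by
  have h := intertwines_right (μ := μ) (ν := ν) (T := 1) (canonicalMap_snd (μ := μν) (ν := σ) (κ := μνσ) w)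
    (S' := tensorRep (tensorRep μ ν) σ w) ?_ (tensorRep_assoc w)
  · rwa [TensorProduct.map_one] at h
  · refine Weyl.intertwines_of_gen
      (μ := (Module.End.lTensorAlgHom ℂ (Vμν ⊗[ℂ] Vσ) (cgSpace μ ν μν)).comp (tensorRep μν σ))
      (μ' := tensorRep (tensorRep μ ν) σ) ?_ ?_ w
    · change Intertwines _ (TensorProduct.map (1 : Module.End ℂ (cgSpace μ ν μν))
        (tensorRep μν σ (Weyl.X q))) _
      rw [tensorRep_X, tensorRep_X (tensorRep μ ν)]
      exact intertwines_right_aux _ _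
    · change Intertwines _ (TensorProduct.map (1 : Module.End ℂ (cgSpace μ ν μν))
        (tensorRep μν σ (Weyl.Y q))) _
      rw [tensorRep_Y, tensorRep_Y (tensorRep μ ν), TensorProduct.map_add_right]
      exact (intertwines_right_aux _ _).add (intertwines_right_aux _ _)

theorem fiveTermLeft_thd (w : Weyl q) :
    Intertwines (fiveTermLeft μ ν σ νσ μνσ) (TensorProduct.map 1 (μνσ w))
      (tensorRep μ (tensorRep ν σ) w) := by
  have h := intertwines_left (ν := ν) (σ := σ) (T := 1) (U := 1) (canonicalMap_snd (μ := μ) (ν := νσ) (κ := μνσ) w)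
    (S' := tensorRep μ (tensorRep ν σ) w) ?_
  · rwa [TensorProduct.map_one] at h
  · refine Weyl.intertwines_of_gen
      (μ := (Module.End.rTensorAlgHom ℂ (Vμ ⊗[ℂ] Vνσ) (cgSpace ν σ νσ)).comp (tensorRep μ νσ))
      (μ' := tensorRep μ (tensorRep ν σ)) ?_ ?_ w
    · change Intertwines _ (TensorProduct.map (tensorRep μ νσ (Weyl.X q)) 1) _
      rw [tensorRep_X, tensorRep_X μ]
      exact intertwines_left_aux _ (canonicalMap_snd _)
    · change Intertwines _ (TensorProduct.map (tensorRep μ νσ (Weyl.Y q)) 1) _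
      rw [tensorRep_Y, tensorRep_Y μ, TensorProduct.map_add_left]
      refine (intertwines_left_aux _ (canonicalMap_snd _)).add (intertwines_left_aux _ ?_)
      rw [TensorProduct.map_one]
      exact Intertwines.one

end Maps

/-! ### Identities for the operators of a tensor product of two cyclic representations -/

section Identities

variable {ν : Weyl q →ₐ[ℂ] Module.End ℂ Vν} {σ : Weyl q →ₐ[ℂ] Module.End ℂ Vσ}

/-- This identity and the next one match the action on V_(μν,σ) with Δ(X⁻¹) and Δ(Y) on V_(μ,νσ) ⊗
V_(ν,σ). The last two of this section match the action on V_(μ,ν) with the two operators in the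
definition of a flip. -/
theorem inverse_tensorRep_Y_mul_cgOpX (h : IsRegularPair ν σ) :
    Ring.inverse (tensorRep ν σ (Weyl.Y q)) * cgOpX ν σ =
      TensorProduct.map 1 (Ring.inverse (σ (Weyl.Y q))) := by
  rw [cgOpX_eq ν σ h, ← mul_assoc, Ring.inverse_mul_cancel _ h.tensor.isUnit_Y, one_mul]

theorem inverse_tensorRep_Y_mul_cgOpY (h : IsRegularPair ν σ) :
    Ring.inverse (tensorRep ν σ (Weyl.Y q)) * cgOpY ν σ + q⁻¹ •
      (tensorRep ν σ (Weyl.Xinv q) * Ring.inverse (tensorRep ν σ (Weyl.Y q))) =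
    q⁻¹ • TensorProduct.map 1 (σ (Weyl.Xinv q) * Ring.inverse (σ (Weyl.Y q))) := by
  have hu := h.tensor.isUnit_Y
  refine hu.mul_left_cancel ?_
  rw [mul_add, ← mul_assoc, Ring.mul_inverse_cancel _ hu, one_mul, mul_smul_comm, ← mul_assoc,
    rep_Y_Xinv, smul_mul_assoc, mul_assoc, Ring.mul_inverse_cancel _ hu, mul_one, mul_smul_comm,
    tensorRep_Y, tensorRep_Xinv, add_mul, ← TensorProduct.map_mul, ← TensorProduct.map_mul,
    ← mul_assoc, rep_Y_Xinv σ, smul_mul_assoc, mul_assoc, Ring.mul_inverse_cancel _ h.right.isUnit_Y,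
    mul_one, mul_one, one_mul, TensorProduct.map_smul_right, smul_add, mul_one, cgOpY, add_comm]

theorem map_inverse_Y_mul_cgOpY (h : IsRegularPair ν σ) :
    TensorProduct.map (Ring.inverse (ν (Weyl.Y q))) 1 * cgOpY ν σ =
      q⁻¹ • TensorProduct.map 1 (σ (Weyl.Xinv q) * Ring.inverse (σ (Weyl.Y q))) := by
  rw [cgOpY, mul_smul_comm, ← TensorProduct.map_mul, Ring.inverse_mul_cancel _ h.left.isUnit_Y,
    one_mul]

theorem inverse_tensorRep_Y_add (hq : q ≠ 0) (h : IsRegularPair ν σ) :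
    Ring.inverse (tensorRep ν σ (Weyl.Y q)) + q⁻¹ •
      (tensorRep ν σ (Weyl.Xinv q) * Ring.inverse (tensorRep ν σ (Weyl.Y q)) *
        Ring.inverse (cgOpY ν σ)) = TensorProduct.map (Ring.inverse (ν (Weyl.Y q))) 1 := by
  have hH := isUnit_cgOpY hq h.left h.right
  refine hH.mul_right_cancel ?_
  rw [add_mul, smul_mul_assoc, mul_assoc _ (Ring.inverse (cgOpY ν σ)),
    Ring.inverse_mul_cancel _ hH, mul_one, inverse_tensorRep_Y_mul_cgOpY h,
    map_inverse_Y_mul_cgOpY h]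

theorem tensorRep_Xinv_mul_inverse (hq : q ≠ 0) (h : IsRegularPair ν σ) :
    q⁻¹ • (tensorRep ν σ (Weyl.Xinv q) * Ring.inverse (tensorRep ν σ (Weyl.Y q)) *
      (cgOpX ν σ * Ring.inverse (cgOpY ν σ))) =
    TensorProduct.map (ν (Weyl.Xinv q) * Ring.inverse (ν (Weyl.Y q))) 1 := by
  have hH := isUnit_cgOpY hq h.left h.right
  refine hH.mul_right_cancel ?_
  rw [smul_mul_assoc, mul_assoc, mul_assoc (cgOpX ν σ), Ring.inverse_mul_cancel _ hH, mul_one,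
    mul_assoc, inverse_tensorRep_Y_mul_cgOpX h, tensorRep_Xinv, ← TensorProduct.map_mul, mul_one,
    cgOpY, mul_smul_comm, ← TensorProduct.map_mul, mul_assoc (ν (Weyl.Xinv q)),
    Ring.inverse_mul_cancel _ h.left.isUnit_Y, mul_one, one_mul]

end Identities

variable {μ : Weyl q →ₐ[ℂ] Module.End ℂ Vμ} {ν : Weyl q →ₐ[ℂ] Module.End ℂ Vν}
  {σ : Weyl q →ₐ[ℂ] Module.End ℂ Vσ} {μν : Weyl q →ₐ[ℂ] Module.End ℂ Vμν}
  {νσ : Weyl q →ₐ[ℂ] Module.End ℂ Vνσ} {μνσ : Weyl q →ₐ[ℂ] Module.End ℂ Vμνσ}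
  {h₁ : IsRegularPair μ ν} {h₂ : IsRegularPair μν σ}
  {h₃ : IsRegularPair μ νσ} {h₄ : IsRegularPair ν σ}

theorem fiveTermRight_fst_Xinv : Intertwines (fiveTermRight μ ν σ μν μνσ)
    (TensorProduct.map (TensorProduct.map (cgRep μν h₁ (Weyl.Xinv q)) 1) 1)
    (TensorProduct.map (μ (Weyl.Xinv q)) 1 + TensorProduct.map (μ (Weyl.Y q))
      (TensorProduct.map (Ring.inverse (ν (Weyl.Y q))) 1)) := by
  refine intertwines_right_fst (canonicalMap_Xinv h₁) ?_
  rw [cgOpX, TensorProduct.map_add_left]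
  refine Intertwines.add ?_ (intertwines_assoc _ _ _)
  have := intertwines_assoc (μ (Weyl.Xinv q)) (1 : Module.End ℂ Vν) (1 : Module.End ℂ Vσ)
  rwa [TensorProduct.map_one (M := Vν)] at this

theorem fiveTermRight_fst_Y : Intertwines (fiveTermRight μ ν σ μν μνσ)
    (TensorProduct.map (TensorProduct.map (cgRep μν h₁ (Weyl.Y q)) 1) 1)
    (q⁻¹ • TensorProduct.map (μ (Weyl.Y q))
      (TensorProduct.map (ν (Weyl.Xinv q) * Ring.inverse (ν (Weyl.Y q))) 1)) := by
  refine intertwines_right_fst (canonicalMap_Y h₁) ?_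
  rw [cgOpY, TensorProduct.map_smul_left]
  exact (intertwines_assoc _ _ _).smul _

theorem fiveTermRight_snd_Xinv : Intertwines (fiveTermRight μ ν σ μν μνσ)
    (TensorProduct.map (TensorProduct.map 1 (cgRep μνσ h₂ (Weyl.Xinv q))) 1)
    (TensorProduct.map (μ (Weyl.Xinv q)) (cgOpX ν σ) + TensorProduct.map (μ (Weyl.Y q))
      (TensorProduct.map 1 (Ring.inverse (σ (Weyl.Y q))))) := by
  refine intertwines_right (canonicalMap_Xinv h₂)
    (S' := TensorProduct.map (tensorRep μ ν (Weyl.Xinv q)) 1 +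
      TensorProduct.map (tensorRep μ ν (Weyl.Y q)) (Ring.inverse (σ (Weyl.Y q)))) ?_ ?_
  · rw [cgOpX, TensorProduct.map_add_right]
    exact (intertwines_right_aux _ _).add (intertwines_right_aux _ _)
  · rw [tensorRep_Xinv, tensorRep_Y, TensorProduct.map_add_left, cgOpX,
      TensorProduct.map_add_right, ← add_assoc]
    exact ((intertwines_assoc _ _ _).add (intertwines_assoc _ _ _)).add (intertwines_assoc _ _ _)

theorem fiveTermRight_snd_Y : Intertwines (fiveTermRight μ ν σ μν μνσ)
    (TensorProduct.map (TensorProduct.map 1 (cgRep μνσ h₂ (Weyl.Y q))) 1)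
    (TensorProduct.map (μ (Weyl.Xinv q)) (cgOpY ν σ) + TensorProduct.map (μ (Weyl.Y q))
      (q⁻¹ • TensorProduct.map 1 (σ (Weyl.Xinv q) * Ring.inverse (σ (Weyl.Y q))))) := by
  refine intertwines_right (canonicalMap_Y h₂)
    (S' := q⁻¹ • TensorProduct.map (tensorRep μ ν (Weyl.Y q))
      (σ (Weyl.Xinv q) * Ring.inverse (σ (Weyl.Y q)))) ?_ ?_
  · rw [cgOpY, TensorProduct.map_smul_right]
    exact (intertwines_right_aux _ _).smul _
  · rw [tensorRep_Y, TensorProduct.map_add_left, cgOpY, TensorProduct.map_smul_right,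
      TensorProduct.map_smul_right, smul_add]
    exact ((intertwines_assoc _ _ _).smul _).add ((intertwines_assoc _ _ _).smul _)

theorem canonicalMap_inverse_Y (h : IsRegularPair ν σ) (hc : IsCyclic νσ) :
    Intertwines (canonicalMap ν σ νσ) (TensorProduct.map 1 (Ring.inverse (νσ (Weyl.Y q))))
      (Ring.inverse (tensorRep ν σ (Weyl.Y q))) := by
  refine (canonicalMap_snd (Weyl.Y q)).of_mul_eq_one ?_
    (Ring.inverse_mul_cancel _ h.tensor.isUnit_Y)
  rw [← TensorProduct.map_mul, Ring.mul_inverse_cancel _ hc.isUnit_Y, mul_one,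
    TensorProduct.map_one]

/-- Ω(μ,νσ) produces operators of μ and νσ, and Ω(ν,σ) then converts the action νσ into the tensor
product action on V_ν ⊗ V_σ. -/
theorem fiveTermLeft_fst_Xinv (h : IsRegularPair ν σ) :
    Intertwines (fiveTermLeft μ ν σ νσ μνσ)
      (TensorProduct.map (TensorProduct.map (cgRep μνσ h₃ (Weyl.Xinv q)) 1) 1)
      (TensorProduct.map (μ (Weyl.Xinv q)) 1 + TensorProduct.map (μ (Weyl.Y q))
        (Ring.inverse (tensorRep ν σ (Weyl.Y q)))) := by
  refine intertwines_left (canonicalMap_Xinv h₃) ?_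
  rw [cgOpX, TensorProduct.map_add_left]
  refine (intertwines_left_aux _ ?_).add
    (intertwines_left_aux _ (canonicalMap_inverse_Y h h₃.right))
  rw [TensorProduct.map_one]
  exact Intertwines.one

theorem fiveTermLeft_fst_Y (h : IsRegularPair ν σ) :
    Intertwines (fiveTermLeft μ ν σ νσ μνσ)
      (TensorProduct.map (TensorProduct.map (cgRep μνσ h₃ (Weyl.Y q)) 1) 1)
      (q⁻¹ • TensorProduct.map (μ (Weyl.Y q))
        (tensorRep ν σ (Weyl.Xinv q) * Ring.inverse (tensorRep ν σ (Weyl.Y q)))) := by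
  refine intertwines_left (canonicalMap_Y h₃) ?_
  rw [cgOpY, TensorProduct.map_smul_left]
  refine (intertwines_left_aux _ ?_).smul _
  have := (canonicalMap_snd (μ := ν) (ν := σ) (κ := νσ) (Weyl.Xinv q)).mul
    (canonicalMap_inverse_Y h h₃.right)
  rwa [← TensorProduct.map_mul, mul_one] at this

theorem fiveTermLeft_snd {U : Module.End ℂ (cgSpace ν σ νσ)} {S : Module.End ℂ (Vν ⊗[ℂ] Vσ)}
    (hU : Intertwines (canonicalMap ν σ νσ) (TensorProduct.map U 1) S) :
    Intertwines (fiveTermLeft μ ν σ νσ μνσ) (TensorProduct.map (TensorProduct.map 1 U) 1)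
      (TensorProduct.map 1 S) := by
  refine intertwines_left (S := TensorProduct.map 1 1) ?_ (intertwines_left_aux _ hU)
  rw [TensorProduct.map_one, TensorProduct.map_one]
  exact Intertwines.one

/-- Since K = M ∘ (R ⊗ 1), the maps RA ⊗ 1 and A'R ⊗ 1 agree after the injective map M, and a
nonzero tensor factor can be dropped. Every relation for a `6j`-symbol is thereby reduced to an
identity of operators on V_μ ⊗ V_ν ⊗ V_σ. -/
theorem intertwines_of_fiveTerm {V V' U T : Type*} [AddCommGroup V] [Module ℂ V]
    [AddCommGroup V'] [Module ℂ V'] [AddCommGroup U] [Module ℂ U] [AddCommGroup T] [Module ℂ T]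
    [Nontrivial U] {R : V →ₗ[ℂ] V'} {M : V' ⊗[ℂ] U →ₗ[ℂ] T} {K : V ⊗[ℂ] U →ₗ[ℂ] T}
    (hM : Function.Injective M) (hR : M ∘ₗ R.rTensor U = K) {A : Module.End ℂ V}
    {A' : Module.End ℂ V'} {B : Module.End ℂ T} (hK : Intertwines K (TensorProduct.map A 1) B)
    (hM' : Intertwines M (TensorProduct.map A' 1) B) : Intertwines R A A' := by
  refine eq_of_rTensor_eq (V := U) (TensorProduct.ext' fun v u => hM ?_)
  have e₁ := hK.apply (v ⊗ₜ u)
  have e₂ := hM'.apply (R v ⊗ₜ u)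
  rw [← hR] at e₁
  simp only [LinearMap.comp_apply, LinearMap.rTensor_tmul, TensorProduct.map_tmul,
    Module.End.one_apply] at e₁ e₂ ⊢
  rw [e₁, ← e₂]

theorem map_one_right_mul {V U : Type*} [AddCommGroup V] [Module ℂ V] [AddCommGroup U] [Module ℂ U]
    (A B : Module.End ℂ V) : TensorProduct.map (A * B) (1 : Module.End ℂ U) =
      TensorProduct.map A 1 * TensorProduct.map B 1 := by
  rw [← TensorProduct.map_mul, mul_one]

theorem map_eq_mul {V U : Type*} [AddCommGroup V] [Module ℂ V] [AddCommGroup U] [Module ℂ U]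
    (A : Module.End ℂ V) (B : Module.End ℂ U) : TensorProduct.map A B =
      TensorProduct.map A 1 * TensorProduct.map 1 B := by
  rw [← TensorProduct.map_mul, mul_one, one_mul]

/-- Kashaev's `6j`-symbol is a flip. -/
theorem isFlip_of_isSixJ (h : IsQRoot N q) (iμ : IsIrred μ) (iν : IsIrred ν) (iσ : IsIrred σ)
    (p₁ : IsProductRep N μ ν μν) (p₂ : IsProductRep N μν σ μνσ) (p₃ : IsProductRep N μ νσ μνσ)
    (p₄ : IsProductRep N ν σ νσ)
    {R : cgSpace μ ν μν ⊗[ℂ] cgSpace μν σ μνσ →ₗ[ℂ] cgSpace μ νσ μνσ ⊗[ℂ] cgSpace ν σ νσ}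
    (hR : IsSixJ μ ν σ μν νσ μνσ R) :
    IsFlip (cgRep μν h₁) (cgRep μνσ h₂) (cgRep μνσ h₃) (cgRep νσ h₄) R := by
  have hq := h.ne_zero
  have i₁ := cgRep_isIrred h h₁ iμ iν p₁
  have i₂ := cgRep_isIrred h h₂ p₁.irred iσ p₂
  have i₁' := cgRep_isIrred h h₃ iμ p₄.irred p₃
  have i₂' := cgRep_isIrred h h₄ iν iσ p₄
  have c₁ := cgRep_isCyclic hq h₁ p₁.cyclic
  have c₂ := cgRep_isCyclic hq h₂ p₂.cyclic
  have c₁' := cgRep_isCyclic hq h₃ p₃.cyclic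
  have c₂' := cgRep_isCyclic hq h₄ p₄.cyclic
  have := c₁.finite
  have := c₂.finite
  have := c₁'.finite
  have := c₂'.finite
  have := p₂.irred.1
  rw [isSixJ_iff] at hR
  have hM := fiveTermLeft_bijective (canonicalMap_bijective h h₃ iμ p₃)
    (canonicalMap_bijective h h₄ iν p₄)
  have hK := fiveTermRight_bijective (canonicalMap_bijective h h₁ iμ p₁)
    (canonicalMap_bijective h h₂ p₁.irred p₂)
  have key := fun {A A' B} => intertwines_of_fiveTerm (A := A) (A' := A') (B := B) hM.1 hR
  have mX := fiveTermLeft_fst_Xinv (h₃ := h₃) (μνσ := μνσ) h₄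
  have mY := fiveTermLeft_fst_Y (h₃ := h₃) (μνσ := μνσ) h₄
  have mX₂ := fiveTermLeft_snd (μ := μ) (μνσ := μνσ) (canonicalMap_Xinv (κ := νσ) h₄)
  have mY₂ := fiveTermLeft_snd (μ := μ) (μνσ := μνσ) (canonicalMap_Y (κ := νσ) h₄)
  have hH := isUnit_cgOpY hq h₄.left h₄.right
  have mYi : Intertwines (fiveTermLeft μ ν σ νσ μνσ)
      (TensorProduct.map (TensorProduct.map 1 (Ring.inverse (cgRep νσ h₄ (Weyl.Y q)))) 1)
      (TensorProduct.map 1 (Ring.inverse (cgOpY ν σ))) := by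
    refine mY₂.of_mul_eq_one ?_ ?_
    · rw [← TensorProduct.map_mul, ← TensorProduct.map_mul,
        Ring.mul_inverse_cancel _ c₂'.isUnit_Y, mul_one, mul_one, TensorProduct.map_one,
        TensorProduct.map_one]
    · rw [← TensorProduct.map_mul, Ring.inverse_mul_cancel _ hH, mul_one, TensorProduct.map_one]
  have sX : Intertwines R (TensorProduct.map 1 (cgRep μνσ h₂ (Weyl.Xinv q)))
      (tensorRep (cgRep μνσ h₃) (cgRep νσ h₄) (Weyl.Xinv q)) := by
    refine key fiveTermRight_snd_Xinv ?_
    rw [tensorRep_Xinv, map_eq_mul (cgRep μνσ h₃ (Weyl.Xinv q)), map_one_right_mul]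
    convert mX.mul mX₂ using 1
    rw [add_mul, ← TensorProduct.map_mul, ← TensorProduct.map_mul, mul_one, mul_one, one_mul,
      inverse_tensorRep_Y_mul_cgOpX h₄]
  have sY : Intertwines R (TensorProduct.map 1 (cgRep μνσ h₂ (Weyl.Y q)))
      (tensorRep (cgRep μνσ h₃) (cgRep νσ h₄) (Weyl.Y q)) := by
    refine key fiveTermRight_snd_Y ?_
    rw [tensorRep_Y, map_eq_mul (cgRep μνσ h₃ (Weyl.Xinv q)), TensorProduct.map_add_left,
      map_one_right_mul]
    convert (mX.mul mY₂).add mY using 1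
    rw [add_mul, ← TensorProduct.map_mul, ← TensorProduct.map_mul, mul_one, mul_one, one_mul,
      ← inverse_tensorRep_Y_mul_cgOpY h₄, TensorProduct.map_add_right,
      TensorProduct.map_smul_right, add_assoc]
  have sX' : Intertwines R (TensorProduct.map 1 (cgRep μνσ h₂ (Weyl.X q)))
      (tensorRep (cgRep μνσ h₃) (cgRep νσ h₄) (Weyl.X q)) := by
    refine sX.of_mul_eq_one ?_ (rep_X_Xinv _)
    rw [← TensorProduct.map_mul, rep_Xinv_X, mul_one, TensorProduct.map_one]
  refine ⟨i₁, i₂, i₁', i₂', c₁, c₂, c₁', c₂', ?_, ?_, ?_, ?_⟩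
  -- If R kills t, then the injective right side of the five-term relation kills t ⊗ v for every v,
  -- so t = 0. Surjectivity follows because both spaces have dimension N².
  · have hinj : Function.Injective R := by
      rw [injective_iff_map_eq_zero]
      intro t ht
      obtain ⟨v, hv⟩ := exists_ne (0 : Vμνσ)
      by_contra ht0
      obtain ⟨φ, hφ⟩ := exists_dual_apply_ne_zero ht0
      have e₁ := LinearMap.congr_fun hR (t ⊗ₜ v)
      simp only [LinearMap.comp_apply, LinearMap.rTensor_tmul, ht, TensorProduct.zero_tmul,
        map_zero] at e₁
      have e₂ := hK.1 (e₁.symm.trans (map_zero _).symm)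
      have e₃ := congrArg (fun s => TensorProduct.lid ℂ Vμνσ (φ.rTensor Vμνσ s)) e₂
      simp [hφ, hv] at e₃
    refine ⟨hinj, (LinearMap.injective_iff_surjective_of_finrank_eq_finrank ?_).mp hinj⟩
    rw [Module.finrank_tensorProduct, Module.finrank_tensorProduct, i₁.finrank_eq h c₁,
      i₂.finrank_eq h c₂, i₁'.finrank_eq h c₁', i₂'.finrank_eq h c₂']
  · refine key fiveTermRight_fst_Xinv ?_
    rw [cgOpX, map_eq_mul (cgRep μνσ h₃ (Weyl.Y q)), TensorProduct.map_add_left,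
      map_one_right_mul]
    convert mX.add (mY.mul mYi) using 1
    rw [smul_mul_assoc, ← TensorProduct.map_mul, mul_one, ← inverse_tensorRep_Y_add hq h₄,
      TensorProduct.map_add_right, TensorProduct.map_smul_right, add_assoc]
  · refine key fiveTermRight_fst_Y ?_
    rw [cgOpY, TensorProduct.map_smul_left, map_eq_mul (cgRep μνσ h₃ (Weyl.Y q)),
      map_one_right_mul]
    have e₁ : TensorProduct.map (1 : Module.End ℂ (cgSpace μ νσ μνσ))
        (cgRep νσ h₄ (Weyl.Xinv q) * Ring.inverse (cgRep νσ h₄ (Weyl.Y q))) =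
        TensorProduct.map 1 (cgRep νσ h₄ (Weyl.Xinv q)) *
          TensorProduct.map 1 (Ring.inverse (cgRep νσ h₄ (Weyl.Y q))) := by
      rw [← TensorProduct.map_mul, mul_one]
    rw [e₁, map_one_right_mul]
    convert (mY.mul (mX₂.mul mYi)).smul q⁻¹ using 1
    rw [smul_mul_assoc, ← TensorProduct.map_mul, ← TensorProduct.map_mul, mul_one, mul_one,
      ← tensorRep_Xinv_mul_inverse hq h₄, TensorProduct.map_smul_right]
  · exact Weyl.intertwines_of_gen (f := R)
      (μ := (Module.End.lTensorAlgHom ℂ (cgSpace μν σ μνσ) (cgSpace μ ν μν)).comp (cgRep μνσ h₂))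
      (μ' := tensorRep (cgRep μνσ h₃) (cgRep νσ h₄)) sX' sY

/-- The `6j`-symbol exists. -/
theorem exists_isSixJ (h : IsQRoot N q) (h₁ : IsRegularPair μ ν) (h₂ : IsRegularPair μν σ)
    (h₃ : IsRegularPair μ νσ) (h₄ : IsRegularPair ν σ) (iμ : IsIrred μ) (iν : IsIrred ν)
    (p₂ : IsProductRep N μν σ μνσ) (p₃ : IsProductRep N μ νσ μνσ)
    (p₄ : IsProductRep N ν σ νσ) :
    ∃ R : cgSpace μ ν μν ⊗[ℂ] cgSpace μν σ μνσ →ₗ[ℂ] cgSpace μ νσ μνσ ⊗[ℂ] cgSpace ν σ νσ,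
      IsSixJ μ ν σ μν νσ μνσ R := by
  have hM := fiveTermLeft_bijective (canonicalMap_bijective h h₃ iμ p₃)
    (canonicalMap_bijective h h₄ iν p₄)
  have := h₁.left.finite
  have := h₁.right.finite
  have := h₂.right.finite
  have := h₃.right.finite
  have := p₂.cyclic.finite
  let e := LinearEquiv.ofBijective _ hM
  -- The left side of the five-term relation is invertible. Its inverse composed with the right side
  -- commutes with the irreducible action on V_μνσ, hence has the form R ⊗ 1.
  obtain ⟨R, hR⟩ := p₂.irred.exists_eq_rTensor
    (T := e.symm.toLinearMap ∘ₗ fiveTermRight μ ν σ μν μνσ) fun w =>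
      Intertwines.comp (Intertwines.symm (e := e) (fiveTermLeft_thd w)) (fiveTermRight_thd w)
  refine ⟨R, isSixJ_iff.mpr ?_⟩
  rw [← hR]
  refine LinearMap.ext fun t => ?_
  exact e.apply_symm_apply _

end SixJ

/-! ### Flips are Kashaev's `6j`-symbols -/

section Uniqueness

variable {N : ℕ} {q : ℂ} {V₁ V₂ V₁' V₂' : Type*} [AddCommGroup V₁] [Module ℂ V₁]
  [AddCommGroup V₂] [Module ℂ V₂] [AddCommGroup V₁'] [Module ℂ V₁'] [AddCommGroup V₂']
  [Module ℂ V₂'] {ρ₁ : Weyl q →ₐ[ℂ] Module.End ℂ V₁} {ρ₂ : Weyl q →ₐ[ℂ] Module.End ℂ V₂}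
  {ρ₁' : Weyl q →ₐ[ℂ] Module.End ℂ V₁'} {ρ₂' : Weyl q →ₐ[ℂ] Module.End ℂ V₂'}

/-- A flip is determined up to a nonzero scalar by the four representations. -/
theorem IsFlip.exists_eq_smul {L M : V₁ ⊗[ℂ] V₂ →ₗ[ℂ] V₁' ⊗[ℂ] V₂'}
    (hL : IsFlip ρ₁ ρ₂ ρ₁' ρ₂' L) (hM : IsFlip ρ₁ ρ₂ ρ₁' ρ₂' M) :
    ∃ c : ℂ, c ≠ 0 ∧ L = c • M := by
  have := hL.cyclic₁.finite
  have := hL.cyclic₂.finite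
  have := hL.irred₁.1
  have := hL.irred₂.1
  let e := LinearEquiv.ofBijective M hM.bijective
  -- M⁻¹L commutes with both irreducible actions on the source, so it is a scalar.
  have key : ∀ {A : Module.End ℂ (V₁ ⊗[ℂ] V₂)} {B : Module.End ℂ (V₁' ⊗[ℂ] V₂')},
      Intertwines L A B → Intertwines M A B → Intertwines (e.symm.toLinearMap ∘ₗ L) A A :=
    fun hA hB => Intertwines.comp (Intertwines.symm (e := e) hB) hA
  have hX : Intertwines (e.symm.toLinearMap ∘ₗ L) (TensorProduct.map (ρ₁ (Weyl.X q)) 1)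
      (TensorProduct.map (ρ₁ (Weyl.X q)) 1) := by
    refine (key hL.fst_Xinv hM.fst_Xinv).of_mul_eq_one ?_ ?_
    · rw [← TensorProduct.map_mul, rep_Xinv_X, mul_one, TensorProduct.map_one]
    · rw [← TensorProduct.map_mul, rep_X_Xinv, mul_one, TensorProduct.map_one]
  obtain ⟨c, hc⟩ := hL.irred₁.tensor_exists_eq_smul_one hL.irred₂
    (T := e.symm.toLinearMap ∘ₗ L)
    (Weyl.intertwines_of_gen (f := e.symm.toLinearMap ∘ₗ L)
      (μ := (Module.End.rTensorAlgHom ℂ V₁ V₂).comp ρ₁)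
      (μ' := (Module.End.rTensorAlgHom ℂ V₁ V₂).comp ρ₁) hX (key hL.fst_Y hM.fst_Y))
    (fun w => key (hL.snd w) (hM.snd w))
  have hLM : L = c • M := by
    refine LinearMap.ext fun t => ?_
    have := congrArg e (LinearMap.congr_fun hc t)
    rw [LinearMap.comp_apply, LinearEquiv.coe_coe, LinearEquiv.apply_symm_apply,
      LinearMap.smul_apply, map_smul] at this
    exact this
  refine ⟨c, ?_, hLM⟩
  rintro rfl
  obtain ⟨t, ht⟩ := exists_ne (0 : V₁ ⊗[ℂ] V₂)
  refine ht (hL.bijective.1 ?_)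
  rw [hLM, map_zero, zero_smul, LinearMap.zero_apply]

end Uniqueness

/-! ### Triples with prescribed parameters, and the converse for `6j`-symbols -/

section Existence

variable {N : ℕ} {q : ℂ}

/-- An irreducible cyclic representation can be rescaled to one with arbitrary parameters. -/
theorem IsIrred.exists_rescale (h : IsQRoot N q) {V : Type*} [AddCommGroup V] [Module ℂ V]
    {ρ : Weyl q →ₐ[ℂ] Module.End ℂ V} (hρ : IsIrred ρ) (hc : IsCyclic ρ) {x y : ℂ} (hx : x ≠ 0)
    (hy : y ≠ 0) : ∃ τ : Weyl q →ₐ[ℂ] Module.End ℂ V,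
      IsIrred τ ∧ IsCyclic τ ∧ HasParams N τ x y := by
  have := hc.finite
  have := hρ.1
  obtain ⟨x₀, y₀, hp⟩ := hρ.exists_hasParams h
  obtain ⟨hx₀, hy₀⟩ := hc.params_ne_zero hp
  -- Scaling X by a multiplies the parameter x₀ by a^N; likewise for Y.
  obtain ⟨a, ha⟩ := IsAlgClosed.exists_pow_nat_eq (x / x₀) h.pos
  obtain ⟨b, hb⟩ := IsAlgClosed.exists_pow_nat_eq (y / y₀) h.pos
  have ha0 : a ≠ 0 := by
    rintro rfl
    rw [zero_pow h.pos.ne'] at ha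
    exact div_ne_zero hx hx₀ ha.symm
  have hb0 : b ≠ 0 := by
    rintro rfl
    rw [zero_pow h.pos.ne'] at hb
    exact div_ne_zero hy hy₀ hb.symm
  let τ : Weyl q →ₐ[ℂ] Module.End ℂ V :=
    Weyl.lift (a • ρ (Weyl.X q)) (a⁻¹ • ρ (Weyl.Xinv q)) (b • ρ (Weyl.Y q))
      (by rw [smul_mul_smul_comm, rep_X_Xinv, mul_inv_cancel₀ ha0, one_smul])
      (by rw [smul_mul_smul_comm, rep_Xinv_X, inv_mul_cancel₀ ha0, one_smul])
      (by rw [smul_mul_smul_comm, smul_mul_smul_comm, rep_X_Y, smul_comm, mul_comm])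
  have hX : τ (Weyl.X q) = a • ρ (Weyl.X q) := Weyl.lift_X ..
  have hY : τ (Weyl.Y q) = b • ρ (Weyl.Y q) := Weyl.lift_Y ..
  have hτ : HasParams N τ x y := by
    constructor
    · rw [hX, smul_pow, hp.1, ha, smul_smul, div_mul_cancel₀ _ hx₀]
    · rw [hY, smul_pow, hp.2, hb, smul_smul, div_mul_cancel₀ _ hy₀]
  refine ⟨τ, IsIrred.of_gen fun p pX pY => hρ.gen p (fun v hv => ?_) fun v hv => ?_,
    hτ.isCyclic h hy, hτ⟩
  · have := p.smul_mem a⁻¹ (pX v hv)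
    rwa [hX, LinearMap.smul_apply, smul_smul, inv_mul_cancel₀ ha0, one_smul] at this
  · have := p.smul_mem b⁻¹ (pY v hv)
    rwa [hY, LinearMap.smul_apply, smul_smul, inv_mul_cancel₀ hb0, one_smul] at this

theorem HasParams.isRegularPair (h : IsQRoot N q) {Vμ Vν : Type*} [AddCommGroup Vμ] [Module ℂ Vμ]
    [AddCommGroup Vν] [Module ℂ Vν] {μ : Weyl q →ₐ[ℂ] Module.End ℂ Vμ}
    {ν : Weyl q →ₐ[ℂ] Module.End ℂ Vν} (cμ : IsCyclic μ) (cν : IsCyclic ν) {xμ yμ xν yν : ℂ}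
    (hμ : HasParams N μ xμ yμ) (hν : HasParams N ν xν yν) (hx : xμ ≠ 0) (hy : yμ ≠ 0)
    (hyt : xμ⁻¹ * yν + yμ ≠ 0) : IsRegularPair μ ν := by
  have := cμ.finite
  have := cν.finite
  exact ⟨cμ, cν, (hμ.tensorRep h hν hx hy).isCyclic h hyt⟩

/-- Parameters of a regular triple `(μ, ν, σ)` for which `V_(μ,νσ)` and `V_(ν,σ)` have given
parameters. -/
theorem exists_triple_params {x₁ y₁ x₂ y₂ : ℂ} (hx₁ : x₁ ≠ 0) (hy₁ : y₁ ≠ 0) (hx₂ : x₂ ≠ 0)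
    (hy₂ : y₂ ≠ 0) (hD : x₁⁻¹ + y₁ * y₂⁻¹ ≠ 0) :
    ∃ xμ yμ xν yν xσ yσ : ℂ, xμ ≠ 0 ∧ yμ ≠ 0 ∧ xν ≠ 0 ∧ yν ≠ 0 ∧ xσ ≠ 0 ∧ yσ ≠ 0 ∧
      xμ⁻¹ * yν + yμ ≠ 0 ∧ xν⁻¹ * yσ + yν ≠ 0 ∧ xμ⁻¹ * (xν⁻¹ * yσ + yν) + yμ ≠ 0 ∧
      (xμ⁻¹ + yμ * (xν⁻¹ * yσ + yν)⁻¹)⁻¹ = x₁ ∧ yμ * (xν * xσ)⁻¹ * (xν⁻¹ * yσ + yν)⁻¹ = y₁ ∧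
      (xν⁻¹ + yν * yσ⁻¹)⁻¹ = x₂ ∧ yν * xσ⁻¹ * yσ⁻¹ = y₂ := by
  have hE : x₁⁻¹ * y₂ + y₁ ≠ 0 := by
    have : x₁⁻¹ * y₂ + y₁ = (x₁⁻¹ + y₁ * y₂⁻¹) * y₂ := by field_simp
    rw [this]
    exact mul_ne_zero hD hy₂
  -- Put yσ = 1 and leave s = xσ free. The equations for V_(ν,σ) give yν = y₂s and xν⁻¹ = A, so that
  -- νσ has second parameter x₂⁻¹. Those for V_(μ,νσ) then give yμ = t and xμ⁻¹ = B. Avoiding three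
  -- values of s keeps s, A and B nonzero.
  obtain ⟨s, hs⟩ := Infinite.exists_notMem_finset
    ({0, x₂⁻¹ / y₂, x₁⁻¹ * x₂⁻¹ / (x₁⁻¹ * y₂ + y₁)} : Finset ℂ)
  simp only [Finset.mem_insert, Finset.mem_singleton, not_or] at hs
  obtain ⟨hs, hs₁, hs₂⟩ := hs
  have hA : x₂⁻¹ - y₂ * s ≠ 0 := fun h0 => hs₁ (by
    rw [eq_div_iff hy₂, mul_comm]
    exact (sub_eq_zero.mp h0).symm)
  have hB : x₁⁻¹ * x₂⁻¹ - (x₁⁻¹ * y₂ + y₁) * s ≠ 0 := fun h0 => hs₂ (by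
    rw [eq_div_iff hE, mul_comm]
    exact (sub_eq_zero.mp h0).symm)
  obtain ⟨A, hA'⟩ : ∃ A, A = x₂⁻¹ - y₂ * s := ⟨_, rfl⟩
  obtain ⟨t, ht⟩ : ∃ t, t = y₁ * s / (A * x₂) := ⟨_, rfl⟩
  obtain ⟨B, hB'⟩ : ∃ B, B = x₁⁻¹ - t * x₂ := ⟨_, rfl⟩
  rw [← hA'] at hA
  have ht0 : t ≠ 0 := by
    rw [ht]
    exact div_ne_zero (mul_ne_zero hy₁ hs) (mul_ne_zero hA hx₂)
  have htA : t * x₂ * A = y₁ * s := by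
    rw [ht]
    field_simp
  have hBA : B * A = x₁⁻¹ * x₂⁻¹ - (x₁⁻¹ * y₂ + y₁) * s := by
    rw [hB', sub_mul, htA, hA']
    ring
  have hB0 : B ≠ 0 := left_ne_zero_of_mul (hBA ▸ hB)
  have hνσ : A⁻¹⁻¹ * 1 + y₂ * s = x₂⁻¹ := by
    rw [inv_inv, hA']
    ring
  -- After cancelling A, the second parameter of μν is s(x₁⁻¹y₂ + y₁), which is nonzero by the
  -- hypothesis on the flip.
  have hμν : (B * (y₂ * s) + t) * A = s * (x₁⁻¹ * y₂ + y₁) * A := by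
    have htA' : t * A = y₁ * s * x₂⁻¹ := by
      rw [← htA]
      field_simp
    rw [add_mul, htA', mul_right_comm B, hBA, hA']
    ring
  have hμνσ : B * x₂⁻¹ + t = x₁⁻¹ * x₂⁻¹ := by
    rw [hB', sub_mul, mul_assoc t, mul_inv_cancel₀ hx₂]
    ring
  refine ⟨B⁻¹, t, A⁻¹, y₂ * s, s, 1, inv_ne_zero hB0, ht0, inv_ne_zero hA, mul_ne_zero hy₂ hs, hs,
    one_ne_zero, ?_, ?_, ?_, ?_, ?_, ?_, ?_⟩
  · rw [inv_inv, mul_right_cancel₀ hA hμν]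
    exact mul_ne_zero hs hE
  · rw [hνσ]
    exact inv_ne_zero hx₂
  · rw [hνσ, inv_inv, hμνσ]
    exact mul_ne_zero (inv_ne_zero hx₁) (inv_ne_zero hx₂)
  · rw [hνσ, inv_inv, inv_inv, hB', sub_add_cancel, inv_inv]
  · rw [hνσ, inv_inv, mul_inv, inv_inv, ← mul_assoc, mul_assoc, mul_comm s⁻¹, ← mul_assoc,
      mul_right_comm t, htA, mul_assoc, mul_inv_cancel₀ hs, mul_one]
  · rw [inv_inv, inv_one, mul_one, hA', sub_add_cancel, inv_inv]
  · rw [inv_one, mul_one, mul_assoc, mul_inv_cancel₀ hs, mul_one]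

variable {V₁ V₂ V₁' V₂' : Type u} [AddCommGroup V₁] [Module ℂ V₁]
  [AddCommGroup V₂] [Module ℂ V₂] [AddCommGroup V₁'] [Module ℂ V₁'] [AddCommGroup V₂']
  [Module ℂ V₂'] {ρ₁ : Weyl q →ₐ[ℂ] Module.End ℂ V₁} {ρ₂ : Weyl q →ₐ[ℂ] Module.End ℂ V₂}
  {ρ₁' : Weyl q →ₐ[ℂ] Module.End ℂ V₁'} {ρ₂' : Weyl q →ₐ[ℂ] Module.End ℂ V₂'}
  {L : V₁ ⊗[ℂ] V₂ →ₗ[ℂ] V₁' ⊗[ℂ] V₂'}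

/-- Two flips correspond to each other if the representations on their targets have the same
parameters. -/
theorem IsFlip.exists_isRepIso (h : IsQRoot N q) (hL : IsFlip ρ₁ ρ₂ ρ₁' ρ₂' L)
    {U₁ U₂ U₁' U₂' : Type*} [AddCommGroup U₁] [Module ℂ U₁] [AddCommGroup U₂] [Module ℂ U₂]
    [AddCommGroup U₁'] [Module ℂ U₁'] [AddCommGroup U₂'] [Module ℂ U₂']
    {τ₁ : Weyl q →ₐ[ℂ] Module.End ℂ U₁} {τ₂ : Weyl q →ₐ[ℂ] Module.End ℂ U₂}
    {τ₁' : Weyl q →ₐ[ℂ] Module.End ℂ U₁'} {τ₂' : Weyl q →ₐ[ℂ] Module.End ℂ U₂'}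
    {M : U₁ ⊗[ℂ] U₂ →ₗ[ℂ] U₁' ⊗[ℂ] U₂'} (hM : IsFlip τ₁ τ₂ τ₁' τ₂' M) {x₁ y₁ x₂ y₂ : ℂ}
    (hρ₁ : HasParams N ρ₁' x₁ y₁) (hρ₂ : HasParams N ρ₂' x₂ y₂)
    (hτ₁ : HasParams N τ₁' x₁ y₁) (hτ₂ : HasParams N τ₂' x₂ y₂) :
    ∃ (e₁ : V₁ ≃ₗ[ℂ] U₁) (e₂ : V₂ ≃ₗ[ℂ] U₂) (e₁' : V₁' ≃ₗ[ℂ] U₁') (e₂' : V₂' ≃ₗ[ℂ] U₂') (c : ℂ),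
      IsRepIso ρ₁ τ₁ e₁ ∧ IsRepIso ρ₂ τ₂ e₂ ∧ IsRepIso ρ₁' τ₁' e₁' ∧ IsRepIso ρ₂' τ₂' e₂' ∧
      c ≠ 0 ∧ (TensorProduct.congr e₁' e₂').toLinearMap ∘ₗ L =
        c • (M ∘ₗ (TensorProduct.congr e₁ e₂).toLinearMap) := by
  obtain ⟨pρ₁, pρ₂, -⟩ := hL.params h hρ₁ hρ₂
  obtain ⟨pτ₁, pτ₂, -⟩ := hM.params h hτ₁ hτ₂
  obtain ⟨e₁, i₁⟩ := hL.irred₁.exists_isRepIso h hM.irred₁ hL.cyclic₁ hM.cyclic₁ pρ₁ pτ₁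
  obtain ⟨e₂, i₂⟩ := hL.irred₂.exists_isRepIso h hM.irred₂ hL.cyclic₂ hM.cyclic₂ pρ₂ pτ₂
  obtain ⟨e₁', i₁'⟩ := hL.irred₁'.exists_isRepIso h hM.irred₁' hL.cyclic₁' hM.cyclic₁' hρ₁ hτ₁
  obtain ⟨e₂', i₂'⟩ := hL.irred₂'.exists_isRepIso h hM.irred₂' hL.cyclic₂' hM.cyclic₂' hρ₂ hτ₂
  have hM' : IsFlip ρ₁ ρ₂ ρ₁' ρ₂' ((TensorProduct.congr e₁' e₂').symm.toLinearMap ∘ₗ M ∘ₗ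
      (TensorProduct.congr e₁ e₂).toLinearMap) := by
    refine hM.transport i₁ i₂ i₁' i₂' one_ne_zero (LinearMap.ext fun t => ?_)
    rw [one_smul]
    exact (TensorProduct.congr e₁' e₂').apply_symm_apply _
  obtain ⟨c, hc, hLM⟩ := hL.exists_eq_smul hM'
  refine ⟨e₁, e₂, e₁', e₂', c, i₁, i₂, i₁', i₂', hc, LinearMap.ext fun t => ?_⟩
  rw [hLM, LinearMap.comp_smul, LinearMap.smul_apply, LinearMap.smul_apply]
  exact congrArg (c • ·) ((TensorProduct.congr e₁' e₂').apply_symm_apply _)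

/-- For the converse, a `6j`-symbol is constructed whose target has the same parameters as that of
`L`. Flips with this property correspond to each other up to a scalar. -/
theorem isKashaevSixJ_iff_isFlip (h : IsQRoot N q) :
    IsKashaevSixJ N ρ₁ ρ₂ ρ₁' ρ₂' L ↔ IsFlip ρ₁ ρ₂ ρ₁' ρ₂' L := by
  constructor
  · rintro ⟨Vμ, Vν, Vσ, Vμν, Vνσ, Vμνσ, _, _, _, _, _, _, _, _, _, _, _, _, μ, ν, σ, μν, νσ, μνσ,
      h₁, h₂, h₃, h₄, R, e₁, e₂, e₁', e₂', c, iμ, iν, iσ, -, p₁, p₄, p₂, p₃, hR, i₁, i₂, i₁', i₂',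
      hc, hL⟩
    exact (isFlip_of_isSixJ h iμ iν iσ p₁ p₂ p₃ p₄ hR).transport i₁ i₂ i₁' i₂' hc hL
  · intro hL
    have := hL.irred₁'.1
    have := hL.irred₂'.1
    have := hL.cyclic₁'.finite
    have := hL.cyclic₂'.finite
    obtain ⟨x₁, y₁, q₁⟩ := hL.irred₁'.exists_hasParams h
    obtain ⟨x₂, y₂, q₂⟩ := hL.irred₂'.exists_hasParams h
    obtain ⟨hx₁, hy₁⟩ := hL.cyclic₁'.params_ne_zero q₁
    obtain ⟨hx₂, hy₂⟩ := hL.cyclic₂'.params_ne_zero q₂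
    obtain ⟨xμ, yμ, xν, yν, xσ, yσ, hxμ, hyμ, hxν, hyν, hxσ, hyσ, hμν, hνσ, hμνσ, E₁, E₂, E₃, E₄⟩ :=
      exists_triple_params hx₁ hy₁ hx₂ hy₂ (hL.params h q₁ q₂).2.2
    have hassoc : (xμ * xν)⁻¹ * yσ + (xμ⁻¹ * yν + yμ) = xμ⁻¹ * (xν⁻¹ * yσ + yν) + yμ := by
      rw [mul_inv]
      ring
    -- All six representations are put on the space V₁', as rescalings of ρ₁'.
    have ex := fun {x y : ℂ} => hL.irred₁'.exists_rescale h hL.cyclic₁' (x := x) (y := y)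
    obtain ⟨μ, iμ, cμ, qμ⟩ := ex hxμ hyμ
    obtain ⟨ν, iν, cν, qν⟩ := ex hxν hyν
    obtain ⟨σ, iσ, cσ, qσ⟩ := ex hxσ hyσ
    obtain ⟨μν, iμν, cμν, qμν⟩ := ex (mul_ne_zero hxμ hxν) hμν
    obtain ⟨νσ, iνσ, cνσ, qνσ⟩ := ex (mul_ne_zero hxν hxσ) hνσ
    obtain ⟨μνσ, iμνσ, cμνσ, qμνσ⟩ := ex (mul_ne_zero hxμ (mul_ne_zero hxν hxσ)) hμνσ
    have qμνσ' : HasParams N μνσ (xμ * xν * xσ) ((xμ * xν)⁻¹ * yσ + (xμ⁻¹ * yν + yμ)) := by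
      rwa [hassoc, mul_assoc]
    have h₁ := qμ.isRegularPair h cμ cν qν hxμ hyμ hμν
    have h₂ := qμν.isRegularPair h cμν cσ qσ (mul_ne_zero hxμ hxν) hμν (hassoc ▸ hμνσ)
    have h₃ := qμ.isRegularPair h cμ cνσ qνσ hxμ hyμ hμνσ
    have h₄ := qν.isRegularPair h cν cσ qσ hxν hyν hνσ
    have h₅ := (qμ.tensorRep h qν hxμ hyμ).isRegularPair h h₁.tensor cσ qσ (mul_ne_zero hxμ hxν) hμν
      (hassoc ▸ hμνσ)
    have p₁ : IsProductRep N μ ν μν := ⟨iμν, cμν, _, _, _, _, qμ, qν, qμν⟩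
    have p₂ : IsProductRep N μν σ μνσ := ⟨iμνσ, cμνσ, _, _, _, _, qμν, qσ, qμνσ'⟩
    have p₃ : IsProductRep N μ νσ μνσ := ⟨iμνσ, cμνσ, _, _, _, _, qμ, qνσ, qμνσ⟩
    have p₄ : IsProductRep N ν σ νσ := ⟨iνσ, cνσ, _, _, _, _, qν, qσ, qνσ⟩
    obtain ⟨R, hR⟩ := exists_isSixJ h h₁ h₂ h₃ h₄ iμ iν p₂ p₃ p₄
    -- Canonical maps are flips, so `IsFlip.params` yields the parameters of V_(μ,νσ) and V_(ν,σ).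
    -- By the choice of the triple they are those of ρ₁' and ρ₂'.
    have q₁' := ((isFlip_canonicalMap h h₃ iμ iνσ p₃).params h qμ qνσ).1
    have q₂' := ((isFlip_canonicalMap h h₄ iν iσ p₄).params h qν qσ).1
    rw [E₁, E₂] at q₁'
    rw [E₃, E₄] at q₂'
    obtain ⟨e₁, e₂, e₁', e₂', c, i₁, i₂, i₁', i₂', hc, he⟩ := hL.exists_isRepIso h
      (isFlip_of_isSixJ (h₁ := h₁) (h₂ := h₂) (h₃ := h₃) (h₄ := h₄) h iμ iν iσ p₁ p₂ p₃ p₄ hR)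
      q₁ q₂ q₁' q₂'
    exact ⟨V₁', V₁', V₁', V₁', V₁', V₁', _, _, _, _, _, _, _, _, _, _, _, _, μ, ν, σ, μν, νσ, μνσ,
      h₁, h₂, h₃, h₄, R, e₁, e₂, e₁', e₂', c, iμ, iν, iσ,
      ⟨cμ, cν, cσ, h₁.tensor, h₄.tensor, h₅.tensor⟩, p₁, p₄, p₂, p₃, hR, i₁, i₂, i₁', i₂', hc, he⟩

end Existence

end QTeich

end

theorem theorem1 {N : ℕ} {q : ℂ} (h : QTeich.IsQRoot N q) {V₁ V₂ V₁' V₂' : Type u}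
    [AddCommGroup V₁] [Module ℂ V₁] [AddCommGroup V₂] [Module ℂ V₂]
    [AddCommGroup V₁'] [Module ℂ V₁'] [AddCommGroup V₂'] [Module ℂ V₂']
    (L : V₁ ⊗[ℂ] V₂ →ₗ[ℂ] V₁' ⊗[ℂ] V₂') :
    (∀ (ρ₁ : QTeich.Weyl q →ₐ[ℂ] Module.End ℂ V₁) (ρ₂ : QTeich.Weyl q →ₐ[ℂ] Module.End ℂ V₂)
      (ρ₁' : QTeich.Weyl q →ₐ[ℂ] Module.End ℂ V₁') (ρ₂' : QTeich.Weyl q →ₐ[ℂ] Module.End ℂ V₂'),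
      List.TFAE [
        QTeich.IsCanonicalMap N ρ₁ ρ₂ ρ₁' ρ₂' L,
        QTeich.IsKashaevSixJ N ρ₁ ρ₂ ρ₁' ρ₂' L,
        QTeich.IsWeylIntertwiner h ρ₁ ρ₂ ρ₁' ρ₂' L]) ∧
    List.TFAE [
      ∃ (ρ₁ : QTeich.Weyl q →ₐ[ℂ] Module.End ℂ V₁) (ρ₂ : QTeich.Weyl q →ₐ[ℂ] Module.End ℂ V₂)
        (ρ₁' : QTeich.Weyl q →ₐ[ℂ] Module.End ℂ V₁') (ρ₂' : QTeich.Weyl q →ₐ[ℂ] Module.End ℂ V₂'),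
        QTeich.IsCanonicalMap N ρ₁ ρ₂ ρ₁' ρ₂' L,
      ∃ (ρ₁ : QTeich.Weyl q →ₐ[ℂ] Module.End ℂ V₁) (ρ₂ : QTeich.Weyl q →ₐ[ℂ] Module.End ℂ V₂)
        (ρ₁' : QTeich.Weyl q →ₐ[ℂ] Module.End ℂ V₁') (ρ₂' : QTeich.Weyl q →ₐ[ℂ] Module.End ℂ V₂'),
        QTeich.IsKashaevSixJ N ρ₁ ρ₂ ρ₁' ρ₂' L,
      QTeich.IsLocalIntertwiner h L] := by
  refine ⟨fun ρ₁ ρ₂ ρ₁' ρ₂' => ?_, ?_⟩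
  · rw [QTeich.isCanonicalMap_iff_isFlip h, QTeich.isKashaevSixJ_iff_isFlip h,
      QTeich.isWeylIntertwiner_iff_isFlip h]
    tfae_have 1 ↔ 2 := Iff.rfl
    tfae_have 2 ↔ 3 := Iff.rfl
    tfae_finish
  · simp only [QTeich.isCanonicalMap_iff_isFlip h, QTeich.isKashaevSixJ_iff_isFlip h,
      QTeich.isLocalIntertwiner_iff_exists_isFlip h]
    tfae_have 1 ↔ 2 := Iff.rfl
    tfae_have 2 ↔ 3 := Iff.rfl
    tfae_finish
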